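/- **Theorem.** *Model.* An insurer has $n$ lines of business and there are $m$ classes of events. The events of class $k$ arrive along a Poisson process $N^{(k)}$ with intensity $\beta_k>0$; the processes $N^{(1)},\dots,N^{(m)}$ are independent; $\beta=\sum_k\beta_k$. An event of class $k$ causes a claim in line $j$ with probability $p_{kj}\in[0,1]$, independently over the lines. The claim severities $(U_1,\dots,U_n)\in[0,\infty)^n$ of an event have a given joint law (for instance a product law), the same for all classes, with finite means. Everything is independent over different events. Let $\eta_1\ge\eta>0$ and $\delta>0$. For a vector $R=(R_1,\dots,R_n)$ of Borel retained loss functions with $0\le R_j(\alpha)\le\alpha$ let $$G^{R}=\sum_{A\subseteq\{1,\dots,n\}}\Big[\sum_{i=1}^m\frac{\beta_i}{\beta}\prod_{z\in A}p_{iz}\prod_{z\notin A}(1-p_{iz})\Big]\,\mathrm{Law}\Big(\sum_{z\in A}R_z(U_z)\Big),\qquad G=G^{\mathrm{id}},$$ $$p=(1+\eta)\beta\int\alpha\,dG,\qquad q_R=(1+\eta_1)\beta\Big(\int\alpha\,dG-\int\alpha\,dG^R\Big),\qquad p_R=p-q_R .$$ For every line $j$ let $\mathcal F_j$ be a family of Borel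 retained loss functions ($0\le R(\alpha)\le\alpha$) that is sequentially compact for pointwise convergence; this includes the families of all proportional contracts $R(\alpha)=b\alpha$ ($0\le b\le1$), all excess-of-loss contracts $R(\alpha)=\min\{\alpha,K\}$ ($0\le K\le\infty$) and all limited excess-of-loss contracts $R(\alpha)=\min\{\alpha,K\}+(\alpha-K-L)^+$ ($0\le K,L\le\infty$). Put $\mathcal F=\mathcal F_1\times\dots\times\mathcal F_n$, and assume that $p_R>0$ for at least one $R\in\mathcal F$ (true if full retention is allowed in every line and the mean claim is positive). *Control problem.* Let $X_j(t)=p_jt-\sum_{i\le N_j(t)}U_j(i)$ be the risk process of line $j$, where $N_j$ counts the claims of line $j$, $U_j(i)$ are their severities and $p_j=(1+\eta)\big(\sum_k\beta_kp_{kj}\big)E[U_j]$. Let $(\mathcal F_t)$ be the filtration generated by $(X_1,\dots,X_n)$, and $\mathcal F_{t-}=\sigma(\mathcal F_s:s<t)$. An admissible strategy $\pi=(R,D)$ consists of an $\mathcal F$-valued process $R_t=(R_{1,t},\dots,R_{n,t})$ such that, for each $j$, $(\omega,\alpha,t)\mapsto R_{j,t}(\omega,\alpha)$ is measurable and $R_{j,t}(\cdot,\alpha)$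 is $\mathcal F_{t-}$-measurable for all $t,\alpha\ge0$, and of a nondecreasing left-continuous process $D$ with $D_0=0$ and $D_t$ $\mathcal F_{t-}$-measurable. With $\tau_{j,i}$ the time of the $i$-th claim of line $j$, the surplus is $$X^\pi(t)=x+\int_0^tp_{R_s}\,ds-\sum_{j=1}^n\sum_{i\le N_j(t)}R_{j,\tau_{j,i}}(U_j(i))-D_t ,$$ $\tau^\pi=\inf\{t\ge0:X^\pi(t)<0\}$, $V^\pi(x)=E\big[\int_{[0,\tau^\pi)}e^{-\delta s}\,dD_s\big]$ (a lump sum $D_{s+}-D_s$ is counted at the time $s$), and $V(x)=\sup_\pi V^\pi(x)$; thus $V(x)=0$ for $x<0$. *Claim.* $V(x)<\infty$ for every $x\ge0$, and $V$ is a viscosity solution at every $x\ge0$ of the HJB equation $$\max\Big\{1-V'(x),\ \sup_{R\in\mathcal F}\mathcal L_R(V)(x)\Big\}=0,\qquad \mathcal L_R(V)(x)=p_RV'(x)-(\delta+\beta)V(x)+\beta\int_{[0,x]}V(x-\alpha)\,dG^R(\alpha).$$ That is: $V$ is locally Lipschitz on $[0,\infty)$ and, writing $H(x,d)$ for the left-hand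 side with $V'(x)$ replaced by $d$, for every $x\ge0$ and $d\in\mathbb R$: $H(x,d)\ge0$ whenever $\liminf_{h\to0^-}\frac{V(x+h)-V(x)}h\ge d\ge\limsup_{h\to0^+}\frac{V(x+h)-V(x)}h$, and $H(x,d)\le0$ whenever $\liminf_{h\to0^+}\frac{V(x+h)-V(x)}h\ge d\ge\limsup_{h\to0^-}\frac{V(x+h)-V(x)}h$. (At $x=0$ the left quotients use $V=0$ on $(-\infty,0)$.) -/

import Mathlib

open MeasureTheory ProbabilityTheory Filter Topology Set
open scoped NNReal ENNReal

namespace ThinningRisk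

noncomputable section

/-- Retained loss functions (of a claim severity in `[0, ∞)`). -/
abbrev Retention := ℝ≥0 → ℝ≥0

/-- The parameters of the risk model with `n` lines of business and `m` classes of events. -/
structure RiskModel (m n : ℕ) where
  /-- intensity of the Poisson process of events of each class -/
  β : Fin m → ℝ
  β_pos : ∀ k, 0 < β k
  /-- `thin k j` : probability that an event of class `k` causes a claim in line `j` -/
  thin : Fin m → Fin n → unitInterval
  /-- joint law of the severities `(U_1, …, U_n)` in the lines (a product measure when the
  severities in different lines are independent) -/
  sev : Measure (Fin n → ℝ≥0)
  sev_prob : IsProbabilityMeasure sev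
  sev_integrable : ∀ j, Integrable (fun u : Fin n → ℝ≥0 => (u j : ℝ)) sev
  /-- safety loading of the insurer -/
  η : ℝ
  η_pos : 0 < η
  /-- safety loading of the reinsurer -/
  η₁ : ℝ
  η_le : η ≤ η₁
  /-- discount rate -/
  δ : ℝ
  δ_pos : 0 < δ

/-- A scenario lists, for the `e`-th event of class `k`: the time elapsed since the previous event
of that class, the lines that it hits, and the severities in the lines. -/
abbrev Scenario (m n : ℕ) := Fin m × ℕ → ℝ × (Fin n → Bool) × (Fin n → ℝ≥0)

namespace RiskModel

variable {m n : ℕ} (M : RiskModel m n)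

instance : IsProbabilityMeasure M.sev := M.sev_prob

instance (k : Fin m) : IsProbabilityMeasure (expMeasure (M.β k)) :=
  isProbabilityMeasure_expMeasure (M.β_pos k)

/-- Law of the data of one event of class `k`: exponential waiting time, independent thinning
indicators of the lines, and severities. -/
def eventLaw (k : Fin m) : Measure (ℝ × (Fin n → Bool) × (Fin n → ℝ≥0)) :=
  (expMeasure (M.β k)).prod
    ((Measure.pi fun j => bernoulliMeasure true false (M.thin k j)).prod M.sev)

instance (k : Fin m) : IsProbabilityMeasure (M.eventLaw k) := by
  unfold eventLaw; infer_instance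

/-- The probability measure on scenarios: all events are independent, so that the events of the
classes arrive along independent Poisson processes with intensities `β k`. -/
def prob : Measure (Scenario m n) :=
  Measure.infinitePi fun i : Fin m × ℕ => M.eventLaw i.1

/-- Total intensity `∑ β_k`. -/
def totalβ : ℝ := ∑ k, M.β k

/-- Probability that a claim-generating event hits exactly the set `A` of lines. -/
def hitWeight (A : Finset (Fin n)) : ℝ :=
  ∑ k, M.β k / M.totalβ *
    ((∏ z ∈ A, (M.thin k z : ℝ)) * ∏ z ∈ Aᶜ, (1 - (M.thin k z : ℝ)))

/-- The distribution `G^R` of the retained part of the total claim of one event. -/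
def claimDist (R : Fin n → Retention) : Measure ℝ :=
  ∑ A : Finset (Fin n), ENNReal.ofReal (M.hitWeight A) •
    M.sev.map fun u => ((∑ z ∈ A, R z (u z) : ℝ≥0) : ℝ)

/-- Mean of `G^R`. -/
def claimMean (R : Fin n → Retention) : ℝ := ∫ a, a ∂(M.claimDist R)

/-- Gross premium rate `p` (no reinsurance, `R = id` in every line). -/
def grossPremium : ℝ := (1 + M.η) * M.totalβ * M.claimMean fun _ => id

/-- Reinsurance premium rate `q_R`. -/
def reinsurancePremium (R : Fin n → Retention) : ℝ :=
  (1 + M.η₁) * M.totalβ * ((M.claimMean fun _ => id) - M.claimMean R)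

/-- Net premium rate `p_R = p - q_R`. -/
def premium (R : Fin n → Retention) : ℝ := M.grossPremium - M.reinsurancePremium R

/-- Premium rate of line `j` without reinsurance. -/
def linePremium (j : Fin n) : ℝ :=
  (1 + M.η) * (∑ k, M.β k * (M.thin k j : ℝ)) * ∫ u, (u j : ℝ) ∂M.sev

end RiskModel

variable {m n : ℕ}

/-- Time of the event with index `i = (class, number)`. -/
def eventTime (ω : Scenario m n) (i : Fin m × ℕ) : ℝ :=
  ∑ e ∈ Finset.range (i.2 + 1), (ω (i.1, e)).1

/-- Total amount retained up to time `t` on the claims of line `j`, when the retained loss function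
in force at time `s` is `r s`. -/
def retainedClaims (ω : Scenario m n) (j : Fin n) (r : ℝ → Retention) (t : ℝ) : ℝ :=
  (∑' i : Fin m × ℕ,
    if eventTime ω i ≤ t ∧ (ω i).2.1 j = true then
      ((r (eventTime ω i) ((ω i).2.2 j) : ℝ≥0) : ℝ≥0∞) else 0).toReal

namespace RiskModel

variable (M : RiskModel m n)

/-- The risk process `X_j(t)` of line `j` (no reinsurance, no dividends). -/
def lineReserve (j : Fin n) (t : ℝ) (ω : Scenario m n) : ℝ :=
  M.linePremium j * t - retainedClaims ω j (fun _ => id) t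

/-- `F_t = σ(X_j(s) : 0 ≤ s ≤ t, 1 ≤ j ≤ n)`. -/
abbrev history (t : ℝ) : MeasurableSpace (Scenario m n) :=
  ⨆ (j : Fin n) (s ∈ Icc (0 : ℝ) t), MeasurableSpace.comap (M.lineReserve j s) inferInstance

/-- `F_{t-} = σ(F_s : 0 ≤ s < t)`. -/
abbrev historyBefore (t : ℝ) : MeasurableSpace (Scenario m n) :=
  ⨆ s ∈ Ico (0 : ℝ) t, M.history s

/-- Admissible control strategies `(R, D)`, where the retained loss functions of line `j` are chosen
in the family `F j`. Time runs through `[0, ∞)`; the values at negative times are immaterial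
(`D` is extended by `0`). -/
structure Strategy (F : Fin n → Set Retention) where
  R : ℝ → Scenario m n → Fin n → Retention
  R_mem : ∀ t ω j, R t ω j ∈ F j
  R_measurable : ∀ j, Measurable fun q : Scenario m n × ℝ≥0 × ℝ => R q.2.2 q.1 j q.2.1
  R_predictable : ∀ t, 0 ≤ t → ∀ j α, Measurable[M.historyBefore t] fun ω => R t ω j α
  D : ℝ → Scenario m n → ℝ
  D_zero : ∀ t, t ≤ 0 → ∀ ω, D t ω = 0
  D_mono : ∀ ω, Monotone fun t => D t ω
  D_leftCont : ∀ ω t, ContinuousWithinAt (fun s => D s ω) (Iic t) t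
  D_predictable : ∀ t, 0 ≤ t → Measurable[M.historyBefore t] (D t)

namespace Strategy

variable {M} {F : Fin n → Set Retention} (π : M.Strategy F)

/-- The controlled surplus `X^π(t)` with initial surplus `x`. -/
def surplus (x : ℝ) (ω : Scenario m n) (t : ℝ) : ℝ :=
  x + (∫ s in (0 : ℝ)..t, M.premium (π.R s ω))
    - (∑ j, retainedClaims ω j (fun s => π.R s ω j) t) - π.D t ω

/-- Time of ruin `inf {t ≥ 0 : X^π(t) < 0}` (`⊤` if there is no ruin). -/
def ruinTime (x : ℝ) (ω : Scenario m n) : EReal :=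
  sInf ((fun t : ℝ => (t : EReal)) '' {t | 0 ≤ t ∧ π.surplus x ω t < 0})

/-- Discounted dividends until ruin. As `D` is left-continuous, the integral over `[0, τ)` of
`exp (-δ s)` against `dD_s` counts the lump sum `D_{s+} - D_s` for `s < τ` (also at `s = 0`), and not
a lump sum at the time of ruin. -/
def discountedDividends (x : ℝ) (ω : Scenario m n) : ℝ≥0∞ :=
  ∫⁻ s in {s : ℝ | 0 ≤ s ∧ (s : EReal) < π.ruinTime x ω}, ENNReal.ofReal (Real.exp (-M.δ * s))
    ∂(π.D_mono ω).stieltjesFunction.measure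

/-- `V^π(x)`. -/
def value (x : ℝ) : ℝ≥0∞ := ∫⁻ ω, π.discountedDividends x ω ∂M.prob

end Strategy

/-- The optimal value function as an extended number, `V(x) = sup_π V^π(x)`. It is `0` for `x < 0`,
where ruin is immediate. -/
def optimalValueENN (F : Fin n → Set Retention) (x : ℝ) : ℝ≥0∞ := ⨆ π : M.Strategy F, π.value x

/-- The optimal value function `V`. -/
def optimalValue (F : Fin n → Set Retention) (x : ℝ) : ℝ := (M.optimalValueENN F x).toReal

/-- `L_R(u)(x)` with `v` in the place of `u x` and `d` in the place of the derivative of `u` at `x`. -/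
def generator (R : Fin n → Retention) (x v d : ℝ) (u : ℝ → ℝ) : ℝ :=
  M.premium R * d - (M.δ + M.totalβ) * v
    + M.totalβ * ∫ a in Icc 0 x, u (x - a) ∂(M.claimDist R)

/-- The left-hand side of the HJB equation `max {1 - u'(x), sup_R L_R(u)(x)} = 0`. -/
def hjb (F : Fin n → Set Retention) (x v d : ℝ) (u : ℝ → ℝ) : ℝ :=
  max (1 - d) (sSup {y | ∃ R : Fin n → Retention, (∀ j, R j ∈ F j) ∧ y = M.generator R x v d u})

end RiskModel

/-! Viscosity solutions on `[0, ∞)` of `L(x, u(x), u'(x), u) = 0`. -/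

/-- `d` is a super-differential of `u` at `x`. -/
def IsSuperdifferential (u : ℝ → ℝ) (x d : ℝ) : Prop :=
  (d : EReal) ≤ liminf (fun h : ℝ => (((u (x + h) - u x) / h : ℝ) : EReal)) (𝓝[<] 0) ∧
    limsup (fun h : ℝ => (((u (x + h) - u x) / h : ℝ) : EReal)) (𝓝[>] 0) ≤ (d : EReal)

/-- `d` is a sub-differential of `u` at `x`. -/
def IsSubdifferential (u : ℝ → ℝ) (x d : ℝ) : Prop :=
  (d : EReal) ≤ liminf (fun h : ℝ => (((u (x + h) - u x) / h : ℝ) : EReal)) (𝓝[>] 0) ∧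
    limsup (fun h : ℝ => (((u (x + h) - u x) / h : ℝ) : EReal)) (𝓝[<] 0) ≤ (d : EReal)

def IsViscositySubsolutionAt (L : ℝ → ℝ → ℝ → (ℝ → ℝ) → ℝ) (u : ℝ → ℝ) (x : ℝ) : Prop :=
  LocallyLipschitzOn (Ici 0) u ∧ ∀ d, IsSuperdifferential u x d → 0 ≤ L x (u x) d u

def IsViscositySupersolutionAt (L : ℝ → ℝ → ℝ → (ℝ → ℝ) → ℝ) (u : ℝ → ℝ) (x : ℝ) : Prop :=
  LocallyLipschitzOn (Ici 0) u ∧ ∀ d, IsSubdifferential u x d → L x (u x) d u ≤ 0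

def IsViscositySolutionAt (L : ℝ → ℝ → ℝ → (ℝ → ℝ) → ℝ) (u : ℝ → ℝ) (x : ℝ) : Prop :=
  IsViscositySubsolutionAt L u x ∧ IsViscositySupersolutionAt L u x

/-! Reinsurance families. -/

/-- A family of retained loss functions: Borel functions with `0 ≤ R(α) ≤ α`, such that every
sequence in the family has a subsequence that converges pointwise to a member of the family. -/
structure IsReinsuranceFamily (𝓕 : Set Retention) : Prop where
  measurable : ∀ R ∈ 𝓕, Measurable R
  le_self : ∀ R ∈ 𝓕, ∀ α, R α ≤ α
  isSeqCompact : IsSeqCompact 𝓕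

/-- Proportional reinsurance `R(α) = b α`, `0 ≤ b ≤ 1`. -/
def proportional : Set Retention := {R | ∃ b : ℝ≥0, b ≤ 1 ∧ R = fun α => b * α}

/-- Excess of loss reinsurance `R(α) = min {α, K}`, `0 ≤ K ≤ ∞`. -/
def excessOfLoss : Set Retention :=
  {R | ∃ K : ℝ≥0∞, R = fun α : ℝ≥0 => (min (α : ℝ≥0∞) K).toNNReal}

/-- Limited excess of loss reinsurance `R(α) = min {α, K} + (α - K - L)^+`, `0 ≤ K, L ≤ ∞`
(subtraction is truncated at `0`). -/
def limitedExcessOfLoss : Set Retention :=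
  {R | ∃ K L : ℝ≥0∞, R = fun α : ℝ≥0 => (min (α : ℝ≥0∞) K + ((α : ℝ≥0∞) - K - L)).toNNReal}

theorem isReinsuranceFamily_proportional : IsReinsuranceFamily proportional where
  measurable := by
    rintro R ⟨b, -, rfl⟩
    fun_prop
  le_self := by
    rintro R ⟨b, hb, rfl⟩ α
    exact mul_le_of_le_one_left zero_le hb
  isSeqCompact := by
    have h : proportional = (fun (b : ℝ≥0) (α : ℝ≥0) => b * α) '' Icc 0 1 := by
      ext R
      constructor
      · rintro ⟨b, hb, rfl⟩
        exact ⟨b, ⟨zero_le, hb⟩, rfl⟩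
      · rintro ⟨b, hb, rfl⟩
        exact ⟨b, hb.2, rfl⟩
    rw [h]
    refine IsSeqCompact.image ?_ isCompact_Icc.isSeqCompact
    exact (continuous_pi fun α => by fun_prop).seqContinuous

theorem min_add_sub_sub_le (a K L : ℝ≥0∞) : min a K + (a - K - L) ≤ a := by
  calc min a K + (a - K - L) ≤ min a K + (a - K) := add_le_add_right tsub_le_self _
    _ = a := by
      rcases le_total a K with h | h
      · rw [min_eq_left h, tsub_eq_zero_of_le h, add_zero]
      · rw [min_eq_right h, add_tsub_cancel_of_le h]

theorem isReinsuranceFamily_limitedExcessOfLoss : IsReinsuranceFamily limitedExcessOfLoss where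
  measurable := by
    rintro R ⟨K, L, rfl⟩
    fun_prop
  le_self := by
    rintro R ⟨K, L, rfl⟩ α
    simpa using ENNReal.toNNReal_mono ENNReal.coe_ne_top (min_add_sub_sub_le α K L)
  isSeqCompact := by
    have h : limitedExcessOfLoss = (fun (q : ℝ≥0∞ × ℝ≥0∞) (α : ℝ≥0) =>
        (min (α : ℝ≥0∞) q.1 + ((α : ℝ≥0∞) - q.1 - q.2)).toNNReal) '' univ := by
      ext R
      constructor
      · rintro ⟨K, L, rfl⟩
        exact ⟨(K, L), mem_univ _, rfl⟩
      · rintro ⟨⟨K, L⟩, -, rfl⟩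
        exact ⟨K, L, rfl⟩
    rw [h]
    refine IsSeqCompact.image ?_ isCompact_univ.isSeqCompact
    refine (continuous_pi fun α => ?_).seqContinuous
    have hc : Continuous fun q : ℝ≥0∞ × ℝ≥0∞ =>
        min (α : ℝ≥0∞) q.1 + ((α : ℝ≥0∞) - q.1 - q.2) := by
      have h1 : Continuous fun q : ℝ≥0∞ × ℝ≥0∞ => (α : ℝ≥0∞) - q.1 :=
        (ENNReal.continuous_sub_left ENNReal.coe_ne_top).comp continuous_fst
      refine (continuous_const.min continuous_fst).add ?_
      refine continuous_iff_continuousAt.2 fun q => ?_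
      refine ENNReal.Tendsto.sub h1.continuousAt continuous_snd.continuousAt (Or.inl ?_)
      exact ne_top_of_le_ne_top ENNReal.coe_ne_top (tsub_le_self (a := (α : ℝ≥0∞)))
    refine continuous_iff_continuousAt.2 fun q => ?_
    refine (ENNReal.tendsto_toNNReal ?_).comp hc.continuousAt
    exact ne_top_of_le_ne_top ENNReal.coe_ne_top (min_add_sub_sub_le α q.1 q.2)

theorem isReinsuranceFamily_excessOfLoss : IsReinsuranceFamily excessOfLoss where
  measurable := by
    rintro R ⟨K, rfl⟩
    fun_prop
  le_self := by
    rintro R ⟨K, rfl⟩ α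
    simpa using ENNReal.toNNReal_mono ENNReal.coe_ne_top (min_le_left (α : ℝ≥0∞) K)
  isSeqCompact := by
    have h : excessOfLoss = (fun (K : ℝ≥0∞) (α : ℝ≥0) =>
        (min (α : ℝ≥0∞) K).toNNReal) '' univ := by
      ext R
      constructor
      · rintro ⟨K, rfl⟩
        exact ⟨K, mem_univ _, rfl⟩
      · rintro ⟨K, -, rfl⟩
        exact ⟨K, rfl⟩
    rw [h]
    refine IsSeqCompact.image ?_ isCompact_univ.isSeqCompact
    refine (continuous_pi fun α => ?_).seqContinuous
    refine continuous_iff_continuousAt.2 fun K => ?_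
    refine (ENNReal.tendsto_toNNReal ?_).comp (continuous_const.min continuous_id).continuousAt
    exact ne_top_of_le_ne_top ENNReal.coe_ne_top (min_le_left (α : ℝ≥0∞) K)

end

end ThinningRisk

open MeasureTheory ProbabilityTheory Filter Topology Set
open scoped NNReal ENNReal

namespace ThinningRisk

noncomputable section

/-! The proof is dynamic programming over a short interval `[0, T]`, with two one-sided estimates in
place of an identity. Write `λ = δ + β`, `ν` for the measure `intensity` of marks per unit of time,
and `P` for `premiumBound`.

Lower estimate. Keep a contract `R` with premium rate `p > 0` and pay nothing until `T`, then
continue almost optimally. Counting only the scenarios with at most one event before `T` gives `exp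
(-λ T) (V (x + p T) + T ∫ V (x - R(u)) dν) ≤ V x` (`le_optimalValueENN_of_premium_pos`). The
continuation must be chosen measurably, so the surplus after the claim is rounded down to a grid.
The rounding costs a factor close to `1`, because the estimate without the integral already gives `V
(x + h) ≤ exp (λ h / p) V x`. The same growth bound makes `V` locally Lipschitz.

Supersolution. Paying `h` at once gives `V x + h ≤ V (x + h)` (`add_le_optimalValueENN`), so a
subdifferential `d` at `x > 0` is at least `1`. Dividing the lower estimate by `T` and letting `T →
0` bounds the generators with `p_R > 0`; those with `p_R ≤ 0` are bounded trivially. At `0` there is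
no subdifferential, since `V` jumps there from `0` to `V 0 > 0`.

Upper estimate. Before the first event a strategy acts as on the scenario `quiet` without claims, so
it is deterministic. For a fixed time and mark of the first event, its continuation is again
admissible and is worth at most `V`. Integrating over time and mark bounds every strategy
(`Strategy.value_le`), and nothing has to be selected.

Subsolution. Suppose that the left-hand side of the equation is negative for a superdifferential
`d`. Then `d > 1`, and all generators at `x` are at most some `-c < 0`. Compactness of the families
and upper semicontinuity of `V` carry half of this bound to levels slightly above `x`
(`exists_pos_generator_le`). Inserting it and the first-order expansion of `V` into the upper
estimate, every strategy falls short of `V x` by one and the same `κ > 0` (`exists_uniform_lt`),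
which contradicts the definition of `V x` as a supremum.

Two technical points run through the file. The filtration is not completed and only records
real-valued claims, so strategies must be predictable even on null scenarios where the claims
explode; `sanitize` takes care of these. Measurability of the discounted dividends in the scenario
is never established; measurable minorants with the same integral take their place. -/

variable {m n : ℕ}

/-! ### Rearranging scenarios -/

/-- Hit lines and severities of one event. -/
abbrev Mark (n : ℕ) := (Fin n → Bool) × (Fin n → ℝ≥0)

/-- Delay all events of class `k` by `a k`. -/
def shiftWaits (a : Fin m → ℝ) (ω : Scenario m n) : Scenario m n :=
  fun i => if i.2 = 0 then ((ω i).1 + a i.1, (ω i).2) else ω i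

/-- Put the event `x` in front of the events of class `k`. -/
def insertEvent (k : Fin m) (x : ℝ × Mark n) (ω : Scenario m n) : Scenario m n :=
  fun i => if i.1 = k then (if i.2 = 0 then x else ω (i.1, i.2 - 1)) else ω i

/-- Position of the events of a scenario after an event of class `k` has been put in front. -/
def insertIndex (k : Fin m) (i : Fin m × ℕ) : Fin m × ℕ :=
  if i.1 = k then (i.1, i.2 + 1) else i

/-- An event of class `k` at time `t`, together with the events of `ω` delayed by `b`. -/
def arrive (k : Fin m) (t : ℝ) (u : Mark n) (b : ℝ) (ω : Scenario m n) : Scenario m n :=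
  insertEvent k (t, u) (shiftWaits (fun k' => if k' = k then b - t else b) ω)

theorem insertIndex_injective (k : Fin m) : Function.Injective (insertIndex k) := by
  rintro ⟨a, e⟩ ⟨b, f⟩ h
  unfold insertIndex at h
  split_ifs at h <;> simp_all

theorem mem_range_insertIndex {k : Fin m} {i : Fin m × ℕ} :
    i ∈ range (insertIndex k) ↔ i ≠ (k, 0) := by
  obtain ⟨a, e⟩ := i
  constructor
  · rintro ⟨⟨b, f⟩, h⟩ h'
    unfold insertIndex at h
    split_ifs at h <;> simp_all
  · intro h
    by_cases ha : a = k
    · subst ha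
      cases e with
      | zero => simp at h
      | succ e => exact ⟨(a, e), by simp [insertIndex]⟩
    · exact ⟨(a, e), by simp [insertIndex, ha]⟩

theorem insertIndex_fst (k : Fin m) (i : Fin m × ℕ) : (insertIndex k i).1 = i.1 := by
  unfold insertIndex; split_ifs <;> rfl

@[simp] theorem insertEvent_self (k : Fin m) (x : ℝ × Mark n) (ω : Scenario m n) :
    insertEvent k x ω (k, 0) = x := by simp [insertEvent]

@[simp] theorem insertEvent_insertIndex (k : Fin m) (x : ℝ × Mark n) (ω : Scenario m n)
    (i : Fin m × ℕ) : insertEvent k x ω (insertIndex k i) = ω i := by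
  obtain ⟨a, e⟩ := i
  by_cases h : a = k <;> simp [insertEvent, insertIndex, h]

theorem shiftWaits_zero (ω : Scenario m n) : shiftWaits 0 ω = ω := by
  funext i; simp [shiftWaits]

theorem shiftWaits_add (a b : Fin m → ℝ) (ω : Scenario m n) :
    shiftWaits a (shiftWaits b ω) = shiftWaits (b + a) ω := by
  funext i
  by_cases h : i.2 = 0 <;> simp [shiftWaits, h, add_assoc]

theorem shiftWaits_single_insertEvent (k : Fin m) (a t : ℝ) (u : Mark n) (ω : Scenario m n) :
    shiftWaits (Pi.single k a) (insertEvent k (t, u) ω) = insertEvent k (t + a, u) ω := by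
  funext ⟨k', e⟩
  by_cases h : k' = k
  · subst h
    cases e <;> simp [shiftWaits, insertEvent]
  · simp [shiftWaits, insertEvent, h]

theorem measurable_shiftWaits {α : Type*} [MeasurableSpace α] {a : α → Fin m → ℝ}
    {f : α → Scenario m n} (ha : Measurable a) (hf : Measurable f) :
    Measurable fun x => shiftWaits (a x) (f x) := by
  refine measurable_pi_iff.2 fun i => ?_
  by_cases h : i.2 = 0 <;> simp only [shiftWaits, h, if_true, if_false]
  · fun_prop
  · fun_prop

theorem measurable_insertEvent (k : Fin m) {α : Type*} [MeasurableSpace α] {g : α → ℝ × Mark n}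
    {f : α → Scenario m n} (hg : Measurable g) (hf : Measurable f) :
    Measurable fun x => insertEvent k (g x) (f x) := by
  refine measurable_pi_iff.2 fun i => ?_
  by_cases h : i.1 = k <;> by_cases h' : i.2 = 0 <;>
    simp only [insertEvent, h, h', if_true, if_false] <;> fun_prop

theorem measurable_arrive (k : Fin m) {α : Type*} [MeasurableSpace α] {t b : α → ℝ}
    {u : α → Mark n} {f : α → Scenario m n} (ht : Measurable t) (hu : Measurable u)
    (hb : Measurable b) (hf : Measurable f) :
    Measurable fun x => arrive k (t x) (u x) (b x) (f x) := by
  refine measurable_insertEvent k (by fun_prop) (measurable_shiftWaits ?_ hf)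
  refine measurable_pi_iff.2 fun k' => ?_
  by_cases h : k' = k <;> simp only [h, if_true, if_false] <;> fun_prop

theorem eventTime_shiftWaits (a : Fin m → ℝ) (ω : Scenario m n) (i : Fin m × ℕ) :
    eventTime (shiftWaits a ω) i = eventTime ω i + a i.1 := by
  unfold eventTime
  rw [Finset.sum_range_succ', Finset.sum_range_succ']
  simp [shiftWaits, add_assoc]

theorem eventTime_insertEvent_self (k : Fin m) (x : ℝ × Mark n) (ω : Scenario m n) :
    eventTime (insertEvent k x ω) (k, 0) = x.1 := by
  simp [eventTime]

theorem eventTime_insertEvent (k : Fin m) (x : ℝ × Mark n) (ω : Scenario m n) (i : Fin m × ℕ) :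
    eventTime (insertEvent k x ω) (insertIndex k i) =
      eventTime ω i + if i.1 = k then x.1 else 0 := by
  obtain ⟨a, e⟩ := i
  by_cases h : a = k
  · subst h
    simp only [eventTime, insertIndex, if_true]
    rw [Finset.sum_range_succ']
    simp [insertEvent]
  · simp [eventTime, insertIndex, h, insertEvent]

@[simp] theorem eventTime_arrive_self (k : Fin m) (t : ℝ) (u : Mark n) (b : ℝ)
    (ω : Scenario m n) : eventTime (arrive k t u b ω) (k, 0) = t :=
  eventTime_insertEvent_self _ _ _

@[simp] theorem eventTime_arrive (k : Fin m) (t : ℝ) (u : Mark n) (b : ℝ) (ω : Scenario m n)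
    (i : Fin m × ℕ) :
    eventTime (arrive k t u b ω) (insertIndex k i) = eventTime ω i + b := by
  rw [arrive, eventTime_insertEvent, eventTime_shiftWaits]
  by_cases h : i.1 = k <;> simp [h, add_assoc]

@[simp] theorem arrive_self_snd (k : Fin m) (t : ℝ) (u : Mark n) (b : ℝ) (ω : Scenario m n) :
    (arrive k t u b ω (k, 0)).2 = u := by
  simp [arrive]

@[simp] theorem arrive_snd (k : Fin m) (t : ℝ) (u : Mark n) (b : ℝ) (ω : Scenario m n)
    (i : Fin m × ℕ) : (arrive k t u b ω (insertIndex k i)).2 = (ω i).2 := by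
  rw [arrive, insertEvent_insertIndex, shiftWaits]
  split_ifs <;> rfl

@[simp] theorem shiftWaits_snd (a : Fin m → ℝ) (ω : Scenario m n) (i : Fin m × ℕ) :
    (shiftWaits a ω i).2 = (ω i).2 := by
  rw [shiftWaits]
  split_ifs <;> rfl

theorem measurable_eventTime (i : Fin m × ℕ) :
    Measurable fun ω : Scenario m n => eventTime ω i := by
  unfold eventTime
  fun_prop

theorem tsum_insertIndex (k : Fin m) (f : Fin m × ℕ → ℝ≥0∞) :
    ∑' i, f i = f (k, 0) + ∑' i, f (insertIndex k i) := by
  rw [ENNReal.tsum_eq_add_tsum_ite (k, 0)]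
  congr 1
  have := (insertIndex_injective k).tsum_eq (f := fun i => if i = (k, 0) then 0 else f i) ?_
  · refine Eq.trans (by congr! with i) (this.symm.trans ?_)
    refine tsum_congr fun i => ?_
    rw [if_neg (mem_range_insertIndex.1 (mem_range_self i))]
  · intro i hi
    rw [mem_range_insertIndex]
    rintro rfl
    simp at hi

/-! ### The law of the scenarios -/

namespace RiskModel

variable (M : RiskModel m n)

/-- Law of the hit lines and severities of an event of class `k`. -/
def markLaw (k : Fin m) : Measure (Mark n) :=
  (Measure.pi fun j => bernoulliMeasure true false (M.thin k j)).prod M.sev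

instance (k : Fin m) : IsProbabilityMeasure (M.markLaw k) := by
  unfold markLaw; infer_instance

instance : IsProbabilityMeasure M.prob := by
  unfold prob; infer_instance

theorem eventLaw_eq (k : Fin m) : M.eventLaw k = (expMeasure (M.β k)).prod (M.markLaw k) := rfl

/-- The events of class `k` are independent and identically distributed, so a fresh one in front
merely renumbers them. On cylinders, the preimage of a box is the factor at `(k, 0)` times a box in
the old coordinates. -/
theorem map_insertEvent (k : Fin m) :
    ((M.eventLaw k).prod M.prob).map (fun q => insertEvent k q.1 q.2) = M.prob := by
  have hm : Measurable fun q : (ℝ × Mark n) × Scenario m n => insertEvent k q.1 q.2 :=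
    measurable_insertEvent k measurable_fst measurable_snd
  refine Measure.eq_infinitePi _ fun s t ht => ?_
  rw [Measure.map_apply hm (MeasurableSet.pi s.countable_toSet fun i _ => ht i)]
  have hinj := (insertIndex_injective k).injOn (s := insertIndex k ⁻¹' (s : Set (Fin m × ℕ)))
  have hset : (fun q : (ℝ × Mark n) × Scenario m n => insertEvent k q.1 q.2) ⁻¹' (s : Set _).pi t
      = (if (k, 0) ∈ s then t (k, 0) else univ) ×ˢ
        ((s.preimage (insertIndex k) hinj : Finset _) : Set _).pi
          fun i => t (insertIndex k i) := by
    ext ⟨x, ω⟩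
    simp only [mem_preimage, Set.mem_pi, mem_prod, Finset.coe_preimage, Finset.mem_coe]
    constructor
    · intro h
      refine ⟨?_, fun i hi => ?_⟩
      · split_ifs with h0
        · simpa using h _ h0
        · trivial
      · simpa using h _ hi
    · rintro ⟨h1, h2⟩ i hi
      by_cases h0 : i = (k, 0)
      · subst h0
        simpa [show (k, 0) ∈ s from hi] using h1
      · obtain ⟨i', rfl⟩ := mem_range_insertIndex.2 h0
        simpa using h2 i' hi
  classical
  rw [hset, Measure.prod_prod, prob, Measure.infinitePi_pi]
  · have e1 : ∀ i, M.eventLaw i.1 (t (insertIndex k i)) =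
        (fun i' : Fin m × ℕ => M.eventLaw i'.1 (t i')) (insertIndex k i) := fun i => by
      simp only [insertIndex_fst]
    rw [Finset.prod_congr rfl fun i _ => e1 i, Finset.prod_preimage' (insertIndex k) s hinj
        (fun i' : Fin m × ℕ => M.eventLaw i'.1 (t i')),
      ← Finset.prod_filter_mul_prod_filter_not s (fun i => i ∈ range (insertIndex k)), mul_comm]
    congr 1
    simp only [mem_range_insertIndex, not_not, Finset.prod_filter, Finset.prod_ite_eq']
    split_ifs <;> simp
  · exact fun i _ => ht _

theorem lintegral_prob_insertEvent (k : Fin m) {f : Scenario m n → ℝ≥0∞} (hf : Measurable f) :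
    ∫⁻ ω, f ω ∂M.prob = ∫⁻ t, ∫⁻ u, ∫⁻ ω, f (insertEvent k (t, u) ω) ∂M.prob ∂M.markLaw k
      ∂expMeasure (M.β k) := by
  have hm : Measurable fun q : (ℝ × Mark n) × Scenario m n => insertEvent k q.1 q.2 :=
    measurable_insertEvent k measurable_fst measurable_snd
  conv_lhs => rw [← M.map_insertEvent k]
  rw [lintegral_map hf hm, lintegral_prod (fun q => f (insertEvent k q.1 q.2))
    (hf.comp hm).aemeasurable, eventLaw_eq, lintegral_prod]
  exact (Measurable.lintegral_prod_right' (f := fun q => f (insertEvent k q.1 q.2))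
    (hf.comp hm)).aemeasurable

end RiskModel

/-! ### Memorylessness of the waiting times -/

theorem expMeasure_eq (r : ℝ) : expMeasure r = volume.withDensity (exponentialPDF r) := rfl

theorem measurable_exponentialPDF (r : ℝ) : Measurable (exponentialPDF r) :=
  (measurable_exponentialPDFReal r).ennreal_ofReal

theorem lintegral_expMeasure_Ici {r a : ℝ} (ha : 0 ≤ a) {f : ℝ → ℝ≥0∞} (hf : Measurable f) :
    ∫⁻ t, (Ici a).indicator f t ∂expMeasure r =
      ENNReal.ofReal (Real.exp (-(r * a))) * ∫⁻ t, f (t + a) ∂expMeasure r := by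
  have hp := measurable_exponentialPDF r
  have hfa : Measurable fun t => f (t + a) := hf.comp (measurable_add_const a)
  rw [expMeasure_eq, lintegral_withDensity_eq_lintegral_mul _ hp (hf.indicator measurableSet_Ici),
    lintegral_withDensity_eq_lintegral_mul _ hp hfa, ← lintegral_add_right_eq_self _ a,
    ← lintegral_const_mul _ (hp.mul hfa)]
  refine lintegral_congr fun t => ?_
  simp only [Pi.mul_apply, indicator, mem_Ici, le_add_iff_nonneg_left, exponentialPDF_eq]
  by_cases ht : 0 ≤ t
  · rw [if_pos ht, if_pos ht, if_pos (by positivity), ← mul_assoc,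
      ← ENNReal.ofReal_mul (Real.exp_pos _).le]
    congr 2
    rw [mul_left_comm, ← Real.exp_add]
    ring_nf
  · simp [ht]

theorem lintegral_expMeasure {r : ℝ} {f : ℝ → ℝ≥0∞} (hf : Measurable f) :
    ∫⁻ t, f t ∂expMeasure r =
      ∫⁻ t in Ici 0, ENNReal.ofReal (r * Real.exp (-(r * t))) * f t := by
  rw [expMeasure_eq, lintegral_withDensity_eq_lintegral_mul _ (measurable_exponentialPDF r) hf,
    ← lintegral_indicator measurableSet_Ici]
  refine lintegral_congr fun t => ?_
  simp only [Pi.mul_apply, indicator, mem_Ici, exponentialPDF_eq]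
  split_ifs <;> simp

namespace RiskModel

variable (M : RiskModel m n)

theorem lintegral_prob_shiftWaits_single (k : Fin m) {a : ℝ} (ha : 0 ≤ a)
    {f : Scenario m n → ℝ≥0∞} (hf : Measurable f) :
    ∫⁻ ω, {ω : Scenario m n | a ≤ (ω (k, 0)).1}.indicator f ω ∂M.prob =
      ENNReal.ofReal (Real.exp (-(M.β k * a))) *
        ∫⁻ ω, f (shiftWaits (Pi.single k a) ω) ∂M.prob := by
  have hs : MeasurableSet {ω : Scenario m n | a ≤ (ω (k, 0)).1} :=
    measurableSet_le measurable_const (by fun_prop)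
  have hm : Measurable fun q : (ℝ × Mark n) × Scenario m n => f (insertEvent k q.1 q.2) :=
    hf.comp (measurable_insertEvent k measurable_fst measurable_snd)
  have h1 : Measurable fun q : ℝ × Mark n => ∫⁻ ω, f (insertEvent k q ω) ∂M.prob :=
    hm.lintegral_prod_right'
  have h2 : Measurable fun t : ℝ =>
      ∫⁻ u, ∫⁻ ω, f (insertEvent k (t, u) ω) ∂M.prob ∂M.markLaw k := h1.lintegral_prod_right'
  rw [M.lintegral_prob_insertEvent k (hf.indicator hs), M.lintegral_prob_insertEvent k
    (f := fun ω => f (shiftWaits (Pi.single k a) ω))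
    (hf.comp (measurable_shiftWaits measurable_const measurable_id))]
  have := lintegral_expMeasure_Ici (r := M.β k) ha h2
  simp only [shiftWaits_single_insertEvent] at this ⊢
  rw [← this]
  refine lintegral_congr fun t => ?_
  by_cases ht : a ≤ t <;> simp [indicator, ht]

/-- Memorylessness applied to one class after the other. With equal delays it says that a scenario
without events before `a`, seen from `a`, is distributed like a fresh one. -/
theorem lintegral_prob_shiftWaits {a : Fin m → ℝ} (ha : ∀ k, 0 ≤ a k)
    {f : Scenario m n → ℝ≥0∞} (hf : Measurable f) :
    ∫⁻ ω, {ω : Scenario m n | ∀ k, a k ≤ (ω (k, 0)).1}.indicator f ω ∂M.prob =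
      ENNReal.ofReal (Real.exp (-(∑ k, M.β k * a k))) *
        ∫⁻ ω, f (shiftWaits a ω) ∂M.prob := by
  suffices H : ∀ (S : Finset (Fin m)) {f : Scenario m n → ℝ≥0∞}, Measurable f →
      ∫⁻ ω, {ω : Scenario m n | ∀ k ∈ S, a k ≤ (ω (k, 0)).1}.indicator f ω ∂M.prob =
      ENNReal.ofReal (Real.exp (-(∑ k ∈ S, M.β k * a k))) *
        ∫⁻ ω, f (shiftWaits (∑ k ∈ S, Pi.single k (a k)) ω) ∂M.prob by
    have := H Finset.univ hf
    simp only [Finset.mem_univ, forall_true_left, Finset.univ_sum_single] at this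
    exact this
  intro S
  induction S using Finset.induction_on with
  | empty => intro f hf; simp [shiftWaits_zero]
  | insert k S hk ih =>
    intro f hf
    have hs : MeasurableSet {ω : Scenario m n | a k ≤ (ω (k, 0)).1} :=
      measurableSet_le measurable_const (by fun_prop)
    have h1 := ih (hf.indicator hs)
    have e1 : ∀ ω : Scenario m n,
        {ω : Scenario m n | ∀ k' ∈ insert k S, a k' ≤ (ω (k', 0)).1}.indicator f ω =
        {ω : Scenario m n | ∀ k ∈ S, a k ≤ (ω (k, 0)).1}.indicator
          ({ω : Scenario m n | a k ≤ (ω (k, 0)).1}.indicator f) ω := fun ω => by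
      by_cases h1 : a k ≤ (ω (k, 0)).1 <;> by_cases h2 : ∀ k ∈ S, a k ≤ (ω (k, 0)).1 <;>
        simp [indicator, h1, h2]
    -- Delaying the classes in `S` does not touch the first waiting time of `k ∉ S`.
    have e2 : ∀ ω : Scenario m n, {ω : Scenario m n | a k ≤ (ω (k, 0)).1}.indicator f
        (shiftWaits (∑ k ∈ S, Pi.single k (a k)) ω) =
        {ω : Scenario m n | a k ≤ (ω (k, 0)).1}.indicator
          (fun ω => f (shiftWaits (∑ k ∈ S, Pi.single k (a k)) ω)) ω := fun ω => by
      have : (shiftWaits (∑ k ∈ S, Pi.single k (a k)) ω (k, 0)).1 = (ω (k, 0)).1 := by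
        simp only [shiftWaits, if_true, Finset.sum_apply, add_eq_left]
        refine Finset.sum_eq_zero fun k' hk' => ?_
        rw [Pi.single_eq_of_ne]
        rintro rfl
        exact hk hk'
      simp only [indicator, mem_ofPred_eq, this]
    simp_rw [e1, h1, e2]
    rw [M.lintegral_prob_shiftWaits_single k (ha k)
      (f := fun ω => f (shiftWaits (∑ k ∈ S, Pi.single k (a k)) ω))
      (hf.comp (measurable_shiftWaits measurable_const measurable_id)), ← mul_assoc,
      ← ENNReal.ofReal_mul (Real.exp_pos _).le, ← Real.exp_add, Finset.sum_insert hk,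
      Finset.sum_insert hk]
    simp only [shiftWaits_add]
    ring_nf

/-- Law of the scenarios with a first event of class `k` at a time `t ∈ B` and no other event before
time `b t`. -/
theorem lintegral_prob_arrive (k : Fin m) {B : Set ℝ} (hB : MeasurableSet B) {b : ℝ → ℝ}
    (hb : Measurable b) (hB0 : ∀ t ∈ B, 0 ≤ t) (htb : ∀ t ∈ B, t ≤ b t)
    {f : Scenario m n → ℝ≥0∞} (hf : Measurable f) :
    ∫⁻ ω, {ω : Scenario m n | (ω (k, 0)).1 ∈ B ∧ ∀ k', if k' = k
        then b (ω (k, 0)).1 - (ω (k, 0)).1 ≤ (ω (k, 1)).1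
        else b (ω (k, 0)).1 ≤ (ω (k', 0)).1}.indicator f ω ∂M.prob =
      ∫⁻ t in B, ENNReal.ofReal (M.β k * Real.exp (-(M.totalβ * b t))) *
        ∫⁻ u, ∫⁻ ω, f (arrive k t u (b t) ω) ∂M.prob ∂M.markLaw k := by
  set E : Set (Scenario m n) := {ω : Scenario m n | (ω (k, 0)).1 ∈ B ∧ ∀ k', if k' = k
        then b (ω (k, 0)).1 - (ω (k, 0)).1 ≤ (ω (k, 1)).1
        else b (ω (k, 0)).1 ≤ (ω (k', 0)).1} with hE
  have hEm : MeasurableSet E := by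
    have : E = (fun ω : Scenario m n => (ω (k, 0)).1) ⁻¹' B ∩ ⋂ k', {ω | if k' = k
        then b (ω (k, 0)).1 - (ω (k, 0)).1 ≤ (ω (k, 1)).1
        else b (ω (k, 0)).1 ≤ (ω (k', 0)).1} := by
      ext ω
      simp [hE]
    rw [this]
    refine ((by fun_prop : Measurable fun ω : Scenario m n => (ω (k, 0)).1) hB).inter ?_
    refine MeasurableSet.iInter fun k' => ?_
    by_cases h : k' = k <;> simp only [h, if_true, if_false] <;>
      exact measurableSet_le (by fun_prop) (by fun_prop)
  -- Waiting times required after the event at `t` is taken out. The constant `b = T` isolates a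
  -- single event before `T` (lower estimate), `b t = t` isolates the first event (upper estimate).
  let a : ℝ → Fin m → ℝ := fun t k' => if k' = k then b t - t else b t
  have hm : Measurable fun q : ℝ × Mark n × Scenario m n => f (arrive k q.1 q.2.1 (b q.1) q.2.2) :=
    hf.comp (measurable_arrive k (by fun_prop) (by fun_prop) (by fun_prop) (by fun_prop))
  have hm2 : Measurable fun t : ℝ => ∫⁻ u, ∫⁻ ω, f (arrive k t u (b t) ω) ∂M.prob ∂M.markLaw k := by
    have : Measurable fun q : ℝ × Mark n => ∫⁻ ω, f (arrive k q.1 q.2 (b q.1) ω) ∂M.prob :=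
      (hm.comp (by fun_prop : Measurable fun q : (ℝ × Mark n) × Scenario m n =>
        (q.1.1, q.1.2, q.2))).lintegral_prod_right'
    exact this.lintegral_prod_right'
  have key : ∀ t u, ∫⁻ ω, E.indicator f (insertEvent k (t, u) ω) ∂M.prob =
      B.indicator (fun t => ENNReal.ofReal (Real.exp (-(∑ k', M.β k' * a t k'))) *
        ∫⁻ ω, f (arrive k t u (b t) ω) ∂M.prob) t := by
    intro t u
    have e : ∀ ω, E.indicator f (insertEvent k (t, u) ω) = B.indicator (fun t =>
        {ω : Scenario m n | ∀ k, a t k ≤ (ω (k, 0)).1}.indicator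
          (fun ω => f (insertEvent k (t, u) ω)) ω) t := fun ω => by
      have : insertEvent k (t, u) ω ∈ E ↔ t ∈ B ∧ ∀ k', a t k' ≤ (ω (k', 0)).1 := by
        simp only [hE, mem_ofPred_eq, insertEvent_self, a]
        refine and_congr_right fun _ => forall_congr' fun k' => ?_
        by_cases h : k' = k <;> simp [h, insertEvent]
      by_cases h1 : t ∈ B <;> by_cases h2 : ∀ k', a t k' ≤ (ω (k', 0)).1 <;>
        simp [indicator, this, h1, h2]
    simp_rw [e]
    by_cases ht : t ∈ B
    · simp only [indicator_of_mem ht]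
      have ha : ∀ k', 0 ≤ a t k' := fun k' => by
        have := htb t ht
        have := hB0 t ht
        simp only [a]
        split_ifs <;> linarith
      exact M.lintegral_prob_shiftWaits ha
        (hf.comp (measurable_insertEvent k measurable_const measurable_id))
    · simp [ht]
  -- The missing `β_k t` is supplied by the density of the first waiting time of class `k`, so that
  -- only `totalβ * b t` remains in the exponent.
  have hsum : ∀ t, ∑ k', M.β k' * a t k' = M.totalβ * b t - M.β k * t := fun t => by
    have : ∀ k', M.β k' * a t k' = M.β k' * b t - if k' = k then M.β k * t else 0 := fun k' => by
      simp only [a]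
      split_ifs with h
      · subst h; ring
      · ring
    simp_rw [this, Finset.sum_sub_distrib, totalβ, Finset.sum_mul]
    simp
  rw [M.lintegral_prob_insertEvent k (hf.indicator hEm)]
  simp_rw [key, hsum]
  have e3 : ∀ t, ∫⁻ u, B.indicator (fun t =>
      ENNReal.ofReal (Real.exp (-(M.totalβ * b t - M.β k * t))) *
        ∫⁻ ω, f (arrive k t u (b t) ω) ∂M.prob) t ∂M.markLaw k =
      B.indicator (fun t => ENNReal.ofReal (Real.exp (-(M.totalβ * b t - M.β k * t))) *
        ∫⁻ u, ∫⁻ ω, f (arrive k t u (b t) ω) ∂M.prob ∂M.markLaw k) t := fun t => by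
    by_cases ht : t ∈ B
    · simp only [indicator_of_mem ht]
      rw [lintegral_const_mul]
      exact (hm.comp (by fun_prop : Measurable fun q : Mark n × Scenario m n =>
        (t, q.1, q.2))).lintegral_prod_right'
    · simp [ht]
  simp_rw [e3]
  rw [lintegral_expMeasure (Measurable.indicator (by fun_prop) hB),
    ← lintegral_indicator measurableSet_Ici, ← lintegral_indicator hB]
  refine lintegral_congr fun t => ?_
  by_cases ht : t ∈ B
  · simp only [indicator_of_mem ht, indicator_of_mem (show t ∈ Ici (0 : ℝ) from hB0 t ht)]
    rw [← mul_assoc, ← ENNReal.ofReal_mul (by have := M.β_pos k; positivity), mul_assoc,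
      ← Real.exp_add]
    ring_nf
  · simp [ht]

end RiskModel

/-! ### Total claims -/

/-- Total amount retained up to time `t` on the claims of line `j`, as an extended number. -/
def claimsENN (ω : Scenario m n) (j : Fin n) (r : ℝ → Retention) (t : ℝ) : ℝ≥0∞ :=
  ∑' i : Fin m × ℕ,
    if eventTime ω i ≤ t ∧ (ω i).2.1 j = true then
      ((r (eventTime ω i) ((ω i).2.2 j) : ℝ≥0) : ℝ≥0∞) else 0

theorem retainedClaims_eq (ω : Scenario m n) (j : Fin n) (r : ℝ → Retention) (t : ℝ) :
    retainedClaims ω j r t = (claimsENN ω j r t).toReal := rfl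

theorem claimsENN_mono_time (ω : Scenario m n) (j : Fin n) (r : ℝ → Retention) :
    Monotone (claimsENN ω j r) := fun s t hst => by
  refine ENNReal.tsum_le_tsum fun i => ?_
  by_cases h : eventTime ω i ≤ s ∧ (ω i).2.1 j = true
  · rw [if_pos h, if_pos ⟨h.1.trans hst, h.2⟩]
  · rw [if_neg h]; exact zero_le

theorem claimsENN_le_id (ω : Scenario m n) (j : Fin n) {r : ℝ → Retention}
    (hr : ∀ t α, r t α ≤ α) (t : ℝ) : claimsENN ω j r t ≤ claimsENN ω j (fun _ => id) t := by
  refine ENNReal.tsum_le_tsum fun i => ?_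
  split_ifs
  · exact ENNReal.coe_le_coe.2 (hr _ _)
  · exact le_rfl

theorem claimsENN_congr {ω : Scenario m n} {j : Fin n} {r r' : ℝ → Retention} {t : ℝ}
    (h : ∀ i, eventTime ω i ≤ t → r (eventTime ω i) = r' (eventTime ω i)) :
    claimsENN ω j r t = claimsENN ω j r' t := by
  refine tsum_congr fun i => ?_
  by_cases hi : eventTime ω i ≤ t
  · simp [hi, h i hi]
  · simp [hi]

theorem claimsENN_arrive (k : Fin m) (t : ℝ) (u : Mark n) (b : ℝ) (ω : Scenario m n) (j : Fin n)
    (r : ℝ → Retention) (s : ℝ) :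
    claimsENN (arrive k t u b ω) j r s = (if t ≤ s ∧ u.1 j = true then
        ((r t (u.2 j) : ℝ≥0) : ℝ≥0∞) else 0) + claimsENN ω j (fun q => r (q + b)) (s - b) := by
  rw [claimsENN, tsum_insertIndex k]
  simp only [eventTime_arrive_self, eventTime_arrive, arrive_self_snd, arrive_snd]
  simp only [claimsENN, le_sub_iff_add_le]

theorem claimsENN_shiftWaits (b : ℝ) (ω : Scenario m n) (j : Fin n) (r : ℝ → Retention) (s : ℝ) :
    claimsENN (shiftWaits (fun _ => b) ω) j r s = claimsENN ω j (fun q => r (q + b)) (s - b) := by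
  simp only [claimsENN, eventTime_shiftWaits, shiftWaits_snd, le_sub_iff_add_le]

theorem measurableSet_hit (i : Fin m × ℕ) (j : Fin n) (t : ℝ) :
    MeasurableSet {ω : Scenario m n | eventTime ω i ≤ t ∧ (ω i).2.1 j = true} := by
  refine (measurableSet_le (measurable_eventTime i) measurable_const).inter ?_
  exact (by fun_prop : Measurable fun ω : Scenario m n => (ω i).2.1 j) (measurableSet_singleton true)

theorem measurable_claimsENN_id (j : Fin n) (t : ℝ) :
    Measurable fun ω : Scenario m n => claimsENN ω j (fun _ => id) t := by
  refine Measurable.tsum fun i => ?_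
  exact Measurable.ite (measurableSet_hit i j t) (by simp only [id]; fun_prop) measurable_const

/-! ### Regular scenarios -/

/-- All event times are positive, and the total claims are finite at all times. -/
def IsRegular (ω : Scenario m n) : Prop :=
  (∀ i, 0 < eventTime ω i) ∧ ∀ (j : Fin n) (N : ℕ), claimsENN ω j (fun _ => id) N ≠ ⊤

theorem IsRegular.claims_ne_top {ω : Scenario m n} (h : IsRegular ω) (j : Fin n)
    {r : ℝ → Retention} (hr : ∀ t α, r t α ≤ α) (t : ℝ) : claimsENN ω j r t ≠ ⊤ := by
  obtain ⟨N, hN⟩ := exists_nat_ge t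
  exact ne_top_of_le_ne_top (h.2 j N)
    ((claimsENN_le_id ω j hr t).trans (claimsENN_mono_time ω j _ hN))

theorem IsRegular.claims_nonpos {ω : Scenario m n} (h : IsRegular ω) (j : Fin n)
    (r : ℝ → Retention) {t : ℝ} (ht : t ≤ 0) : claimsENN ω j r t = 0 := by
  refine ENNReal.tsum_eq_zero.2 fun i => if_neg fun hi => ?_
  have := h.1 i
  linarith [hi.1]

theorem measurableSet_isRegular : MeasurableSet {ω : Scenario m n | IsRegular ω} := by
  have : {ω : Scenario m n | IsRegular ω} = (⋂ i, {ω | 0 < eventTime ω i}) ∩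
      ⋂ (j : Fin n) (N : ℕ), {ω | claimsENN ω j (fun _ => id) N ≠ ⊤} := by
    ext ω
    simp [IsRegular]
  rw [this]
  refine (MeasurableSet.iInter fun i => measurableSet_lt measurable_const
    (measurable_eventTime i)).inter (MeasurableSet.iInter fun j => MeasurableSet.iInter fun N => ?_)
  exact (measurable_claimsENN_id j _) (measurableSet_singleton ⊤).compl

theorem ae_expMeasure_pos {r : ℝ} : ∀ᵐ t ∂expMeasure r, 0 < t := by
  rw [ae_iff]
  have h : MeasurableSet {t : ℝ | ¬ 0 < t} := (measurableSet_lt measurable_const measurable_id).compl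
  rw [← lintegral_indicator_one h, lintegral_expMeasure (by exact measurable_one.indicator h)]
  have hae : ∀ᵐ t ∂volume.restrict (Ici (0 : ℝ)),
      ENNReal.ofReal (r * Real.exp (-(r * t))) * {t : ℝ | ¬ 0 < t}.indicator 1 t = 0 := by
    filter_upwards [ae_restrict_mem measurableSet_Ici,
      ae_restrict_of_ae (Measure.ae_ne volume (0 : ℝ))] with t ht ht'
    have : 0 < t := lt_of_le_of_ne ht (Ne.symm ht')
    simp [this]
  rw [lintegral_congr_ae hae, lintegral_zero]

theorem lintegral_exp_neg_expMeasure_lt_one {r : ℝ} (hr : 0 < r) :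
    ∫⁻ t, ENNReal.ofReal (Real.exp (-t)) ∂expMeasure r < 1 := by
  have := isProbabilityMeasure_expMeasure hr
  have : ∫⁻ t, ENNReal.ofReal (Real.exp (-t)) ∂expMeasure r < ∫⁻ _, 1 ∂expMeasure r := by
    have hlt : ∀ᵐ t ∂expMeasure r, ENNReal.ofReal (Real.exp (-t)) < 1 := by
      filter_upwards [ae_expMeasure_pos (r := r)] with t ht
      simpa using ht
    refine lintegral_strict_mono (NeZero.ne _) aemeasurable_const ?_ hlt
    refine ne_top_of_le_ne_top (b := 1) ENNReal.one_ne_top ?_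
    calc ∫⁻ t, ENNReal.ofReal (Real.exp (-t)) ∂expMeasure r ≤ ∫⁻ _, 1 ∂expMeasure r :=
          lintegral_mono_ae (hlt.mono fun t ht => ht.le)
      _ = 1 := by simp
  simpa using this

namespace RiskModel

variable (M : RiskModel m n)

theorem ae_wait_pos : ∀ᵐ ω ∂M.prob, ∀ i, 0 < (ω i).1 := by
  rw [ae_all_iff]
  intro i
  have h := (measurePreserving_eval_infinitePi (fun i : Fin m × ℕ => M.eventLaw i.1) i)
  have h1 : MeasurePreserving Prod.fst (M.eventLaw i.1) (expMeasure (M.β i.1)) :=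
    measurePreserving_fst
  exact (h1.comp h).quasiMeasurePreserving.ae ae_expMeasure_pos

theorem ae_eventTime_pos : ∀ᵐ ω ∂M.prob, ∀ i, 0 < eventTime ω i := by
  filter_upwards [M.ae_wait_pos] with ω h i
  exact Finset.sum_pos (fun e _ => h _) ⟨0, by simp⟩

/-- Mean severity in line `j`. -/
def meanSev (j : Fin n) : ℝ≥0∞ := ∫⁻ u, (u j : ℝ≥0∞) ∂M.sev

theorem meanSev_ne_top (j : Fin n) : M.meanSev j ≠ ⊤ := by
  have h := (M.sev_integrable j).2
  rw [HasFiniteIntegral] at h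
  refine ne_top_of_le_ne_top h.ne (lintegral_mono fun u => ?_)
  simp

theorem lintegral_markLaw_snd (k : Fin m) {f : (Fin n → ℝ≥0) → ℝ≥0∞} (hf : Measurable f) :
    ∫⁻ u, f u.2 ∂M.markLaw k = ∫⁻ u, f u ∂M.sev := by
  have : MeasurePreserving Prod.snd (M.markLaw k) M.sev := measurePreserving_snd
  exact this.lintegral_comp hf

/-- Each event put in front contributes one factor, the Laplace transform at `1` of its waiting
time. -/
theorem lintegral_discounted_severity (k : Fin m) (e : ℕ) (j : Fin n) :
    ∫⁻ ω, ENNReal.ofReal (Real.exp (-eventTime ω (k, e))) * ((ω (k, e)).2.2 j : ℝ≥0∞) ∂M.prob =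
      (∫⁻ t, ENNReal.ofReal (Real.exp (-t)) ∂expMeasure (M.β k)) ^ (e + 1) * M.meanSev j := by
  have hmeas : ∀ e, Measurable fun ω : Scenario m n =>
      ENNReal.ofReal (Real.exp (-eventTime ω (k, e))) * ((ω (k, e)).2.2 j : ℝ≥0∞) := fun e => by
    have := measurable_eventTime (n := n) (k, e)
    fun_prop
  induction e with
  | zero =>
    rw [M.lintegral_prob_insertEvent k (hmeas 0)]
    simp only [eventTime_insertEvent_self, insertEvent_self, lintegral_const, measure_univ, mul_one]
    have : ∀ t : ℝ, ∫⁻ u : Mark n, ENNReal.ofReal (Real.exp (-t)) * (u.2 j : ℝ≥0∞) ∂M.markLaw k =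
        ENNReal.ofReal (Real.exp (-t)) * M.meanSev j := fun t => by
      rw [lintegral_const_mul _ (by fun_prop),
        M.lintegral_markLaw_snd k (f := fun u => (u j : ℝ≥0∞)) (by fun_prop), meanSev]
    simp_rw [this]
    rw [lintegral_mul_const _ (by fun_prop)]
    simp
  | succ e ih =>
    rw [M.lintegral_prob_insertEvent k (hmeas (e + 1))]
    have e1 : ∀ (x : ℝ × Mark n) (ω : Scenario m n), insertEvent k x ω (k, e + 1) = ω (k, e) :=
      fun x ω => by simp [insertEvent]
    have e2 : ∀ (x : ℝ × Mark n) (ω : Scenario m n),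
        eventTime (insertEvent k x ω) (k, e + 1) = eventTime ω (k, e) + x.1 := fun x ω => by
      have := eventTime_insertEvent k x ω (k, e)
      simpa [insertIndex] using this
    simp only [e1, e2, neg_add, Real.exp_add]
    have : ∀ t : ℝ, ∫⁻ ω, ENNReal.ofReal (Real.exp (-eventTime ω (k, e)) * Real.exp (-t)) *
        ((ω (k, e)).2.2 j : ℝ≥0∞) ∂M.prob = ENNReal.ofReal (Real.exp (-t)) *
        ((∫⁻ t, ENNReal.ofReal (Real.exp (-t)) ∂expMeasure (M.β k)) ^ (e + 1) * M.meanSev j) :=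
      fun t => by
        rw [← ih, ← lintegral_const_mul _ (hmeas e)]
        refine lintegral_congr fun ω => ?_
        rw [ENNReal.ofReal_mul (Real.exp_pos _).le]
        ring
    simp only [this, lintegral_const, measure_univ, mul_one]
    rw [lintegral_mul_const _ (by fun_prop)]
    ring

/-- Discounted at rate `1`, the expected severities sum to geometric series, so the discounted total
is almost surely finite. Up to time `N` the discount factor is at least `exp (-N)`, so the claims
themselves are finite. -/
theorem ae_isRegular : ∀ᵐ ω ∂M.prob, IsRegular ω := by
  have hfin : ∀ j : Fin n, ∀ᵐ ω ∂M.prob, ∑' i : Fin m × ℕ,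
      ENNReal.ofReal (Real.exp (-eventTime ω i)) * ((ω i).2.2 j : ℝ≥0∞) < ⊤ := by
    intro j
    have hmeas : ∀ i, Measurable fun ω : Scenario m n =>
        ENNReal.ofReal (Real.exp (-eventTime ω i)) * ((ω i).2.2 j : ℝ≥0∞) := fun i => by
      have := measurable_eventTime (n := n) i
      fun_prop
    refine ae_lt_top (Measurable.tsum hmeas) ?_
    rw [lintegral_tsum fun i => (hmeas i).aemeasurable, ENNReal.tsum_prod', tsum_fintype]
    refine ENNReal.sum_ne_top.2 fun k _ => ?_
    simp_rw [M.lintegral_discounted_severity k _ j, pow_succ, mul_assoc]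
    rw [ENNReal.tsum_mul_right, ENNReal.tsum_geometric]
    have hL := lintegral_exp_neg_expMeasure_lt_one (M.β_pos k)
    refine ENNReal.mul_ne_top ?_ (ENNReal.mul_ne_top hL.ne_top (M.meanSev_ne_top j))
    rw [ENNReal.inv_ne_top]
    exact (tsub_pos_of_lt hL).ne'
  filter_upwards [M.ae_eventTime_pos, ae_all_iff.2 hfin] with ω h1 h2
  refine ⟨h1, fun j N => ?_⟩
  refine ne_top_of_le_ne_top (ENNReal.mul_ne_top
    (ENNReal.ofReal_ne_top (r := Real.exp N)) (h2 j).ne) ?_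
  rw [← ENNReal.tsum_mul_left]
  refine ENNReal.tsum_le_tsum fun i => ?_
  split_ifs with hi
  · rw [← mul_assoc, ← ENNReal.ofReal_mul (Real.exp_pos _).le, ← Real.exp_add]
    refine le_mul_of_one_le_left zero_le ?_
    rw [ENNReal.one_le_ofReal, Real.one_le_exp_iff]
    linarith [hi.1]
  · exact zero_le

end RiskModel

/-! ### Sanitized scenarios

The histories only see `(claimsENN ω j id t).toReal`, which does not separate `0` from `⊤`. Removing the
events after an explosion (and those before time `0`) gives a scenario whose extended total claims are
observable. -/

open Classical in
/-- Remove the hits of a line before time `0`, and after an explosion of the claims of that line. -/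
def sanitize (ω : Scenario m n) : Scenario m n := fun i =>
  ((ω i).1, fun j => (ω i).2.1 j && decide (0 < eventTime ω i ∧
    ∃ q : ℚ, eventTime ω i ≤ q ∧ claimsENN ω j (fun _ => id) q ≠ ⊤), (ω i).2.2)

@[simp] theorem eventTime_sanitize (ω : Scenario m n) (i : Fin m × ℕ) :
    eventTime (sanitize ω) i = eventTime ω i := rfl

theorem sanitize_hit_iff (ω : Scenario m n) (i : Fin m × ℕ) (j : Fin n) :
    (sanitize ω i).2.1 j = true ↔ (ω i).2.1 j = true ∧ 0 < eventTime ω i ∧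
      ∃ q : ℚ, eventTime ω i ≤ q ∧ claimsENN ω j (fun _ => id) q ≠ ⊤ := by
  simp [sanitize]

theorem measurable_sanitize : Measurable (sanitize : Scenario m n → Scenario m n) := by
  refine measurable_pi_iff.2 fun i => ?_
  refine Measurable.prodMk (by fun_prop) (Measurable.prodMk ?_ (by fun_prop))
  refine measurable_pi_iff.2 fun j => measurable_to_bool ?_
  have : (fun ω : Scenario m n => (sanitize ω i).2.1 j) ⁻¹' {true} =
      {ω | (ω i).2.1 j = true} ∩ ({ω | 0 < eventTime ω i} ∩
        ⋃ q : ℚ, ({ω | eventTime ω i ≤ q} ∩ {ω | claimsENN ω j (fun _ => id) q ≠ ⊤})) := by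
    ext ω
    simp [sanitize_hit_iff]
  refine this ▸ MeasurableSet.inter ?_ (MeasurableSet.inter ?_ (MeasurableSet.iUnion fun q =>
    MeasurableSet.inter ?_ ?_))
  · exact (by fun_prop : Measurable fun ω : Scenario m n => (ω i).2.1 j) (measurableSet_singleton _)
  · exact measurableSet_lt measurable_const (measurable_eventTime i)
  · exact measurableSet_le (measurable_eventTime i) measurable_const
  · exact (measurable_claimsENN_id j _) (measurableSet_singleton ⊤).compl

theorem sanitize_of_isRegular {ω : Scenario m n} (h : IsRegular ω) : sanitize ω = ω := by
  funext i
  refine Prod.ext rfl (Prod.ext (funext fun j => ?_) rfl)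
  rw [Bool.eq_iff_iff, sanitize_hit_iff]
  obtain ⟨q, hq⟩ := exists_rat_gt (eventTime ω i)
  exact and_iff_left ⟨h.1 i, q, hq.le, h.claims_ne_top j (fun _ _ => le_rfl) _⟩

theorem claimsENN_sanitize_le (ω : Scenario m n) (j : Fin n) (r : ℝ → Retention) (t : ℝ) :
    claimsENN (sanitize ω) j r t ≤ claimsENN ω j r t := by
  refine ENNReal.tsum_le_tsum fun i => ?_
  by_cases h : eventTime (sanitize ω) i ≤ t ∧ (sanitize ω i).2.1 j = true
  · rw [if_pos h, if_pos ⟨h.1, ((sanitize_hit_iff ω i j).1 h.2).1⟩]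
    exact le_rfl
  · rw [if_neg h]; exact zero_le

/-- Claims of line `j` in the time interval `(0, t]`. -/
def positiveClaims (ω : Scenario m n) (j : Fin n) (t : ℝ) : ℝ≥0∞ :=
  ∑' i : Fin m × ℕ, if 0 < eventTime ω i ∧ eventTime ω i ≤ t ∧ (ω i).2.1 j = true then
    ((ω i).2.2 j : ℝ≥0∞) else 0

theorem claimsENN_eq_add_positiveClaims (ω : Scenario m n) (j : Fin n) {t : ℝ} (ht : 0 ≤ t) :
    claimsENN ω j (fun _ => id) t = claimsENN ω j (fun _ => id) 0 + positiveClaims ω j t := by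
  unfold claimsENN positiveClaims
  rw [← ENNReal.tsum_add]
  refine tsum_congr fun i => ?_
  rcases le_or_gt (eventTime ω i) 0 with h | h
  · simp [h, h.trans ht, h.not_gt]
  · simp [h, h.not_ge]

/-- The right-hand side only uses observed numbers. A time `p` with infinite claims contributes `0`,
because `⊤.toReal = 0`; any other `p` contributes the claims in `(0, p]`. Each surviving hit has
such a finite `p`, and the largest one serves finitely many hits at once. -/
theorem claimsENN_sanitize_rat (ω : Scenario m n) (j : Fin n) (q : ℚ) :
    claimsENN (sanitize ω) j (fun _ => id) q = ⨆ p : Icc (0 : ℚ) q,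
      ENNReal.ofReal ((claimsENN ω j (fun _ => id) (p : ℚ)).toReal
        - (claimsENN ω j (fun _ => id) 0).toReal) := by
  have key : ∀ p : ℚ, 0 ≤ p → claimsENN ω j (fun _ => id) p ≠ ⊤ →
      ENNReal.ofReal ((claimsENN ω j (fun _ => id) p).toReal
        - (claimsENN ω j (fun _ => id) 0).toReal) = positiveClaims ω j p := by
    intro p hp h
    rw [claimsENN_eq_add_positiveClaims ω j (by exact_mod_cast hp)] at h ⊢
    rw [ENNReal.add_ne_top] at h
    rw [ENNReal.toReal_add h.1 h.2, add_sub_cancel_left, ENNReal.ofReal_toReal h.2]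
  refine le_antisymm ?_ (iSup_le fun p => ?_)
  · rw [claimsENN, ENNReal.tsum_eq_iSup_sum]
    refine iSup_le fun s => ?_
    set s' := s.filter fun i => eventTime ω i ≤ q ∧ (sanitize ω i).2.1 j = true with hs'
    have hsum : ∑ i ∈ s, (if eventTime (sanitize ω) i ≤ q ∧ (sanitize ω i).2.1 j = true then
        ((id ((sanitize ω i).2.2 j) : ℝ≥0) : ℝ≥0∞) else 0) =
        ∑ i ∈ s', ((ω i).2.2 j : ℝ≥0∞) := by
      rw [hs', Finset.sum_filter]
      rfl
    rw [hsum]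
    rcases s'.eq_empty_or_nonempty with he | hne
    · simp [he]
    have hw : ∀ i ∈ s', ∃ p : ℚ, 0 < eventTime ω i ∧ eventTime ω i ≤ p ∧ p ≤ q ∧
        claimsENN ω j (fun _ => id) p ≠ ⊤ ∧ (ω i).2.1 j = true := by
      intro i hi
      obtain ⟨-, h1, h2⟩ := Finset.mem_filter.1 hi
      obtain ⟨h3, h4, p, h5, h6⟩ := (sanitize_hit_iff ω i j).1 h2
      refine ⟨min p q, h4, ?_, min_le_right _ _, ?_, h3⟩
      · rw [Rat.cast_min]; exact le_min h5 h1
      · exact ne_top_of_le_ne_top h6 (claimsENN_mono_time _ _ _ (by exact_mod_cast min_le_left _ _))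
    choose! p hp using hw
    obtain ⟨i₀, hi₀, hmax⟩ := s'.exists_max_image p hne
    have h0 : 0 ≤ p i₀ := by
      have := hp i₀ hi₀
      exact_mod_cast this.1.le.trans this.2.1
    refine le_trans ?_ (le_iSup (fun p : Icc (0 : ℚ) q =>
      ENNReal.ofReal ((claimsENN ω j (fun _ => id) (p : ℚ)).toReal
        - (claimsENN ω j (fun _ => id) 0).toReal)) ⟨p i₀, h0, (hp i₀ hi₀).2.2.1⟩)
    simp only
    rw [key _ h0 (hp i₀ hi₀).2.2.2.1, positiveClaims]
    refine le_trans (Finset.sum_le_sum fun i hi => ?_) (ENNReal.sum_le_tsum s')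
    have h1 := hp i hi
    have h2 : (p i : ℝ) ≤ p i₀ := by exact_mod_cast hmax i hi
    rw [if_pos ⟨h1.1, h1.2.1.trans h2, h1.2.2.2.2⟩]
  · obtain ⟨p, hp0, hpq⟩ := p
    simp only
    by_cases h : claimsENN ω j (fun _ => id) p = ⊤
    · rw [h, ENNReal.ofReal_of_nonpos (by simp)]
      exact zero_le
    · rw [key p hp0 h]
      refine ENNReal.tsum_le_tsum fun i => ?_
      by_cases hi : 0 < eventTime ω i ∧ eventTime ω i ≤ p ∧ (ω i).2.1 j = true
      · have hpq' : (p : ℝ) ≤ q := by exact_mod_cast hpq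
        rw [if_pos hi, if_pos ⟨hi.2.1.trans hpq',
          (sanitize_hit_iff ω i j).2 ⟨hi.2.2, hi.1, p, hi.2.1, h⟩⟩]
        exact le_rfl
      · rw [if_neg hi]; exact zero_le

/-- The claims are the distribution function of an atomic measure, and finiteness at `q > s` gives
continuity from above. -/
theorem tendsto_claimsENN_nhdsGT (ω : Scenario m n) (j : Fin n) {s q : ℝ} (hsq : s < q)
    (hq : claimsENN ω j (fun _ => id) q ≠ ⊤) :
    Tendsto (claimsENN ω j fun _ => id) (𝓝[>] s) (𝓝 (claimsENN ω j (fun _ => id) s)) := by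
  let μ : Measure ℝ := Measure.sum fun i : Fin m × ℕ =>
    (if (ω i).2.1 j = true then ((ω i).2.2 j : ℝ≥0∞) else 0) • Measure.dirac (eventTime ω i)
  have hμ : ∀ t, claimsENN ω j (fun _ => id) t = μ (Iic t) := fun t => by
    rw [Measure.sum_apply _ measurableSet_Iic, claimsENN]
    refine tsum_congr fun i => ?_
    rw [Measure.smul_apply, Measure.dirac_apply' _ measurableSet_Iic]
    by_cases h1 : eventTime ω i ≤ t <;> by_cases h2 : (ω i).2.1 j = true <;> simp [h1, h2]
  have hI : Iic s = ⋂ r > s, Iic r := by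
    ext x
    simp only [mem_Iic, mem_iInter]
    exact ⟨fun h r hr => h.trans (le_of_lt hr), fun h => le_of_forall_gt_imp_ge_of_dense h⟩
  have := tendsto_measure_biInter_gt (μ := μ) (s := Iic) (a := s)
    (fun r _ => measurableSet_Iic.nullMeasurableSet) (fun i k _ hik => Iic_subset_Iic.2 hik)
    ⟨q, hsq, by rwa [← hμ]⟩
  rw [← hI, ← hμ] at this
  exact this.congr fun t => (hμ t).symm

/-- Passage from rational to real times. If the claims of `ω` are finite somewhat after `s`, right
continuity applies. If they are infinite at all rational times in `(s, t)`, no hit after `s`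
survives and the sanitized claims stay constant from `s` on. -/
theorem claimsENN_sanitize_eq_iInf (ω : Scenario m n) (j : Fin n) {s t : ℝ} (hst : s < t) :
    claimsENN (sanitize ω) j (fun _ => id) s =
      ⨅ q : {q : ℚ // s < q ∧ (q : ℝ) < t}, claimsENN (sanitize ω) j (fun _ => id) (q : ℚ) := by
  refine le_antisymm (le_iInf fun q => claimsENN_mono_time _ _ _ q.2.1.le) ?_
  by_cases h : ∃ q : ℚ, s < q ∧ (q : ℝ) < t ∧ claimsENN ω j (fun _ => id) q ≠ ⊤
  · obtain ⟨q₀, h1, h2, h3⟩ := h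
    have h4 := tendsto_claimsENN_nhdsGT (sanitize ω) j h1
      (ne_top_of_le_ne_top h3 (claimsENN_sanitize_le _ _ _ _))
    refine le_of_forall_gt fun L hL => ?_
    obtain ⟨r, hr1, hr2⟩ := ((h4.eventually_lt_const hL).and (Ioo_mem_nhdsGT hst)).exists
    obtain ⟨q, hq1, hq2⟩ := exists_rat_btwn hr2.1
    refine lt_of_le_of_lt (iInf_le _ (⟨q, hq1, hq2.trans hr2.2⟩ :
      {q : ℚ // s < q ∧ (q : ℝ) < t})) ?_
    exact (claimsENN_mono_time _ j _ hq2.le).trans_lt hr1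
  · push Not at h
    obtain ⟨q, hq1, hq2⟩ := exists_rat_btwn hst
    refine (iInf_le _ (⟨q, hq1, hq2⟩ : {q : ℚ // s < q ∧ (q : ℝ) < t})).trans (le_of_eq ?_)
    refine tsum_congr fun i => ?_
    have : (sanitize ω i).2.1 j = true → eventTime ω i ≤ s := fun hi => by
      obtain ⟨-, -, p, hp1, hp2⟩ := (sanitize_hit_iff ω i j).1 hi
      by_contra hlt
      have hp3 : (q : ℝ) ≤ p ∨ (p : ℝ) < q := le_or_gt _ _
      rcases hp3 with hp3 | hp3
      · exact hp2 (top_le_iff.1 (h q hq1 hq2 ▸ claimsENN_mono_time ω j _ hp3))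
      · exact hp2 (h p ((not_le.1 hlt).trans_le hp1) (hp3.trans hq2))
    by_cases hi : (sanitize ω i).2.1 j = true
    · simp [hi, this hi, (this hi).trans hq1.le]
    · simp [hi]

/-- The extended claims of a sanitized scenario are observable. -/
theorem measurable_claimsENN_sanitize {Ω : Type*} {𝓖 : MeasurableSpace Ω} {g : Ω → Scenario m n}
    {j : Fin n} {t : ℝ}
    (hg : ∀ q, 0 ≤ q → q < t → Measurable[𝓖] fun x => (claimsENN (g x) j (fun _ => id) q).toReal)
    {s : ℝ} (hs : 0 ≤ s) (hst : s < t) :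
    Measurable[𝓖] fun x => claimsENN (sanitize (g x)) j (fun _ => id) s := by
  simp_rw [claimsENN_sanitize_eq_iInf _ j hst]
  refine Measurable.iInf fun q => ?_
  simp_rw [claimsENN_sanitize_rat _ j]
  refine Measurable.iSup fun p => ?_
  have hp : ((p : ℚ) : ℝ) ≤ (q : ℚ) := by exact_mod_cast p.2.2
  refine ((hg _ (by exact_mod_cast p.2.1) (hp.trans_lt q.2.2)).sub
    (hg 0 le_rfl (hs.trans_lt hst))).ennreal_ofReal

/-! ### Histories -/

namespace RiskModel

variable (M : RiskModel m n)

theorem measurable_claims_historyBefore (j : Fin n) {s t : ℝ} (hs : 0 ≤ s) (hst : s < t) :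
    Measurable[M.historyBefore t] fun ω => (claimsENN ω j (fun _ => id) s).toReal := by
  have h1 : Measurable[M.historyBefore t] (M.lineReserve j s) := by
    have h2 : Measurable[MeasurableSpace.comap (M.lineReserve j s) inferInstance]
      (M.lineReserve j s) := comap_measurable _
    refine h2.mono ?_ le_rfl
    refine le_trans ?_ (le_iSup₂_of_le s ⟨hs, hst⟩ le_rfl)
    exact le_iSup_of_le j (le_iSup₂_of_le s ⟨hs, le_rfl⟩ le_rfl)
  have h2 : (fun ω : Scenario m n => (claimsENN ω j (fun _ => id) s).toReal) =
      fun ω => M.linePremium j * s - M.lineReserve j s ω := by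
    funext ω
    simp [lineReserve, retainedClaims_eq]
  rw [h2]
  exact measurable_const.sub h1

theorem measurable_historyBefore {Ω : Type*} {𝓖 : MeasurableSpace Ω} {t : ℝ}
    {g : Ω → Scenario m n} (hg : ∀ j s, 0 ≤ s → s < t →
      Measurable[𝓖] fun x => (claimsENN (g x) j (fun _ => id) s).toReal) :
    Measurable[𝓖, M.historyBefore t] g := by
  rw [measurable_iff_comap_le, MeasurableSpace.comap_iSup]
  refine iSup_le fun s => ?_
  simp only [MeasurableSpace.comap_iSup, MeasurableSpace.comap_comp]
  refine iSup_le fun hs => iSup_le fun j => iSup_le fun s' => iSup_le fun hs' => ?_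
  rw [← measurable_iff_comap_le]
  exact measurable_const.sub (hg j s' hs'.1 (hs'.2.trans_lt hs.2))

/-- What is known before time `t` only depends on the claims before time `t`. -/
theorem eq_of_measurable_historyBefore {β : Type*} [MeasurableSpace β] [MeasurableSingletonClass β]
    {t : ℝ} {f : Scenario m n → β} (hf : Measurable[M.historyBefore t] f) {ω ω' : Scenario m n}
    (h : ∀ j s, 0 ≤ s → s < t → (claimsENN ω j (fun _ => id) s).toReal =
      (claimsENN ω' j (fun _ => id) s).toReal) : f ω = f ω' := by
  -- For two scenarios with equal observations this map is measurable even from the trivial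
  -- σ-algebra, so the preimage of `{f ω}` is empty or everything.
  let g : Bool → Scenario m n := fun b => if b then ω else ω'
  have hg : Measurable[⊥, M.historyBefore t] g := by
    refine M.measurable_historyBefore fun j s hs hst => ?_
    have : (fun x => (claimsENN (g x) j (fun _ => id) s).toReal) =
        fun _ => (claimsENN ω j (fun _ => id) s).toReal := by
      funext b
      cases b
      · exact (h j s hs hst).symm
      · rfl
    rw [this]
    exact measurable_const
  have h2 := (hf.comp hg) (measurableSet_singleton (f ω))
  rcases MeasurableSpace.measurableSet_bot_iff.1 h2 with h3 | h3
  · have : true ∈ (f ∘ g) ⁻¹' {f ω} := rfl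
    rw [h3] at this
    exact this.elim
  · have : false ∈ (f ∘ g) ⁻¹' {f ω} := h3 ▸ mem_univ _
    exact (show f ω' = f ω from this).symm

end RiskModel

/-! ### Claim distributions and premiums -/

/-- Retained part of the total claim of one event. -/
def retained (R : Fin n → Retention) (u : Mark n) : ℝ≥0 :=
  ∑ j, if u.1 j = true then R j (u.2 j) else 0

theorem measurable_retained {α : Type*} [MeasurableSpace α] {R : α → Fin n → Retention}
    (hR : ∀ j, Measurable fun q : α × ℝ≥0 => R q.1 j q.2) :
    Measurable fun q : α × Mark n => retained (R q.1) q.2 := by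
  refine Finset.measurable_fun_sum _ fun j _ => Measurable.ite ?_ ?_ measurable_const
  · exact (by fun_prop : Measurable fun q : α × Mark n => q.2.1 j) (measurableSet_singleton true)
  · exact (hR j).comp (by fun_prop : Measurable fun q : α × Mark n => (q.1, q.2.2 j))

theorem measurable_retained_const {R : Fin n → Retention} (hR : ∀ j, Measurable (R j)) :
    Measurable (retained R) :=
  (measurable_retained (α := Unit) (R := fun _ => R) fun j => (hR j).comp measurable_snd).comp
    (by fun_prop : Measurable fun u : Mark n => ((), u))

theorem retained_le_id {R : Fin n → Retention} (hR : ∀ j α, R j α ≤ α) (u : Mark n) :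
    retained R u ≤ retained (fun _ => id) u := by
  refine Finset.sum_le_sum fun j _ => ?_
  split_ifs
  · exact hR j _
  · exact le_rfl

/-- Hit lines as Boolean functions. -/
def hitEquiv (n : ℕ) : Finset (Fin n) ≃ (Fin n → Bool) where
  toFun A j := decide (j ∈ A)
  invFun h := Finset.univ.filter fun j => h j = true
  left_inv A := by ext j; simp
  right_inv h := by funext j; simp

namespace RiskModel

variable (M : RiskModel m n)

/-- Intensity measure of the marks of the events of all classes. -/
def intensity : Measure (Mark n) := ∑ k, ENNReal.ofReal (M.β k) • M.markLaw k

theorem totalβ_nonneg : 0 ≤ M.totalβ := Finset.sum_nonneg fun k _ => (M.β_pos k).le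

theorem ofReal_totalβ : ENNReal.ofReal M.totalβ = ∑ k, ENNReal.ofReal (M.β k) :=
  ENNReal.ofReal_sum_of_nonneg fun k _ => (M.β_pos k).le

theorem lintegral_intensity (f : Mark n → ℝ≥0∞) :
    ∫⁻ u, f u ∂M.intensity = ∑ k, ENNReal.ofReal (M.β k) * ∫⁻ u, f u ∂M.markLaw k := by
  rw [intensity, lintegral_finsetSum_measure]
  simp [lintegral_smul_measure]

theorem intensity_univ : M.intensity univ = ENNReal.ofReal M.totalβ := by
  rw [← lintegral_one, lintegral_intensity, ofReal_totalβ]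
  simp

instance : IsFiniteMeasure M.intensity :=
  ⟨by rw [intensity_univ]; exact ENNReal.ofReal_lt_top⟩

theorem pi_bernoulli_singleton (k : Fin m) (A : Finset (Fin n)) :
    (Measure.pi fun j => bernoulliMeasure true false (M.thin k j)) {hitEquiv n A} =
      ENNReal.ofReal ((∏ z ∈ A, (M.thin k z : ℝ)) * ∏ z ∈ Aᶜ, (1 - (M.thin k z : ℝ))) := by
  have h0 : ∀ z, 0 ≤ (M.thin k z : ℝ) := fun z => (M.thin k z).2.1
  have h1 : ∀ z, 0 ≤ 1 - (M.thin k z : ℝ) := fun z => sub_nonneg.2 (M.thin k z).2.2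
  rw [Measure.pi_singleton, ENNReal.ofReal_mul (Finset.prod_nonneg fun z _ => h0 z),
    ENNReal.ofReal_prod_of_nonneg fun z _ => h0 z, ENNReal.ofReal_prod_of_nonneg fun z _ => h1 z,
    ← Finset.prod_mul_prod_compl A]
  congr 1
  · refine Finset.prod_congr rfl fun z hz => ?_
    rw [← ofReal_measureReal, bernoulliMeasure_real_apply_of_mem_of_notMem] <;>
      simp [hitEquiv, hz]
  · refine Finset.prod_congr rfl fun z hz => ?_
    rw [← ofReal_measureReal, bernoulliMeasure_real_apply_of_notMem_of_mem] <;>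
      simp [hitEquiv, Finset.mem_compl.1 hz]

/-- Sorting the marks by their set `A` of hit lines gives the mixture that defines `G^R`; the factor
`totalβ` cancels the normalisation in `hitWeight`. -/
theorem lintegral_claimDist (hβ : 0 < M.totalβ) {R : Fin n → Retention}
    (hR : ∀ j, Measurable (R j)) {f : ℝ → ℝ≥0∞} (hf : Measurable f) :
    ENNReal.ofReal M.totalβ * ∫⁻ a, f a ∂M.claimDist R =
      ∫⁻ u, f (retained R u) ∂M.intensity := by
  have hmA : ∀ A : Finset (Fin n), Measurable fun u : Fin n → ℝ≥0 =>
      ((∑ z ∈ A, R z (u z) : ℝ≥0) : ℝ) := fun A =>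
    (Finset.measurable_fun_sum _ fun z _ => (hR z).comp (measurable_pi_apply z)).coe_nnreal_real
  have hret : Measurable fun u : Mark n => f (retained R u) :=
    hf.comp (measurable_retained_const hR).coe_nnreal_real
  have hk : ∀ k, ∫⁻ u, f (retained R u) ∂M.markLaw k = ∑ A : Finset (Fin n),
      ENNReal.ofReal ((∏ z ∈ A, (M.thin k z : ℝ)) * ∏ z ∈ Aᶜ, (1 - (M.thin k z : ℝ))) *
        ∫⁻ u, f ((∑ z ∈ A, R z (u z) : ℝ≥0) : ℝ) ∂M.sev := by
    intro k
    rw [markLaw, lintegral_prod _ hret.aemeasurable, lintegral_fintype,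
      ← Equiv.sum_comp (hitEquiv n)]
    refine Finset.sum_congr rfl fun A _ => ?_
    rw [pi_bernoulli_singleton, mul_comm]
    congr 2
    funext u
    simp [retained, hitEquiv, Finset.sum_ite_mem]
  have hw : ∀ A k, 0 ≤ (∏ z ∈ A, (M.thin k z : ℝ)) * ∏ z ∈ Aᶜ, (1 - (M.thin k z : ℝ)) :=
    fun A k => mul_nonneg (Finset.prod_nonneg fun z _ => (M.thin k z).2.1)
      (Finset.prod_nonneg fun z _ => sub_nonneg.2 (M.thin k z).2.2)
  rw [lintegral_intensity, claimDist, lintegral_finsetSum_measure, Finset.mul_sum]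
  simp_rw [hk, Finset.mul_sum]
  rw [Finset.sum_comm]
  refine Finset.sum_congr rfl fun A _ => ?_
  rw [lintegral_smul_measure, lintegral_map hf (hmA A), smul_eq_mul, ← mul_assoc,
    ← ENNReal.ofReal_mul hβ.le]
  simp_rw [← mul_assoc]
  rw [← Finset.sum_mul]
  congr 1
  rw [hitWeight, Finset.mul_sum, ENNReal.ofReal_sum_of_nonneg]
  · refine Finset.sum_congr rfl fun k _ => ?_
    rw [← ENNReal.ofReal_mul (M.β_pos k).le]
    congr 1
    field_simp
  · intro k _
    have := M.β_pos k
    have := hw A k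
    positivity

/-- Mean of the retained claims per unit of time. -/
def claimRate (R : Fin n → Retention) : ℝ≥0∞ := ∫⁻ u, (retained R u : ℝ≥0∞) ∂M.intensity

theorem claimRate_id_ne_top : M.claimRate (fun _ => id) ≠ ⊤ := by
  rw [claimRate, lintegral_intensity]
  refine ENNReal.sum_ne_top.2 fun k _ => ENNReal.mul_ne_top ENNReal.ofReal_ne_top ?_
  have h : ∫⁻ u : Mark n, (retained (fun _ => id) u : ℝ≥0∞) ∂M.markLaw k ≤
      ∑ j, M.meanSev j := by
    calc ∫⁻ u : Mark n, (retained (fun _ => id) u : ℝ≥0∞) ∂M.markLaw k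
        ≤ ∫⁻ u : Mark n, ∑ j, (u.2 j : ℝ≥0∞) ∂M.markLaw k := by
          refine lintegral_mono fun u => ?_
          rw [retained, ENNReal.ofNNReal_finsetSum]
          refine Finset.sum_le_sum fun j _ => ?_
          split_ifs <;> simp
      _ = ∑ j, M.meanSev j := by
          rw [M.lintegral_markLaw_snd k (f := fun u => ∑ j, (u j : ℝ≥0∞)) (by fun_prop),
            lintegral_finsetSum _ (by fun_prop)]
          rfl
  exact ne_top_of_le_ne_top (ENNReal.sum_ne_top.2 fun j _ => M.meanSev_ne_top j) h

theorem claimRate_le_id {R : Fin n → Retention} (hR : ∀ j α, R j α ≤ α) :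
    M.claimRate R ≤ M.claimRate fun _ => id :=
  lintegral_mono fun u => ENNReal.coe_le_coe.2 (retained_le_id hR u)

theorem ae_claimDist_nonneg {R : Fin n → Retention} (hR : ∀ j, Measurable (R j)) :
    ∀ᵐ a ∂M.claimDist R, 0 ≤ a := by
  rw [claimDist, ← Measure.sum_fintype, Measure.ae_sum_iff' (p := fun a : ℝ => 0 ≤ a)
    measurableSet_Ici]
  intro A
  refine Measure.ae_smul_measure ?_ _
  rw [ae_map_iff (p := fun a : ℝ => 0 ≤ a) (Measurable.aemeasurable ?_) measurableSet_Ici]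
  · exact ae_of_all _ fun u => NNReal.coe_nonneg _
  · exact (Finset.measurable_fun_sum _ fun z _ =>
      (hR z).comp (measurable_pi_apply z)).coe_nnreal_real

theorem totalβ_mul_claimMean (hβ : 0 < M.totalβ) {R : Fin n → Retention}
    (hR : ∀ j, Measurable (R j)) : M.totalβ * M.claimMean R = (M.claimRate R).toReal := by
  rw [claimMean, integral_eq_lintegral_of_nonneg_ae (M.ae_claimDist_nonneg hR)
    measurable_id.aestronglyMeasurable, ← ENNReal.toReal_ofReal hβ.le, ← ENNReal.toReal_mul,
    M.lintegral_claimDist hβ hR ENNReal.measurable_ofReal, claimRate]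
  simp

/-- The contract enters only through its mean retained claims, so bounds, measurability and
continuity of premiums reduce to `claimRate`. -/
theorem premium_eq (hβ : 0 < M.totalβ) {R : Fin n → Retention} (hR : ∀ j, Measurable (R j)) :
    M.premium R = (1 + M.η₁) * (M.claimRate R).toReal
      - (M.η₁ - M.η) * (M.claimRate fun _ => id).toReal := by
  rw [premium, grossPremium, reinsurancePremium, ← M.totalβ_mul_claimMean hβ hR,
    ← M.totalβ_mul_claimMean hβ (fun _ => measurable_id)]
  ring

/-- A bound for all premium rates. -/
def premiumBound : ℝ := (1 + M.η₁) * (M.claimRate fun _ => id).toReal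

theorem premiumBound_nonneg : 0 ≤ M.premiumBound := by
  have := M.η_pos
  have := M.η_le
  unfold premiumBound
  have : 0 ≤ 1 + M.η₁ := by linarith
  positivity

theorem abs_premium_le (hβ : 0 < M.totalβ) {R : Fin n → Retention} (hR : ∀ j, Measurable (R j))
    (hle : ∀ j α, R j α ≤ α) : |M.premium R| ≤ M.premiumBound := by
  have h1 := M.η_pos
  have h2 := M.η_le
  have h3 : (M.claimRate R).toReal ≤ (M.claimRate fun _ => id).toReal :=
    ENNReal.toReal_mono M.claimRate_id_ne_top (M.claimRate_le_id hle)
  have h4 : 0 ≤ (M.claimRate R).toReal := ENNReal.toReal_nonneg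
  rw [M.premium_eq hβ hR, premiumBound, abs_le]
  constructor <;> nlinarith

theorem totalβ_pos_of_premium_pos {R : Fin n → Retention} (h : 0 < M.premium R) :
    0 < M.totalβ := by
  refine lt_of_le_of_ne M.totalβ_nonneg fun h0 => ?_
  simp [premium, grossPremium, reinsurancePremium, ← h0] at h

theorem measurable_claimRate {α : Type*} [MeasurableSpace α] {R : α → Fin n → Retention}
    (hR : ∀ j, Measurable fun q : α × ℝ≥0 => R q.1 j q.2) :
    Measurable fun x => M.claimRate (R x) :=
  (measurable_retained hR).coe_nnreal_ennreal.lintegral_prod_right'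

theorem measurable_premium (hβ : 0 < M.totalβ) {α : Type*} [MeasurableSpace α]
    {R : α → Fin n → Retention} (hR : ∀ j, Measurable fun q : α × ℝ≥0 => R q.1 j q.2) :
    Measurable fun x => M.premium (R x) := by
  have h : ∀ x j, Measurable (R x j) := fun x j =>
    (hR j).comp (by fun_prop : Measurable fun α : ℝ≥0 => (x, α))
  simp_rw [fun x => M.premium_eq hβ (h x)]
  exact ((M.measurable_claimRate hR).ennreal_toReal.const_mul _).sub_const _

end RiskModel

/-! ### Dividends along one scenario -/

namespace RiskModel

namespace Strategy

variable {M : RiskModel m n} {F : Fin n → Set Retention} (π : M.Strategy F)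

/-- The surplus is nonnegative before time `t`. -/
def Solvent (x : ℝ) (ω : Scenario m n) (t : ℝ) : Prop :=
  ∀ r, 0 ≤ r → r < t → 0 ≤ π.surplus x ω r

theorem Solvent.mono {π : M.Strategy F} {x : ℝ} {ω : Scenario m n} {s t : ℝ}
    (h : π.Solvent x ω t) (hst : s ≤ t) : π.Solvent x ω s :=
  fun r h0 hr => h r h0 (hr.trans_le hst)

/-- Trades the infimum in `EReal` for a real witness `t`; beyond `discountedDividends_eq` the ruin
time is no longer needed. -/
theorem lt_ruinTime_iff {x : ℝ} {ω : Scenario m n} {s : ℝ} :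
    (s : EReal) < π.ruinTime x ω ↔ ∃ t, s < t ∧ π.Solvent x ω t := by
  constructor
  · intro h
    obtain ⟨t, h1, h2⟩ := EReal.lt_iff_exists_real_btwn.1 h
    refine ⟨t, EReal.coe_lt_coe_iff.1 h1, fun r hr hrt => ?_⟩
    by_contra hneg
    have : π.ruinTime x ω ≤ (r : EReal) := sInf_le ⟨r, ⟨hr, not_le.1 hneg⟩, rfl⟩
    exact absurd (h2.trans_le this) (not_lt.2 (EReal.coe_le_coe_iff.2 hrt.le))
  · rintro ⟨t, h1, h2⟩
    refine (EReal.coe_lt_coe_iff.2 h1).trans_le (le_sInf ?_)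
    rintro _ ⟨r, ⟨hr, hneg⟩, rfl⟩
    refine EReal.coe_le_coe_iff.2 (le_of_not_gt fun hrt => ?_)
    exact absurd (h2 r hr hrt) (not_le.2 hneg)

/-- Dividend measure. -/
def dividendMeasure (ω : Scenario m n) : Measure ℝ := (π.D_mono ω).stieltjesFunction.measure

/-- `stieltjesFunction` is built from the right limits of `D`, and its left limits return `D` by
left continuity. Intervals `[a, b)` are therefore the natural test sets, and a lump sum at `b` is
not yet part of `D b`. -/
theorem dividendMeasure_Ico (ω : Scenario m n) (a b : ℝ) :
    π.dividendMeasure ω (Ico a b) = ENNReal.ofReal (π.D b ω - π.D a ω) := by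
  have h : ∀ t, Function.leftLim (π.D_mono ω).stieltjesFunction t = π.D t ω := fun t => by
    have h1 : Tendsto (π.D_mono ω).stieltjesFunction (𝓝[<] t)
        (𝓝 (Function.leftLim (π.D_mono ω).stieltjesFunction t)) :=
      (π.D_mono ω).stieltjesFunction.mono.tendsto_leftLim t
    have h2 : Tendsto (fun s => π.D s ω) (𝓝[<] t) (𝓝 (π.D t ω)) :=
      (π.D_leftCont ω t).tendsto.mono_left (nhdsWithin_mono _ Iio_subset_Iic_self)
    refine tendsto_nhds_unique h1 (tendsto_of_tendsto_of_tendsto_of_le_of_le' h2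
      (tendsto_const_nhds (x := π.D t ω)) ?_ ?_)
    · exact Eventually.of_forall fun s => (π.D_mono ω).le_rightLim le_rfl
    · filter_upwards [self_mem_nhdsWithin] with s hs
      exact (π.D_mono ω).rightLim_le hs
  rw [dividendMeasure, StieltjesFunction.measure_Ico, h, h]

/-- The set is order-connected, so no regularity of the surplus in time is required. -/
theorem measurableSet_lt_and_solvent (x : ℝ) (ω : Scenario m n) (b : ℝ) :
    MeasurableSet {s : ℝ | 0 ≤ s ∧ ∃ t, s < t ∧ t ≤ b ∧ π.Solvent x ω t} := by
  refine OrdConnected.measurableSet ⟨fun s hs s' hs' r hr => ?_⟩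
  obtain ⟨t, ht, h⟩ := hs'.2
  exact ⟨hs.1.trans hr.1, t, hr.2.trans_lt ht, h⟩

theorem measurableSet_solvent (x : ℝ) (ω : Scenario m n) :
    MeasurableSet {s : ℝ | 0 ≤ s ∧ ∃ t, s < t ∧ π.Solvent x ω t} := by
  refine OrdConnected.measurableSet ⟨fun s hs s' hs' r hr => ?_⟩
  obtain ⟨t, ht, h⟩ := hs'.2
  exact ⟨hs.1.trans hr.1, t, hr.2.trans_lt ht, h⟩

/-- Discounted dividends before time `b` (and before ruin). -/
def earlyDividends (x : ℝ) (ω : Scenario m n) (b : ℝ) : ℝ≥0∞ :=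
  ∫⁻ s in {s : ℝ | 0 ≤ s ∧ ∃ t, s < t ∧ t ≤ b ∧ π.Solvent x ω t},
    ENNReal.ofReal (Real.exp (-M.δ * s)) ∂π.dividendMeasure ω

theorem discountedDividends_eq (x : ℝ) (ω : Scenario m n) :
    π.discountedDividends x ω = ∫⁻ s in {s : ℝ | 0 ≤ s ∧ ∃ t, s < t ∧ π.Solvent x ω t},
      ENNReal.ofReal (Real.exp (-M.δ * s)) ∂π.dividendMeasure ω := by
  simp only [discountedDividends, lt_ruinTime_iff]
  rfl

theorem earlyDividends_congr {π π' : M.Strategy F} {x x' : ℝ} {ω ω' : Scenario m n} {b : ℝ}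
    (hX : ∀ r, 0 ≤ r → r < b → π.surplus x ω r = π'.surplus x' ω' r)
    (hD : ∀ s, 0 ≤ s → s ≤ b → π.D s ω = π'.D s ω') :
    π.earlyDividends x ω b = π'.earlyDividends x' ω' b := by
  have hS : {s : ℝ | 0 ≤ s ∧ ∃ t, s < t ∧ t ≤ b ∧ π.Solvent x ω t} =
      {s : ℝ | 0 ≤ s ∧ ∃ t, s < t ∧ t ≤ b ∧ π'.Solvent x' ω' t} := by
    ext s
    refine and_congr_right fun _ => exists_congr fun t => and_congr_right fun _ =>
      and_congr_right fun htb => ?_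
    refine forall_congr' fun r => forall_congr' fun h0 => forall_congr' fun hr => ?_
    rw [hX r h0 (hr.trans_le htb)]
  have hsub : {s : ℝ | 0 ≤ s ∧ ∃ t, s < t ∧ t ≤ b ∧ π'.Solvent x' ω' t} ⊆ Ico 0 b :=
    fun s hs => ⟨hs.1, by obtain ⟨t, h1, h2, -⟩ := hs.2; exact h1.trans_le h2⟩
  have hμ : (π.dividendMeasure ω).restrict (Ico 0 b) =
      (π'.dividendMeasure ω').restrict (Ico 0 b) := by
    refine Measure.ext_of_Ico' _ _ (fun c d _ => ?_) fun c d _ => ?_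
    · rw [Measure.restrict_apply measurableSet_Ico, Ico_inter_Ico, dividendMeasure_Ico]
      exact ENNReal.ofReal_ne_top
    · simp only [Measure.restrict_apply measurableSet_Ico, Ico_inter_Ico]
      rcases lt_or_ge (max c 0) (min d b) with h | h
      · have h0 : 0 ≤ max c 0 := le_max_right _ _
        have hb : min d b ≤ b := min_le_right _ _
        rw [dividendMeasure_Ico, dividendMeasure_Ico, hD _ (h0.trans h.le) hb,
          hD _ h0 (h.le.trans hb)]
      · rw [Ico_eq_empty_of_le h]; simp
  unfold earlyDividends
  rw [hS, ← Measure.restrict_restrict_of_subset hsub, hμ, Measure.restrict_restrict_of_subset hsub]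

/-- A lump sum at `b` itself becomes a lump sum at time `0` of the restarted strategy, in accordance
with the closed end of `Ici b`. -/
theorem dividendMeasure_shift {π π' : M.Strategy F} {ω ω' : Scenario m n} {b : ℝ}
    (hD : ∀ s, 0 ≤ s → π'.D s ω' = π.D (b + s) ω - π.D b ω) :
    (π.dividendMeasure ω).restrict (Ici b) =
      ((π'.dividendMeasure ω').restrict (Ici 0)).map (b + ·) := by
  have hm : Measurable fun s : ℝ => b + s := measurable_const_add b
  refine Measure.ext_of_Ico' _ _ (fun c d _ => ?_) fun c d _ => ?_
  · rw [Measure.restrict_apply measurableSet_Ico, Ico_inter_Ici, dividendMeasure_Ico]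
    exact ENNReal.ofReal_ne_top
  · rw [Measure.map_apply hm measurableSet_Ico,
      Measure.restrict_apply measurableSet_Ico, Measure.restrict_apply (hm measurableSet_Ico),
      preimage_const_add_Ico, Ico_inter_Ici, Ico_inter_Ici, dividendMeasure_Ico,
      dividendMeasure_Ico]
    rcases le_or_gt (max c b) d with h | h
    · have hb : b ≤ max c b := le_max_right _ _
      rw [hD _ (by linarith), hD _ (le_max_right _ _), add_sub_cancel,
        show b + max (c - b) 0 = max c b by rw [← max_add_add_left]; simp]
      congr 1
      ring
    · rw [ENNReal.ofReal_of_nonpos (sub_nonpos.2 (π.D_mono ω h.le)),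
        ENNReal.ofReal_of_nonpos (sub_nonpos.2 (π'.D_mono ω' _))]
      rw [← sub_self b, max_sub_sub_right]
      linarith

/-- Dynamic programming along one scenario. -/
theorem discountedDividends_split {π π' : M.Strategy F} {x y : ℝ} {ω ω' : Scenario m n} {b : ℝ}
    (hb : 0 ≤ b) (hX : ∀ s, 0 ≤ s → π.surplus x ω (b + s) = π'.surplus y ω' s)
    (hD : ∀ s, 0 ≤ s → π'.D s ω' = π.D (b + s) ω - π.D b ω) :
    π.discountedDividends x ω = π.earlyDividends x ω b +
      {_s : Unit | π.Solvent x ω b}.indicator (fun _ => ENNReal.ofReal (Real.exp (-M.δ * b)) *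
        π'.discountedDividends y ω') () := by
  set S := {s : ℝ | 0 ≤ s ∧ ∃ t, s < t ∧ π.Solvent x ω t} with hSdef
  have hSm : MeasurableSet S := π.measurableSet_solvent x ω
  have h1 : S ∩ Iio b = {s : ℝ | 0 ≤ s ∧ ∃ t, s < t ∧ t ≤ b ∧ π.Solvent x ω t} := by
    ext s
    constructor
    · rintro ⟨⟨h0, t, h1, h2⟩, h3⟩
      exact ⟨h0, min t b, lt_min h1 h3, min_le_right _ _, h2.mono (min_le_left _ _)⟩
    · rintro ⟨h0, t, h1, h2, h3⟩
      exact ⟨⟨h0, t, h1, h3⟩, h1.trans_le h2⟩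
  rw [discountedDividends_eq, ← lintegral_inter_add_sdiff _ _ measurableSet_Iio (B := Iio b), h1]
  unfold earlyDividends
  congr 1
  have h2 : S \ Iio b = S ∩ Ici b := by ext s; simp
  rw [h2]
  by_cases hsol : π.Solvent x ω b
  · rw [indicator_of_mem (by exact hsol), discountedDividends_eq,
      ← Measure.restrict_restrict hSm, dividendMeasure_shift hD,
      setLIntegral_map hSm (by fun_prop) (measurable_const_add b),
      Measure.restrict_restrict (measurable_const_add b hSm),
      ← lintegral_const_mul _ (by fun_prop)]
    have h3 : (fun s => b + s) ⁻¹' S ∩ Ici 0 =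
        {s : ℝ | 0 ≤ s ∧ ∃ t, s < t ∧ π'.Solvent y ω' t} := by
      ext s
      constructor
      · rintro ⟨⟨-, t, h4, h5⟩, h6⟩
        refine ⟨h6, t - b, by linarith, fun r hr hrt => ?_⟩
        rw [← hX r hr]
        exact h5 _ (by linarith) (by linarith)
      · rintro ⟨h4, t, h5, h6⟩
        refine ⟨⟨by linarith, b + t, by linarith, fun r hr hrt => ?_⟩, h4⟩
        rcases lt_or_ge r b with h7 | h7
        · exact hsol r hr h7
        · have := h6 (r - b) (by linarith) (by linarith)
          rwa [← hX _ (by linarith), add_sub_cancel] at this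
    rw [h3]
    refine lintegral_congr fun s => ?_
    rw [← ENNReal.ofReal_mul (Real.exp_pos _).le, ← Real.exp_add]
    ring_nf
  · rw [indicator_of_notMem (by exact hsol)]
    have h3 : S ∩ Ici b = ∅ := by
      ext s
      simp only [mem_inter_iff, mem_Ici, mem_empty_iff_false, iff_false, not_and, not_le]
      rintro ⟨-, t, h4, h5⟩
      by_contra h6
      exact hsol (h5.mono ((not_lt.1 h6).trans h4.le))
    rw [h3]
    simp

/-! ### Bounds -/

theorem R_le (hF : ∀ j, IsReinsuranceFamily (F j)) (t : ℝ) (ω : Scenario m n) (j : Fin n)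
    (α : ℝ≥0) : π.R t ω j α ≤ α :=
  (hF j).le_self _ (π.R_mem t ω j) α

theorem measurable_R_time (ω : Scenario m n) (j : Fin n) :
    Measurable fun q : ℝ × ℝ≥0 => π.R q.1 ω j q.2 :=
  (π.R_measurable j).comp (by fun_prop : Measurable fun q : ℝ × ℝ≥0 => (ω, q.2, q.1))

theorem measurable_R (t : ℝ) (ω : Scenario m n) (j : Fin n) : Measurable (π.R t ω j) :=
  (π.measurable_R_time ω j).comp (by fun_prop : Measurable fun α : ℝ≥0 => (t, α))

theorem abs_premium_le (hF : ∀ j, IsReinsuranceFamily (F j)) (hβ : 0 < M.totalβ) (t : ℝ)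
    (ω : Scenario m n) : |M.premium (π.R t ω)| ≤ M.premiumBound :=
  M.abs_premium_le hβ (π.measurable_R t ω) (π.R_le hF t ω)

theorem measurable_premium (hβ : 0 < M.totalβ) (ω : Scenario m n) :
    Measurable fun t => M.premium (π.R t ω) :=
  M.measurable_premium hβ (π.measurable_R_time ω)

theorem intervalIntegrable_premium (hF : ∀ j, IsReinsuranceFamily (F j)) (hβ : 0 < M.totalβ)
    (ω : Scenario m n) (a b : ℝ) :
    IntervalIntegrable (fun t => M.premium (π.R t ω)) volume a b := by
  refine (intervalIntegrable_const (c := M.premiumBound)).mono_fun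
    (π.measurable_premium hβ ω).aestronglyMeasurable (ae_of_all _ fun t => ?_)
  simp only [Real.norm_eq_abs, abs_of_nonneg M.premiumBound_nonneg]
  exact π.abs_premium_le hF hβ t ω

theorem abs_integral_premium_le (hF : ∀ j, IsReinsuranceFamily (F j)) (hβ : 0 < M.totalβ)
    (ω : Scenario m n) {t : ℝ} (ht : 0 ≤ t) :
    |∫ s in (0 : ℝ)..t, M.premium (π.R s ω)| ≤ M.premiumBound * t := by
  have := intervalIntegral.norm_integral_le_of_norm_le_const (a := 0) (b := t)
    (f := fun s => M.premium (π.R s ω)) (C := M.premiumBound)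
    fun s _ => π.abs_premium_le hF hβ s ω
  rwa [sub_zero, abs_of_nonneg ht] at this

theorem surplus_le (hF : ∀ j, IsReinsuranceFamily (F j)) (hβ : 0 < M.totalβ) (x : ℝ)
    (ω : Scenario m n) {t : ℝ} (ht : 0 ≤ t) :
    π.surplus x ω t ≤ x + M.premiumBound * t - π.D t ω := by
  have h1 := (abs_le.1 (π.abs_integral_premium_le hF hβ ω ht)).2
  have h2 : 0 ≤ ∑ j, retainedClaims ω j (fun s => π.R s ω j) t :=
    Finset.sum_nonneg fun j _ => ENNReal.toReal_nonneg
  unfold surplus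
  linarith

theorem D_nonneg (t : ℝ) (ω : Scenario m n) : 0 ≤ π.D t ω := by
  rcases le_total t 0 with h | h
  · exact (π.D_zero t h ω).ge
  · rw [← π.D_zero 0 le_rfl ω]
    exact π.D_mono ω h

theorem surplus_add (x h : ℝ) (ω : Scenario m n) (t : ℝ) :
    π.surplus (x + h) ω t = π.surplus x ω t + h := by
  unfold surplus
  ring

theorem Solvent.mono_left {π : M.Strategy F} {x y : ℝ} (hxy : x ≤ y) {ω : Scenario m n} {t : ℝ}
    (h : π.Solvent x ω t) : π.Solvent y ω t := fun r h0 hr => by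
  have := π.surplus_add x (y - x) ω r
  rw [add_sub_cancel] at this
  rw [this]
  linarith [h r h0 hr]

theorem discountedDividends_mono (ω : Scenario m n) :
    Monotone fun x => π.discountedDividends x ω := fun x y hxy => by
  simp only [discountedDividends_eq]
  exact lintegral_mono_set fun s ⟨h0, t, h1, h2⟩ => ⟨h0, t, h1, h2.mono_left hxy⟩

theorem value_mono : Monotone π.value := fun _ _ hxy =>
  lintegral_mono fun ω => π.discountedDividends_mono ω hxy

theorem discountedDividends_of_neg {x : ℝ} (hF : ∀ j, IsReinsuranceFamily (F j))
    (hβ : 0 < M.totalβ) (hx : x < 0) (ω : Scenario m n) : π.discountedDividends x ω = 0 := by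
  rw [discountedDividends_eq]
  have : {s : ℝ | 0 ≤ s ∧ ∃ t, s < t ∧ π.Solvent x ω t} = ∅ := by
    ext s
    simp only [mem_ofPred_eq, mem_empty_iff_false, iff_false]
    rintro ⟨h0, t, h1, h2⟩
    have h3 := h2 0 le_rfl (h0.trans_lt h1)
    have h4 := π.surplus_le hF hβ x ω le_rfl
    rw [π.D_zero 0 le_rfl ω] at h4
    linarith
  rw [this]
  simp

theorem value_of_neg {x : ℝ} (hF : ∀ j, IsReinsuranceFamily (F j))
    (hβ : 0 < M.totalβ) (hx : x < 0) : π.value x = 0 := by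
  simp [value, π.discountedDividends_of_neg hF hβ hx]

/-- Solvency is only known strictly before `t`; left continuity of `D` carries the bound to `t`. -/
theorem D_le_of_solvent (hF : ∀ j, IsReinsuranceFamily (F j)) (hβ : 0 < M.totalβ) {x : ℝ}
    {ω : Scenario m n} {t : ℝ} (ht : 0 < t) (h : π.Solvent x ω t) :
    π.D t ω ≤ x + M.premiumBound * t := by
  have h2 : Tendsto (fun s => π.D s ω) (𝓝[<] t) (𝓝 (π.D t ω)) :=
    (π.D_leftCont ω t).tendsto.mono_left (nhdsWithin_mono _ Iio_subset_Iic_self)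
  refine le_of_tendsto h2 ?_
  filter_upwards [Ioo_mem_nhdsLT ht] with s hs
  have h3 := h s hs.1.le hs.2
  have h4 := π.surplus_le hF hβ x ω hs.1.le
  have h5 : M.premiumBound * s ≤ M.premiumBound * t :=
    mul_le_mul_of_nonneg_left hs.2.le M.premiumBound_nonneg
  linarith

theorem dividendMeasure_solvent_le (hF : ∀ j, IsReinsuranceFamily (F j)) (hβ : 0 < M.totalβ)
    {x : ℝ} (ω : Scenario m n) (b : ℝ) :
    π.dividendMeasure ω {s : ℝ | 0 ≤ s ∧ ∃ t, s < t ∧ t ≤ b ∧ π.Solvent x ω t} ≤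
      ENNReal.ofReal (x + M.premiumBound * b) := by
  set S := {s : ℝ | 0 ≤ s ∧ ∃ t, s < t ∧ t ≤ b ∧ π.Solvent x ω t}
  rcases S.eq_empty_or_nonempty with he | hne
  · rw [he]; simp
  have hbdd : BddAbove S := ⟨b, fun s ⟨_, t, h1, h2, _⟩ => (h1.trans_le h2).le⟩
  -- The supremum is not attained, and solvency holds on all of `[0, ρ)`. Thus the mass of `S` is at
  -- most `D ρ`, which excludes a lump sum at `ρ`.
  set ρ := sSup S
  have hlt : ∀ s ∈ S, s < ρ := by
    rintro s ⟨h0, t, h1, h2, h3⟩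
    obtain ⟨r, hr1, hr2⟩ := exists_between h1
    exact hr1.trans_le (le_csSup hbdd ⟨h0.trans hr1.le, t, hr2, h2, h3⟩)
  have hρb : ρ ≤ b := csSup_le hne fun s ⟨_, t, h1, h2, _⟩ => (h1.trans_le h2).le
  have hρ0 : 0 < ρ := by
    obtain ⟨s, hs⟩ := hne
    exact hs.1.trans_lt (hlt s hs)
  have hsol : π.Solvent x ω ρ := fun r h0 hr => by
    obtain ⟨s, ⟨_, t, h1, _, h3⟩, hs⟩ := exists_lt_of_lt_csSup hne hr
    exact h3 r h0 (hs.trans h1)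
  calc π.dividendMeasure ω S ≤ π.dividendMeasure ω (Ico 0 ρ) :=
        measure_mono fun s hs => ⟨hs.1, hlt s hs⟩
    _ = ENNReal.ofReal (π.D ρ ω) := by
        rw [dividendMeasure_Ico, π.D_zero 0 le_rfl, sub_zero]
    _ ≤ ENNReal.ofReal (x + M.premiumBound * b) := by
        refine ENNReal.ofReal_le_ofReal ((π.D_le_of_solvent hF hβ hρ0 hsol).trans ?_)
        have := mul_le_mul_of_nonneg_left hρb M.premiumBound_nonneg
        linarith

theorem earlyDividends_le_measure (x : ℝ) (ω : Scenario m n) (b : ℝ) :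
    π.earlyDividends x ω b ≤
      π.dividendMeasure ω {s : ℝ | 0 ≤ s ∧ ∃ t, s < t ∧ t ≤ b ∧ π.Solvent x ω t} := by
  have hS := π.measurableSet_lt_and_solvent x ω b
  rw [← setLIntegral_one]
  refine setLIntegral_mono measurable_const fun s hs => ?_
  rw [ENNReal.ofReal_le_one, Real.exp_le_one_iff]
  have := mul_nonneg M.δ_pos.le hs.1
  linarith

theorem earlyDividends_le (hF : ∀ j, IsReinsuranceFamily (F j)) (hβ : 0 < M.totalβ)
    (x : ℝ) (ω : Scenario m n) (b : ℝ) :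
    π.earlyDividends x ω b ≤ ENNReal.ofReal (x + M.premiumBound * b) :=
  (π.earlyDividends_le_measure x ω b).trans (π.dividendMeasure_solvent_le hF hβ ω b)

theorem earlyDividends_le_D (x : ℝ) (ω : Scenario m n) (b : ℝ) :
    π.earlyDividends x ω b ≤ ENNReal.ofReal (π.D b ω) := by
  refine (π.earlyDividends_le_measure x ω b).trans ?_
  calc _ ≤ π.dividendMeasure ω (Ico 0 b) :=
        measure_mono (by rintro s ⟨h0, t, h1, h2, _⟩; exact ⟨h0, h1.trans_le h2⟩)
    _ = ENNReal.ofReal (π.D b ω) := by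
        rw [dividendMeasure_Ico, π.D_zero 0 le_rfl, sub_zero]

theorem earlyDividends_mono (x : ℝ) (ω : Scenario m n) : Monotone (π.earlyDividends x ω) :=
  fun _ _ hab => lintegral_mono_set fun _ ⟨h0, t, h1, h2, h3⟩ => ⟨h0, t, h1, h2.trans hab, h3⟩

/-- Payments in `[N, N + 1)` are discounted at least by `exp (-δ N)`, and solvency limits all
payments before `N + 1`. The bound depends on neither strategy nor scenario, whence `V` is finite.
-/
theorem discountedDividends_le_tsum (hF : ∀ j, IsReinsuranceFamily (F j)) (hβ : 0 < M.totalβ)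
    (x : ℝ) (ω : Scenario m n) : π.discountedDividends x ω ≤ ∑' N : ℕ,
      ENNReal.ofReal (Real.exp (-M.δ * N)) * ENNReal.ofReal (x + M.premiumBound * (N + 1)) := by
  rw [discountedDividends_eq]
  set S := {s : ℝ | 0 ≤ s ∧ ∃ t, s < t ∧ π.Solvent x ω t}
  have hsub : S ⊆ ⋃ N : ℕ, S ∩ Ico (N : ℝ) (N + 1) := by
    intro s hs
    refine mem_iUnion.2 ⟨⌊s⌋₊, hs, Nat.floor_le hs.1, Nat.lt_floor_add_one s⟩
  refine (lintegral_mono_set hsub).trans ((lintegral_iUnion_le _ _).trans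
    (ENNReal.tsum_le_tsum fun N => ?_))
  have hm : MeasurableSet (S ∩ Ico (N : ℝ) (N + 1)) :=
    (π.measurableSet_solvent x ω).inter measurableSet_Ico
  calc ∫⁻ s in S ∩ Ico (N : ℝ) (N + 1), ENNReal.ofReal (Real.exp (-M.δ * s)) ∂π.dividendMeasure ω
      ≤ ∫⁻ _ in S ∩ Ico (N : ℝ) (N + 1), ENNReal.ofReal (Real.exp (-M.δ * N))
          ∂π.dividendMeasure ω := by
        refine setLIntegral_mono measurable_const fun s hs => ENNReal.ofReal_le_ofReal ?_
        rw [Real.exp_le_exp]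
        nlinarith [M.δ_pos, hs.2.1]
    _ = ENNReal.ofReal (Real.exp (-M.δ * N)) * π.dividendMeasure ω (S ∩ Ico (N : ℝ) (N + 1)) :=
        setLIntegral_const _ _
    _ ≤ _ := by
        gcongr
        refine le_trans (measure_mono ?_) (π.dividendMeasure_solvent_le hF hβ ω (N + 1))
        rintro s ⟨⟨h0, t, h1, h2⟩, h3⟩
        exact ⟨h0, min t (N + 1), lt_min h1 h3.2, min_le_right _ _, h2.mono (min_le_left _ _)⟩

end Strategy

variable (M : RiskModel m n) {F : Fin n → Set Retention}

theorem summable_dividend_bound (x : ℝ) : ∑' N : ℕ, ENNReal.ofReal (Real.exp (-M.δ * N)) *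
    ENNReal.ofReal (x + M.premiumBound * (N + 1)) ≠ ⊤ := by
  have hr : ‖Real.exp (-M.δ)‖ < 1 := by
    rw [Real.norm_eq_abs, abs_of_pos (Real.exp_pos _), Real.exp_lt_one_iff]
    linarith [M.δ_pos]
  have h0 := summable_pow_mul_geometric_of_norm_lt_one 0 hr
  have h1 := summable_pow_mul_geometric_of_norm_lt_one 1 hr
  have hs : Summable fun N : ℕ => Real.exp (-M.δ * N) * (|x| + M.premiumBound * (N + 1)) := by
    refine ((h0.mul_left (|x| + M.premiumBound)).add (h1.mul_left M.premiumBound)).congr fun N => ?_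
    rw [mul_comm (-M.δ), Real.exp_nat_mul]
    ring
  refine ne_top_of_le_ne_top hs.tsum_ofReal_ne_top (ENNReal.tsum_le_tsum fun N => ?_)
  rw [← ENNReal.ofReal_mul (Real.exp_pos _).le]
  refine ENNReal.ofReal_le_ofReal (mul_le_mul_of_nonneg_left ?_ (Real.exp_pos _).le)
  linarith [le_abs_self x]

theorem optimalValueENN_ne_top (hF : ∀ j, IsReinsuranceFamily (F j)) (hβ : 0 < M.totalβ)
    (x : ℝ) : M.optimalValueENN F x ≠ ⊤ := by
  refine ne_top_of_le_ne_top (M.summable_dividend_bound x) (iSup_le fun π => ?_)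
  calc π.value x ≤ ∫⁻ _, (∑' N : ℕ, ENNReal.ofReal (Real.exp (-M.δ * N)) *
        ENNReal.ofReal (x + M.premiumBound * (N + 1))) ∂M.prob :=
        lintegral_mono fun ω => π.discountedDividends_le_tsum hF hβ x ω
    _ = _ := by simp

theorem optimalValueENN_mono : Monotone (M.optimalValueENN F) := fun _ _ hxy =>
  iSup_mono fun π => π.value_mono hxy

theorem optimalValueENN_of_neg (hF : ∀ j, IsReinsuranceFamily (F j)) (hβ : 0 < M.totalβ)
    {x : ℝ} (hx : x < 0) : M.optimalValueENN F x = 0 := by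
  simp [optimalValueENN, fun π : M.Strategy F => π.value_of_neg hF hβ hx]

end RiskModel

/-! ### Constructions of strategies -/

theorem measurable_apply_index {X Y : Type*} [MeasurableSpace X] [MeasurableSpace Y] {I : X → ℕ}
    (hI : Measurable I) {f : ℕ → X → Y} (hf : ∀ i, Measurable (f i)) :
    Measurable fun x => f (I x) x := by
  have : Measurable fun q : ℕ × X => f q.1 q.2 := measurable_from_prod_countable_right hf
  exact this.comp (hI.prodMk measurable_id)

namespace RiskModel

namespace Strategy

variable {M : RiskModel m n} {F : Fin n → Set Retention}

/-- Constant retention and no dividends. -/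
def const (M : RiskModel m n) (hF : ∀ j, IsReinsuranceFamily (F j)) (R : Fin n → Retention)
    (hR : ∀ j, R j ∈ F j) : M.Strategy F where
  R _ _ := R
  R_mem _ _ := hR
  R_measurable j := ((hF j).measurable _ (hR j)).comp (by fun_prop)
  R_predictable _ _ _ _ := measurable_const
  D _ _ := 0
  D_zero _ _ _ := rfl
  D_mono _ := monotone_const
  D_leftCont _ _ := continuousWithinAt_const
  D_predictable _ _ := measurable_const

/-- An additional lump sum at time `0`. -/
def addLump (π : M.Strategy F) {h : ℝ} (hh : 0 ≤ h) : M.Strategy F where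
  R := π.R
  R_mem := π.R_mem
  R_measurable := π.R_measurable
  R_predictable := π.R_predictable
  D t ω := if t ≤ 0 then 0 else π.D t ω + h
  D_zero t ht ω := if_pos ht
  D_mono ω s t hst := by
    have h1 := π.D_mono ω hst
    have h2 := π.D_nonneg t ω
    simp only at h1 ⊢
    split_ifs <;> linarith
  D_leftCont ω t := by
    rcases le_or_gt t 0 with ht | ht
    · refine (continuousWithinAt_const (b := (0 : ℝ))).congr (fun s hs => ?_) (if_pos ht)
      exact if_pos (le_trans hs ht)
    · refine ((π.D_leftCont ω t).add_const h).congr_of_eventuallyEq ?_ (if_neg ht.not_ge)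
      filter_upwards [mem_nhdsWithin_of_mem_nhds (Ioi_mem_nhds ht)] with s hs
      exact if_neg (not_le.2 hs)
  D_predictable t ht := by
    by_cases h0 : t ≤ 0
    · simp only [h0, if_true]; exact measurable_const
    · simp only [h0, if_false]; exact (π.D_predictable t ht).add_const h

/-- The strategy `π` from time `b` on, for the scenarios `Ψ ω`. -/
def restart (π : M.Strategy F) {b : ℝ} (hb : 0 ≤ b) (Ψ : Scenario m n → Scenario m n)
    (hΨm : Measurable Ψ)
    (hΨ : ∀ j r t, 0 ≤ t → 0 ≤ r → r < b + t → Measurable[M.historyBefore t] fun ω =>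
      (claimsENN (Ψ ω) j (fun _ => id) r).toReal) : M.Strategy F where
  R t ω := π.R (b + t) (Ψ ω)
  R_mem t ω := π.R_mem _ _
  R_measurable j := (π.R_measurable j).comp (by fun_prop :
    Measurable fun q : Scenario m n × ℝ≥0 × ℝ => (Ψ q.1, q.2.1, b + q.2.2))
  R_predictable t ht j α := (π.R_predictable (b + t) (add_nonneg hb ht) j α).comp
    (M.measurable_historyBefore fun j s hs hst => hΨ j s t ht hs hst)
  D t ω := if t ≤ 0 then 0 else π.D (b + t) (Ψ ω) - π.D b (Ψ ω)
  D_zero t ht ω := if_pos ht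
  D_mono ω s t hst := by
    have h1 : π.D (b + s) (Ψ ω) ≤ π.D (b + t) (Ψ ω) := π.D_mono _ (by linarith)
    simp only
    by_cases hs : s ≤ 0
    · rw [if_pos hs]
      split_ifs with ht
      · exact le_rfl
      · exact sub_nonneg.2 (π.D_mono _ (by linarith))
    · rw [if_neg hs, if_neg (by linarith)]
      linarith
  D_leftCont ω t := by
    rcases le_or_gt t 0 with ht | ht
    · refine (continuousWithinAt_const (b := (0 : ℝ))).congr (fun s hs => ?_) (if_pos ht)
      exact if_pos (le_trans hs ht)
    · have h1 : ContinuousWithinAt (fun s => π.D (b + s) (Ψ ω)) (Iic t) t :=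
        (π.D_leftCont (Ψ ω) (b + t)).comp (f := fun s => b + s)
          (continuous_const_add b).continuousWithinAt fun s hs => add_le_add_right hs b
      have h2 : ContinuousWithinAt (fun s => π.D (b + s) (Ψ ω) - π.D b (Ψ ω)) (Iic t) t :=
        h1.sub continuousWithinAt_const
      refine h2.congr_of_eventuallyEq ?_ (if_neg ht.not_ge)
      filter_upwards [mem_nhdsWithin_of_mem_nhds (Ioi_mem_nhds ht)] with s hs
      exact if_neg (not_le.2 hs)
  D_predictable t ht := by
    by_cases h0 : t ≤ 0
    · simp only [h0, if_true]; exact measurable_const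
    · simp only [h0, if_false]
      refine ((π.D_predictable (b + t) (add_nonneg hb ht)).comp
        (M.measurable_historyBefore fun j s hs hst => hΨ j s t ht hs hst)).sub
        ((π.D_predictable b hb).comp
        (M.measurable_historyBefore fun j s hs hst => hΨ j s t ht hs ?_))
      linarith

/-- Line-wise claims up to time `T`, as far as they can be observed. -/
def observedClaims (T : ℝ) (ω : Scenario m n) (j : Fin n) : ℝ≥0 :=
  (claimsENN ω j (fun _ => id) T).toReal.toNNReal

theorem measurable_switch_index {T t : ℝ} (hT : 0 ≤ T) (ht : T < t) {I : (Fin n → ℝ≥0) → ℕ}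
    (hI : Measurable I) :
    Measurable[M.historyBefore t] fun ω : Scenario m n => I (observedClaims T ω) := by
  have h : Measurable[M.historyBefore t] (observedClaims T : Scenario m n → Fin n → ℝ≥0) := by
    rw [@measurable_pi_iff]
    exact fun j => (M.measurable_claims_historyBefore j hT ht).real_toNNReal
  exact hI.comp h

/-- The scenario seen from `T` reveals before `t - T` only what is known before `t`. Its extended
claims can be recovered from the observed real numbers because it has been sanitized. -/
theorem measurable_switch_scenario {T t : ℝ} (hT : 0 ≤ T) :
    Measurable[M.historyBefore t, M.historyBefore (t - T)] fun ω : Scenario m n =>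
      sanitize (shiftWaits (fun _ => -T) ω) := by
  refine M.measurable_historyBefore fun j s hs hst => Measurable.ennreal_toReal ?_
  refine measurable_claimsENN_sanitize (t := t - T) (fun q hq hqt => ?_) hs hst
  simp_rw [claimsENN_shiftWaits]
  exact M.measurable_claims_historyBefore j (by linarith) (by linarith)

/-- Constant retention `R` and no dividends until time `T`, afterwards one of the strategies `π i`,
chosen by means of the claims observed up to time `T`. -/
def switch (hF : ∀ j, IsReinsuranceFamily (F j)) (R : Fin n → Retention) (hR : ∀ j, R j ∈ F j)
    {T : ℝ} (hT : 0 ≤ T) {I : (Fin n → ℝ≥0) → ℕ} (hI : Measurable I) (π : ℕ → M.Strategy F) :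
    M.Strategy F where
  -- The claims up to and including `T` are predictable information only strictly after `T`, so `R`
  -- is still in force at `T`.
  R t ω := if t ≤ T then R else
    (π (I (observedClaims T ω))).R (t - T) (sanitize (shiftWaits (fun _ => -T) ω))
  R_mem t ω j := by
    split_ifs
    · exact hR j
    · exact Strategy.R_mem _ _ _ _
  R_measurable j := by
    have hθ : Measurable fun ω : Scenario m n => sanitize (shiftWaits (fun _ => -T) ω) :=
      measurable_sanitize.comp (measurable_shiftWaits measurable_const measurable_id)
    have hI' : Measurable fun q : Scenario m n × ℝ≥0 × ℝ => I (observedClaims T q.1) := by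
      refine hI.comp (measurable_pi_iff.2 fun j => ?_)
      exact ((measurable_claimsENN_id j T).comp measurable_fst).ennreal_toReal.real_toNNReal
    have h1 : Measurable fun q : Scenario m n × ℝ≥0 × ℝ => (π (I (observedClaims T q.1))).R
        (q.2.2 - T) (sanitize (shiftWaits (fun _ => -T) q.1)) j q.2.1 :=
      measurable_apply_index hI' (f := fun i (q : Scenario m n × ℝ≥0 × ℝ) => (π i).R
        (q.2.2 - T) (sanitize (shiftWaits (fun _ => -T) q.1)) j q.2.1) fun i =>
        ((π i).R_measurable j).comp ((hθ.comp measurable_fst).prodMk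
          (by fun_prop : Measurable fun q : Scenario m n × ℝ≥0 × ℝ => (q.2.1, q.2.2 - T)))
    have h2 : Measurable fun q : Scenario m n × ℝ≥0 × ℝ => R j q.2.1 :=
      ((hF j).measurable _ (hR j)).comp (by fun_prop)
    simp only [ite_apply]
    exact Measurable.ite (p := fun q : Scenario m n × ℝ≥0 × ℝ => q.2.2 ≤ T)
      (measurableSet_le (by fun_prop) measurable_const) h2 h1
  R_predictable t ht j α := by
    by_cases h : t ≤ T
    · simp only [h, if_true]; exact measurable_const
    · simp only [h, if_false]
      rw [not_le] at h
      exact @measurable_apply_index _ _ (M.historyBefore t) _ _ (measurable_switch_index hT h hI)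
        (fun i ω => (π i).R (t - T) (sanitize (shiftWaits (fun _ => -T) ω)) j α) fun i =>
        ((π i).R_predictable (t - T) (sub_nonneg.2 h.le) j α).comp (measurable_switch_scenario hT)
  D t ω := if t ≤ T then 0 else
    (π (I (observedClaims T ω))).D (t - T) (sanitize (shiftWaits (fun _ => -T) ω))
  D_zero t ht ω := if_pos (ht.trans hT)
  D_mono ω s t hst := by
    simp only
    by_cases hs : s ≤ T
    · rw [if_pos hs]
      split_ifs
      · exact le_rfl
      · exact D_nonneg _ _ _
    · rw [if_neg hs, if_neg (by linarith)]
      exact Strategy.D_mono _ _ (by linarith)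
  D_leftCont ω t := by
    rcases le_or_gt t T with ht | ht
    · refine (continuousWithinAt_const (b := (0 : ℝ))).congr (fun s hs => ?_) (if_pos ht)
      exact if_pos (le_trans hs ht)
    · have h1 : ContinuousWithinAt (fun s => (π (I (observedClaims T ω))).D (s - T)
          (sanitize (shiftWaits (fun _ => -T) ω))) (Iic t) t :=
        (Strategy.D_leftCont _ _ (t - T)).comp (f := fun s => s - T)
          (continuous_sub_right T).continuousWithinAt fun s hs => sub_le_sub_right hs T
      refine h1.congr_of_eventuallyEq ?_ (if_neg ht.not_ge)
      filter_upwards [mem_nhdsWithin_of_mem_nhds (Ioi_mem_nhds ht)] with s hs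
      exact if_neg (not_le.2 hs)
  D_predictable t ht := by
    by_cases h : t ≤ T
    · simp only [h, if_true]; exact measurable_const
    · simp only [h, if_false]
      rw [not_le] at h
      exact @measurable_apply_index _ _ (M.historyBefore t) _ _ (measurable_switch_index hT h hI)
        (fun i ω => (π i).D (t - T) (sanitize (shiftWaits (fun _ => -T) ω))) fun i =>
        ((π i).D_predictable (t - T) (sub_nonneg.2 h.le)).comp (measurable_switch_scenario hT)

end Strategy

/-! ### Delayed scenarios -/

end RiskModel

/-- The claims of `ω` are those of `ω'`, delayed by `b`, and those of an event with mark `u` at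
time `t`. -/
def Delayed (ω ω' : Scenario m n) (t : ℝ) (u : Mark n) (b : ℝ) : Prop :=
  ∀ j r s, claimsENN ω j r s = (if t ≤ s ∧ u.1 j = true then
    ((r t (u.2 j) : ℝ≥0) : ℝ≥0∞) else 0) + claimsENN ω' j (fun q => r (q + b)) (s - b)

theorem delayed_arrive (k : Fin m) (t : ℝ) (u : Mark n) (b : ℝ) (ω : Scenario m n) :
    Delayed (arrive k t u b ω) ω t u b := fun j r s => claimsENN_arrive k t u b ω j r s

/-- The mark of an event without claims. -/
def noHit (n : ℕ) : Mark n := (fun _ => false, 0)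

theorem delayed_shiftWaits (t b : ℝ) (ω : Scenario m n) :
    Delayed (shiftWaits (fun _ => b) ω) ω t (noHit n) b := fun j r s => by
  simp [claimsENN_shiftWaits, noHit]

theorem retained_noHit (R : Fin n → Retention) : retained R (noHit n) = 0 := by
  simp [retained, noHit]

/-- Claims caused in the lines by an event. -/
def lineClaims (u : Mark n) (j : Fin n) : ℝ≥0 := if u.1 j = true then u.2 j else 0

theorem lineClaims_noHit : lineClaims (noHit n) = 0 := by
  funext j; simp [lineClaims, noHit]

theorem measurable_lineClaims : Measurable (lineClaims : Mark n → Fin n → ℝ≥0) := by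
  refine measurable_pi_iff.2 fun j => Measurable.ite ?_ (by fun_prop) measurable_const
  exact (by fun_prop : Measurable fun u : Mark n => u.1 j) (measurableSet_singleton true)

theorem retained_eq_lineClaims {R : Fin n → Retention} (hR : ∀ j α, R j α ≤ α) (u : Mark n) :
    retained R u = ∑ j, R j (lineClaims u j) := by
  refine Finset.sum_congr rfl fun j _ => ?_
  unfold lineClaims
  split_ifs
  · rfl
  · exact (le_antisymm (hR j 0) zero_le).symm

/-- A scenario without claims. -/
def quiet (m n : ℕ) : Scenario m n := fun _ => (0, noHit n)

theorem claimsENN_quiet (j : Fin n) (r : ℝ → Retention) (t : ℝ) :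
    claimsENN (quiet m n) j r t = 0 := by
  simp [claimsENN, quiet, noHit]

/-- In the absence of explosions, sanitizing removes exactly the hits at times `≤ 0`. -/
theorem claimsENN_sanitize_add {ω : Scenario m n} {j : Fin n}
    (h : ∀ t, claimsENN ω j (fun _ => id) t ≠ ⊤) {t : ℝ} (ht : 0 ≤ t) :
    claimsENN ω j (fun _ => id) 0 + claimsENN (sanitize ω) j (fun _ => id) t =
      claimsENN ω j (fun _ => id) t := by
  rw [claimsENN_eq_add_positiveClaims ω j ht]
  congr 1
  refine tsum_congr fun i => ?_
  have : (sanitize ω i).2.1 j = true ↔ 0 < eventTime ω i ∧ (ω i).2.1 j = true := by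
    rw [sanitize_hit_iff]
    obtain ⟨q, hq⟩ := exists_rat_gt (eventTime ω i)
    exact ⟨fun h => ⟨h.2.1, h.1⟩, fun h' => ⟨h'.2, h'.1, q, hq.le, h _⟩⟩
  simp only [this, eventTime_sanitize]
  by_cases h1 : 0 < eventTime ω i <;> by_cases h2 : eventTime ω i ≤ t <;>
    by_cases h3 : (ω i).2.1 j = true <;> simp [h1, h2, h3]; rfl

theorem claimsENN_sanitize_of_neg (ω : Scenario m n) (j : Fin n) (r : ℝ → Retention) {t : ℝ}
    (ht : t ≤ 0) : claimsENN (sanitize ω) j r t = 0 := by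
  refine ENNReal.tsum_eq_zero.2 fun i => if_neg fun hi => ?_
  have := ((sanitize_hit_iff ω i j).1 hi.2).2.1
  have := hi.1
  simp only [eventTime_sanitize] at this
  linarith

theorem Delayed.ne_top {ω ω' : Scenario m n} {t b : ℝ} {u : Mark n} (h : Delayed ω ω' t u b)
    (hω : IsRegular ω') (j : Fin n) {r : ℝ → Retention} (hr : ∀ t α, r t α ≤ α) (s : ℝ) :
    claimsENN ω j r s ≠ ⊤ := by
  rw [h]
  refine ENNReal.add_ne_top.2 ⟨?_, hω.claims_ne_top j (fun t => hr (t + b)) _⟩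
  split_ifs <;> simp

/-- Seen from `b ≥ t`, the extra event lies at a time `≤ 0` and is erased by `sanitize`. Its claims
are finite, so they can be cancelled. -/
theorem Delayed.claims_sanitize {ω ω' : Scenario m n} {t b : ℝ} {u : Mark n}
    (h : Delayed ω ω' t u b) (htb : t ≤ b) (hω : IsRegular ω') (j : Fin n) {s : ℝ} (hs : 0 ≤ s) :
    claimsENN (sanitize (shiftWaits (fun _ => -b) ω)) j (fun _ => id) s =
      claimsENN ω' j (fun _ => id) s := by
  have h0 : ∀ s, claimsENN (shiftWaits (fun _ => -b) ω) j (fun _ => id) s ≠ ⊤ := fun s => by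
    rw [claimsENN_shiftWaits]
    exact h.ne_top hω j (fun _ _ => le_rfl) _
  have h1 := claimsENN_sanitize_add h0 hs
  have h2 := h0 0
  rw [claimsENN_shiftWaits, claimsENN_shiftWaits, h, h j _ (s - -b)] at h1
  rw [claimsENN_shiftWaits, h] at h2
  rw [if_congr (show t ≤ s - -b ∧ u.1 j = true ↔ t ≤ 0 - -b ∧ u.1 j = true from by
    rw [sub_neg_eq_add, sub_neg_eq_add, zero_add]
    exact and_congr_left fun _ => ⟨fun _ => htb, fun _ => by linarith⟩) rfl rfl] at h1
  simp only [sub_neg_eq_add, zero_add, sub_self, add_sub_cancel_right] at h1 h2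
  rw [hω.claims_nonpos j _ le_rfl, add_zero] at h1 h2
  exact (ENNReal.add_right_inj h2).1 h1

/-! ### Strategies along delayed scenarios -/

namespace RiskModel

namespace Strategy

variable {M : RiskModel m n} {F : Fin n → Set Retention}

theorem R_eq_of_claims_eq (π : M.Strategy F) {ω ω' : Scenario m n} {t : ℝ} (ht : 0 ≤ t)
    (h : ∀ j s, 0 ≤ s → s < t → claimsENN ω j (fun _ => id) s = claimsENN ω' j (fun _ => id) s) :
    π.R t ω = π.R t ω' := by
  funext j α
  exact M.eq_of_measurable_historyBefore (π.R_predictable t ht j α) fun j s hs hst => by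
    rw [h j s hs hst]

theorem D_eq_of_claims_eq (π : M.Strategy F) {ω ω' : Scenario m n} {t : ℝ} (ht : 0 ≤ t)
    (h : ∀ j s, 0 ≤ s → s < t → claimsENN ω j (fun _ => id) s = claimsENN ω' j (fun _ => id) s) :
    π.D t ω = π.D t ω' :=
  M.eq_of_measurable_historyBefore (π.D_predictable t ht) fun j s hs hst => by
    rw [h j s hs hst]

theorem surplus_quiet (π : M.Strategy F) (x t : ℝ) : π.surplus x (quiet m n) t =
    x + (∫ s in (0 : ℝ)..t, M.premium (π.R s (quiet m n))) - π.D t (quiet m n) := by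
  simp [surplus, retainedClaims_eq, claimsENN_quiet]

/-- Before the first claim, a strategy does not depend on the scenario. -/
theorem surplus_eq_quiet (π : M.Strategy F) (x : ℝ) {ω : Scenario m n} {b : ℝ}
    (h : ∀ j r s, s < b → claimsENN ω j r s = 0) {t : ℝ} (ht : 0 ≤ t) (htb : t < b) :
    π.surplus x ω t = π.surplus x (quiet m n) t := by
  have hR : ∀ s, 0 ≤ s → s ≤ t → π.R s ω = π.R s (quiet m n) := fun s hs hst =>
    π.R_eq_of_claims_eq hs fun j q _ hq => by
      rw [claimsENN_quiet, h j _ q ((hq.trans_le hst).trans htb)]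
  have hD : π.D t ω = π.D t (quiet m n) :=
    π.D_eq_of_claims_eq ht fun j q _ hq => by rw [claimsENN_quiet, h j _ q (hq.trans htb)]
  have hI : ∫ s in (0 : ℝ)..t, M.premium (π.R s ω) =
      ∫ s in (0 : ℝ)..t, M.premium (π.R s (quiet m n)) := by
    refine intervalIntegral.integral_congr fun s hs => ?_
    rw [uIcc_of_le ht] at hs
    simp only [hR s hs.1 hs.2]
  rw [surplus_quiet, surplus, hI, hD]
  simp [retainedClaims_eq, h _ _ t htb]

theorem solvent_iff_quiet (π : M.Strategy F) (x : ℝ) {ω : Scenario m n} {b : ℝ}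
    (h : ∀ j r s, s < b → claimsENN ω j r s = 0) :
    π.Solvent x ω b ↔ π.Solvent x (quiet m n) b := by
  refine forall_congr' fun r => forall_congr' fun h0 => forall_congr' fun hr => ?_
  rw [π.surplus_eq_quiet x h h0 hr]

theorem sum_retained (r : Fin n → Retention) (u : Mark n) (c : Fin n → ℝ≥0∞)
    (hc : ∀ j, c j ≠ ⊤) : ∑ j, ((if u.1 j = true then ((r j (u.2 j) : ℝ≥0) : ℝ≥0∞) else 0) +
      c j).toReal = (retained r u : ℝ) + ∑ j, (c j).toReal := by
  rw [retained, NNReal.coe_sum, ← Finset.sum_add_distrib]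
  refine Finset.sum_congr rfl fun j _ => ?_
  rw [ENNReal.toReal_add (by split_ifs <;> simp) (hc j)]
  congr 1
  split_ifs <;> simp

/-- The surplus of a strategy along a delayed scenario. -/
theorem surplus_delayed (hF : ∀ j, IsReinsuranceFamily (F j)) (hβ : 0 < M.totalβ)
    {π π' : M.Strategy F} {ω ω' : Scenario m n} {t b : ℝ} {u : Mark n}
    (h : Delayed ω ω' t u b) (htb : t ≤ b) (hω : IsRegular ω')
    (hR : ∀ s, 0 < s → π.R (b + s) ω = π'.R s ω')
    (hD : ∀ s, 0 ≤ s → π'.D s ω' = π.D (b + s) ω - π.D b ω) (x : ℝ) {s : ℝ} (hs : 0 ≤ s) :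
    π.surplus x ω (b + s) = π'.surplus (x + (∫ q in (0 : ℝ)..b, M.premium (π.R q ω))
      - retained (π.R t ω) u - π.D b ω) ω' s := by
  have hI : ∫ q in (0 : ℝ)..b + s, M.premium (π.R q ω) =
      (∫ q in (0 : ℝ)..b, M.premium (π.R q ω)) + ∫ q in (0 : ℝ)..s, M.premium (π'.R q ω') := by
    rw [← intervalIntegral.integral_add_adjacent_intervals
      (π.intervalIntegrable_premium hF hβ ω 0 b) (π.intervalIntegrable_premium hF hβ ω b (b + s))]
    congr 1
    have := intervalIntegral.integral_comp_add_left (a := 0) (b := s)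
      (fun q => M.premium (π.R q ω)) b
    rw [add_zero] at this
    rw [← this]
    refine intervalIntegral.integral_congr_ae (ae_of_all _ fun q hq => ?_)
    rw [uIoc_of_le hs] at hq
    simp only [hR q hq.1]
  have hC : ∑ j, retainedClaims ω j (fun q => π.R q ω j) (b + s) = (retained (π.R t ω) u : ℝ) +
      ∑ j, retainedClaims ω' j (fun q => π'.R q ω' j) s := by
    simp only [retainedClaims_eq]
    rw [← sum_retained _ _ _ fun j => hω.claims_ne_top j (fun q => π'.R_le hF q ω' j) s]
    refine Finset.sum_congr rfl fun j _ => ?_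
    rw [h, add_sub_cancel_left]
    congr 2
    · exact if_congr (and_iff_right (by linarith)) rfl rfl
    · refine claimsENN_congr fun i _ => ?_
      rw [add_comm, hR _ (hω.1 i)]
  have h3 := hD s hs
  unfold surplus
  rw [hI, hC]
  linarith

/-! ### The value of a switching strategy along a delayed scenario -/

section Switch

variable (hF : ∀ j, IsReinsuranceFamily (F j)) {R : Fin n → Retention}
  (hR : ∀ j, R j ∈ F j) {T : ℝ} (hT : 0 ≤ T) {I : (Fin n → ℝ≥0) → ℕ} (hI : Measurable I)
  (π : ℕ → M.Strategy F)

/-- A single retained claim of at most `x` cannot cause ruin before `T` while premiums are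
nonnegative, whenever it occurs. The claims observed at `T` are those of `u`, so the strategy with
index `I (lineClaims u)` takes over along `ω'`. -/
theorem le_discountedDividends_switch (hβ : 0 < M.totalβ) (hp : 0 ≤ M.premium R) {ω ω' : Scenario m n} {t : ℝ}
    {u : Mark n} (h : Delayed ω ω' t u T) (htT : t ≤ T) (hω : IsRegular ω') {x : ℝ}
    (hx : retained R u ≤ x) :
    ENNReal.ofReal (Real.exp (-M.δ * T)) * (π (I (lineClaims u))).discountedDividends
      (x + M.premium R * T - retained R u) ω' ≤
      (switch hF R hR hT hI π).discountedDividends x ω := by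
  set σ := switch hF R hR hT hI π with hσ
  have hobs : observedClaims T ω = lineClaims u := by
    funext j
    rw [observedClaims, h, sub_self, hω.claims_nonpos j _ le_rfl, lineClaims]
    by_cases hj : u.1 j = true <;> simp [htT, hj]
  have hclaims : ∀ j s, 0 ≤ s → claimsENN (sanitize (shiftWaits (fun _ => -T) ω)) j (fun _ => id) s
      = claimsENN ω' j (fun _ => id) s := fun j s hs => h.claims_sanitize htT hω j hs
  have hR1 : ∀ s, s ≤ T → σ.R s ω = R := fun s hs => if_pos hs
  have hR2 : ∀ s, 0 < s → σ.R (T + s) ω = (π (I (lineClaims u))).R s ω' := fun s hs => by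
    have : σ.R (T + s) ω = (π (I (observedClaims T ω))).R (T + s - T)
        (sanitize (shiftWaits (fun _ => -T) ω)) := if_neg (by linarith)
    rw [this, hobs, add_sub_cancel_left]
    exact R_eq_of_claims_eq _ hs.le fun j q hq _ => hclaims j q hq
  have hD1 : ∀ s, s ≤ T → σ.D s ω = 0 := fun s hs => if_pos hs
  have hD2 : ∀ s, 0 ≤ s → (π (I (lineClaims u))).D s ω' = σ.D (T + s) ω - σ.D T ω := fun s hs => by
    rw [hD1 T le_rfl, sub_zero]
    rcases hs.eq_or_lt with rfl | hs'
    · rw [add_zero, hD1 T le_rfl, D_zero _ 0 le_rfl]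
    · have : σ.D (T + s) ω = (π (I (observedClaims T ω))).D (T + s - T)
          (sanitize (shiftWaits (fun _ => -T) ω)) := if_neg (by linarith)
      rw [this, hobs, add_sub_cancel_left]
      exact (D_eq_of_claims_eq _ hs fun j q hq _ => hclaims j q hq).symm
  have hprem : ∀ s, 0 ≤ s → s ≤ T → ∫ q in (0 : ℝ)..s, M.premium (σ.R q ω) = M.premium R * s :=
    fun s hs hsT => by
      have : ∫ q in (0 : ℝ)..s, M.premium (σ.R q ω) = ∫ _ in (0 : ℝ)..s, M.premium R := by
        refine intervalIntegral.integral_congr fun q hq => ?_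
        rw [uIcc_of_le hs] at hq
        simp only [hR1 q (hq.2.trans hsT)]
      rw [this, intervalIntegral.integral_const, sub_zero, smul_eq_mul, mul_comm]
  have hsolv : σ.Solvent x ω T := fun r h0 hr => by
    have hc : ∑ j, retainedClaims ω j (fun s => σ.R s ω j) r ≤ retained R u := by
      have := sum_retained R u (fun _ => 0) (by simp)
      simp only [add_zero, ENNReal.toReal_zero, Finset.sum_const_zero] at this
      rw [← this]
      refine Finset.sum_le_sum fun j _ => ?_
      rw [retainedClaims_eq, h, hω.claims_nonpos j _ (by linarith), add_zero, hR1 t htT]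
      refine ENNReal.toReal_mono (by split_ifs <;> simp) ?_
      by_cases hj : u.1 j = true <;> by_cases ht : t ≤ r <;> simp [hj, ht]
    have : 0 ≤ M.premium R * r := mul_nonneg hp h0
    rw [surplus, hprem r h0 hr.le, hD1 r hr.le]
    linarith
  have key := discountedDividends_split (π := σ) hT
    (fun s hs => surplus_delayed hF hβ h htT hω hR2 hD2 x hs) hD2
  rw [key, indicator_of_mem (by exact hsolv), hprem T hT le_rfl, hD1 T le_rfl, sub_zero, hR1 t htT]
  exact le_add_self

end Switch

/-- Bound for the dividends along a delayed scenario. -/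
theorem discountedDividends_restart (hF : ∀ j, IsReinsuranceFamily (F j)) (hβ : 0 < M.totalβ)
    (π : M.Strategy F) {b : ℝ} (hb : 0 ≤ b) {Ψ : Scenario m n → Scenario m n}
    (hΨm : Measurable Ψ)
    (hΨ : ∀ j r t, 0 ≤ t → 0 ≤ r → r < b + t → Measurable[M.historyBefore t] fun ω =>
      (claimsENN (Ψ ω) j (fun _ => id) r).toReal) {ω' : Scenario m n} {u : Mark n}
    (h : Delayed (Ψ ω') ω' b u b) (hω : IsRegular ω') (x : ℝ) :
    π.discountedDividends x (Ψ ω') = π.earlyDividends x (quiet m n) b +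
      {_s : Unit | π.Solvent x (quiet m n) b}.indicator (fun _ =>
        ENNReal.ofReal (Real.exp (-M.δ * b)) * (π.restart hb Ψ hΨm hΨ).discountedDividends
          (π.surplus x (quiet m n) b - retained (π.R b (quiet m n)) u) ω') () := by
  have h0 : ∀ j r s, s < b → claimsENN (Ψ ω') j r s = 0 := fun j r s hs => by
    rw [h, if_neg (fun h' => absurd h'.1 hs.not_ge), zero_add]
    exact hω.claims_nonpos j _ (by linarith)
  have hcl : ∀ t, t ≤ b → ∀ j s, 0 ≤ s → s < t → claimsENN (Ψ ω') j (fun _ => id) s =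
      claimsENN (quiet m n) j (fun _ => id) s := fun t ht j s _ hst => by
    rw [h0 j _ s (hst.trans_le ht), claimsENN_quiet]
  have hR0 : ∀ t, 0 ≤ t → t ≤ b → π.R t (Ψ ω') = π.R t (quiet m n) := fun t ht htb =>
    π.R_eq_of_claims_eq ht (hcl t htb)
  have hD0 : ∀ t, 0 ≤ t → t ≤ b → π.D t (Ψ ω') = π.D t (quiet m n) := fun t ht htb =>
    π.D_eq_of_claims_eq ht (hcl t htb)
  have hD : ∀ s, 0 ≤ s → (π.restart hb Ψ hΨm hΨ).D s ω' = π.D (b + s) (Ψ ω') - π.D b (Ψ ω') :=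
    fun s hs => by
      rcases hs.eq_or_lt with rfl | hs'
      · rw [add_zero, sub_self, D_zero _ 0 le_rfl]
      · exact if_neg hs'.not_ge
  have key := discountedDividends_split hb
    (fun s hs => surplus_delayed (π := π) hF hβ h le_rfl hω (fun _ _ => rfl) hD x hs) hD
  have hI : ∫ s in (0 : ℝ)..b, M.premium (π.R s (Ψ ω')) =
      ∫ s in (0 : ℝ)..b, M.premium (π.R s (quiet m n)) := by
    refine intervalIntegral.integral_congr fun s hs => ?_
    rw [uIcc_of_le hb] at hs
    simp only [hR0 s hs.1 hs.2]
  have hS : {_s : Unit | π.Solvent x (Ψ ω') b} = {_s : Unit | π.Solvent x (quiet m n) b} := by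
    ext; exact π.solvent_iff_quiet x h0
  rw [key, earlyDividends_congr (fun r hr hrb => π.surplus_eq_quiet x h0 hr hrb) hD0, hS, hI,
    hR0 b hb le_rfl, hD0 b hb le_rfl, surplus_quiet]
  congr! 5
  ring

/-! ### Lump sums -/

theorem dividendMeasure_addLump (π : M.Strategy F) {h : ℝ} (hh : 0 ≤ h) (ω : Scenario m n) :
    (π.addLump hh).dividendMeasure ω = π.dividendMeasure ω + ENNReal.ofReal h • Measure.dirac 0 := by
  refine Measure.ext_of_Ico' _ _ (fun a b _ => ?_) fun a b hab => ?_
  · rw [dividendMeasure_Ico]; exact ENNReal.ofReal_ne_top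
  · rw [Measure.add_apply, Measure.smul_apply, dividendMeasure_Ico, dividendMeasure_Ico,
      Measure.dirac_apply' _ measurableSet_Ico, smul_eq_mul]
    have h1 : ∀ t, (π.addLump hh).D t ω = if t ≤ 0 then 0 else π.D t ω + h := fun t => rfl
    have h2 : 0 ≤ π.D b ω - π.D a ω := sub_nonneg.2 (π.D_mono ω hab.le)
    rcases le_or_gt b 0 with hb | hb
    · simp [h1, hb, hab.le.trans hb, π.D_zero _ hb, π.D_zero _ (hab.le.trans hb)]
    · rcases le_or_gt a 0 with ha | ha
      · have : (0 : ℝ) ∈ Ico a b := ⟨ha, hb⟩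
        simp only [h1, hb.not_ge, ha, if_true, if_false, π.D_zero _ ha, sub_zero,
          indicator_of_mem this, Pi.one_apply, mul_one]
        exact ENNReal.ofReal_add (π.D_nonneg b ω) hh
      · have : (0 : ℝ) ∉ Ico a b := fun h => absurd h.1 ha.not_ge
        simp only [h1, hb.not_ge, ha.not_ge, if_false, indicator_of_notMem this, mul_zero, add_zero]
        congr 1
        ring

/-- A lump sum at time `0` counts only if the time before ruin is nonempty; this is the role of
solvency up to some `t > 0`. -/
theorem add_le_discountedDividends_addLump (π : M.Strategy F) {h : ℝ} (hh : 0 ≤ h)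
    {x : ℝ} {ω : Scenario m n} {t : ℝ} (ht : 0 < t) (hs : π.Solvent x ω t) :
    π.discountedDividends x ω + ENNReal.ofReal h ≤
      (π.addLump hh).discountedDividends (x + h) ω := by
  have hS : ∀ t, π.Solvent x ω t → (π.addLump hh).Solvent (x + h) ω t := fun t h1 r hr hrt => by
    have h2 := h1 r hr hrt
    have h3 : (π.addLump hh).D r ω = if r ≤ 0 then 0 else π.D r ω + h := rfl
    have h4 := π.D_nonneg r ω
    unfold surplus at h2 ⊢
    rw [h3]
    simp only [addLump]
    split_ifs <;> linarith
  classical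
  rw [discountedDividends_eq, discountedDividends_eq, dividendMeasure_addLump]
  set S := {s : ℝ | 0 ≤ s ∧ ∃ t, s < t ∧ π.Solvent x ω t}
  have hSm : MeasurableSet S := π.measurableSet_solvent x ω
  refine le_trans ?_ (lintegral_mono_set (μ := π.dividendMeasure ω +
    ENNReal.ofReal h • Measure.dirac 0) (s := S) fun s hs => ⟨hs.1, ?_⟩)
  · rw [Measure.restrict_add, lintegral_add_measure, Measure.restrict_smul, lintegral_smul_measure,
      setLIntegral_dirac' (by fun_prop) hSm, if_pos ⟨le_rfl, t, ht, hs⟩]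
    simp
  · obtain ⟨t, h1, h2⟩ := hs.2
    exact ⟨t, h1, hS t h2⟩

end Strategy

variable (M : RiskModel m n) {F : Fin n → Set Retention}

/-- Almost surely, there is no claim in some initial time interval. -/
theorem ae_exists_quiet : ∀ᵐ ω ∂M.prob, ∃ b > 0, ∀ j r s, s < b → claimsENN ω j r s = 0 := by
  filter_upwards [M.ae_wait_pos] with ω hω
  obtain ⟨b, hb0, hb⟩ : ∃ b > 0, ∀ k, b ≤ (ω (k, 0)).1 := by
    rcases isEmpty_or_nonempty (Fin m) with he | hne
    · exact ⟨1, one_pos, fun k => (he.false k).elim⟩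
    · obtain ⟨k₀, hk₀⟩ := Finite.exists_min fun k : Fin m => (ω (k, 0)).1
      exact ⟨_, hω (k₀, 0), hk₀⟩
  refine ⟨b, hb0, fun j r s hs => ENNReal.tsum_eq_zero.2 fun i => if_neg fun hi => ?_⟩
  have h1 : (ω (i.1, 0)).1 ≤ eventTime ω i :=
    Finset.single_le_sum (f := fun e => (ω (i.1, e)).1) (fun e _ => (hω (i.1, e)).le) (by simp)
  have h2 := hi.1
  linarith [hb i.1]

/-- Pay `h` at once and then follow `π`. If `π` is solvent for no positive time on `quiet`, its
value is `0` and the lump sum would be lost; the constant strategy, which stays solvent until the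
first claim, then replaces it. -/
theorem add_le_optimalValueENN {R : Fin n → Retention} (hF : ∀ j, IsReinsuranceFamily (F j))
    (hR : ∀ j, R j ∈ F j) (hp : 0 ≤ M.premium R) {x h : ℝ} (hx : 0 ≤ x)
    (hh : 0 ≤ h) : M.optimalValueENN F x + ENNReal.ofReal h ≤ M.optimalValueENN F (x + h) := by
  have key : ∀ (π : M.Strategy F) (t : ℝ), 0 < t → π.Solvent x (quiet m n) t →
      π.value x + ENNReal.ofReal h ≤ M.optimalValueENN F (x + h) := by
    intro π t ht hs
    refine le_trans ?_ (le_iSup _ (π.addLump hh))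
    rw [Strategy.value, Strategy.value]
    have : ENNReal.ofReal h = ∫⁻ _, ENNReal.ofReal h ∂M.prob := by simp
    rw [this, ← lintegral_add_right _ measurable_const]
    refine lintegral_mono_ae ?_
    filter_upwards [M.ae_exists_quiet] with ω ⟨b, hb, hω⟩
    exact π.add_le_discountedDividends_addLump hh (lt_min ht hb)
      ((π.solvent_iff_quiet x fun j r s hs => hω j r s (hs.trans_le (min_le_right _ _))).2
        (hs.mono (min_le_left _ _)))
  have hconst : (Strategy.const M hF R hR).Solvent x (quiet m n) 1 := fun r hr _ => by
    rw [Strategy.surplus_quiet]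
    simp only [Strategy.const, intervalIntegral.integral_const, sub_zero, smul_eq_mul]
    have := mul_nonneg hr hp
    linarith
  have : Nonempty (M.Strategy F) := ⟨Strategy.const M hF R hR⟩
  rw [optimalValueENN, ENNReal.iSup_add]
  refine iSup_le fun π => ?_
  by_cases hq : ∃ t, 0 < t ∧ π.Solvent x (quiet m n) t
  · obtain ⟨t, ht, hs⟩ := hq
    exact key π t ht hs
  · have h0 : π.value x = 0 := by
      rw [Strategy.value, ← lintegral_zero (μ := M.prob)]
      refine lintegral_congr_ae ?_
      filter_upwards [M.ae_exists_quiet] with ω ⟨b, hb, hω⟩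
      rw [Strategy.discountedDividends_eq]
      have : {s : ℝ | 0 ≤ s ∧ ∃ t, s < t ∧ π.Solvent x ω t} = ∅ := by
        ext s
        simp only [mem_ofPred_eq, mem_empty_iff_false, iff_false]
        rintro ⟨hs0, t, hst, ht⟩
        refine hq ⟨min t b, lt_min (hs0.trans_lt hst) hb, ?_⟩
        exact (π.solvent_iff_quiet x fun j r s hs => hω j r s (hs.trans_le (min_le_right _ _))).1
          (ht.mono (min_le_left _ _))
      rw [this]
      simp
    rw [h0]
    refine le_trans ?_ (key _ 1 one_pos hconst)
    gcongr
    exact zero_le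

end RiskModel

/-! ### Lower bounds for the value function -/

/-- What is left of a scenario at time `b` after its first event of class `k`. -/
def afterEvent (k : Fin m) (b : ℝ) (ω : Scenario m n) : Scenario m n :=
  shiftWaits (fun k' => -(if k' = k then b - (ω (k, 0)).1 else b)) fun i => ω (insertIndex k i)

theorem afterEvent_arrive (k : Fin m) (t : ℝ) (u : Mark n) (b : ℝ) (ω : Scenario m n) :
    afterEvent k b (arrive k t u b ω) = ω := by
  have h1 : (fun i => arrive k t u b ω (insertIndex k i)) =
      shiftWaits (fun k' => if k' = k then b - t else b) ω := by
    funext i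
    rw [arrive, insertEvent_insertIndex]
  have h2 : (arrive k t u b ω (k, 0)).1 = t := by simp [arrive]
  rw [afterEvent, h1, h2, shiftWaits_add]
  refine Eq.trans ?_ (shiftWaits_zero ω)
  congr 1
  funext k'
  simp

theorem arrive_afterEvent (k : Fin m) (b : ℝ) (ω : Scenario m n) :
    arrive k (ω (k, 0)).1 (ω (k, 0)).2 b (afterEvent k b ω) = ω := by
  rw [arrive, afterEvent, shiftWaits_add]
  have : ((fun k' => -(if k' = k then b - (ω (k, 0)).1 else b)) +
      fun k' => if k' = k then b - (ω (k, 0)).1 else b) = 0 := by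
    funext k'
    simp
  rw [this, shiftWaits_zero]
  funext i
  by_cases hi : i = (k, 0)
  · rw [hi, insertEvent_self]
  · obtain ⟨i', rfl⟩ := mem_range_insertIndex.2 hi
    rw [insertEvent_insertIndex]

theorem measurable_afterEvent (k : Fin m) (b : ℝ) :
    Measurable (afterEvent k b : Scenario m n → Scenario m n) := by
  refine measurable_shiftWaits (measurable_pi_iff.2 fun k' => ?_)
    (measurable_pi_iff.2 fun i => by fun_prop)
  by_cases h : k' = k <;> simp only [h, if_true, if_false] <;> fun_prop

namespace RiskModel

variable (M : RiskModel m n) {F : Fin n → Set Retention}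

theorem lintegral_indicator_isRegular (g : Scenario m n → ℝ≥0∞) :
    ∫⁻ ω, {ω : Scenario m n | IsRegular ω}.indicator g ω ∂M.prob = ∫⁻ ω, g ω ∂M.prob := by
  refine lintegral_congr_ae ?_
  filter_upwards [M.ae_isRegular] with ω hω
  exact indicator_of_mem (show ω ∈ {ω : Scenario m n | IsRegular ω} from hω) g

/-- No event before `T` has probability `exp (-β T)`; a single event of class `k` has density `β_k
exp (-β T)`, independent of its time, which integrates to the factor `T`. Every continuation starts
at `T`, which gives the common discount. The levels `z` may underestimate the true surplus by
monotonicity. -/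
theorem le_optimalValueENN_switch (hF : ∀ j, IsReinsuranceFamily (F j)) (hβ : 0 < M.totalβ)
    {R : Fin n → Retention} (hR : ∀ j, R j ∈ F j) (hp : 0 ≤ M.premium R) {T : ℝ} (hT : 0 ≤ T)
    {I : (Fin n → ℝ≥0) → ℕ} (hI : Measurable I) (π : ℕ → M.Strategy F) {z : ℕ → ℝ} {x : ℝ}
    (hx : 0 ≤ x) (hz0 : z (I 0) ≤ x + M.premium R * T) {A : Set (Mark n)} (hA : MeasurableSet A)
    (hA1 : ∀ u ∈ A, retained R u ≤ x)
    (hA2 : ∀ u ∈ A, z (I (lineClaims u)) ≤ x + M.premium R * T - retained R u) :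
    ENNReal.ofReal (Real.exp (-((M.δ + M.totalβ) * T))) * ((π (I 0)).value (z (I 0)) +
      ENNReal.ofReal T * ∫⁻ u in A, (π (I (lineClaims u))).value (z (I (lineClaims u)))
        ∂M.intensity) ≤ M.optimalValueENN F x := by
  set σ := Strategy.switch hF R hR hT hI π with hσ
  -- Measurability of `discountedDividends` in the scenario is not available; its lower integral is
  -- attained by a measurable minorant.
  choose g hg hgle hgeq using fun i => exists_measurable_le_lintegral_eq M.prob
    fun ω => (π i).discountedDividends (z i) ω
  set Reg := {ω : Scenario m n | IsRegular ω} with hReg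
  have hRegm : MeasurableSet Reg := measurableSet_isRegular
  set E₀ := {ω : Scenario m n | ∀ k, T ≤ (ω (k, 0)).1} with hE₀
  let E : Fin m → Set (Scenario m n) := fun k => {ω | (ω (k, 0)).1 ∈ Ico 0 T ∧ ∀ k', if k' = k
        then T - (ω (k, 0)).1 ≤ (ω (k, 1)).1 else T ≤ (ω (k', 0)).1}
  let c : ℝ≥0∞ := ENNReal.ofReal (Real.exp (-M.δ * T))
  let f₀ : Scenario m n → ℝ≥0∞ := fun ω =>
    c * Reg.indicator (g (I 0)) (shiftWaits (fun _ => -T) ω)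
  let f : Fin m → Scenario m n → ℝ≥0∞ := fun k ω =>
    A.indicator (fun u => c * Reg.indicator (g (I (lineClaims u))) (afterEvent k T ω)) (ω (k, 0)).2
  have hf₀m : Measurable f₀ := ((hg _).indicator hRegm |>.comp
    (measurable_shiftWaits measurable_const measurable_id)).const_mul _
  have hgind : Measurable fun q : Mark n × Scenario m n =>
      A.indicator (fun u => c * Reg.indicator (g (I (lineClaims u))) q.2) q.1 := by
    have h1 : Measurable fun q : Mark n × Scenario m n =>
        Reg.indicator (g (I (lineClaims q.1))) q.2 :=
      measurable_apply_index ((hI.comp measurable_lineClaims).comp measurable_fst)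
        (f := fun i (q : Mark n × Scenario m n) => Reg.indicator (g i) q.2)
        fun i => ((hg i).indicator hRegm).comp measurable_snd
    exact (h1.const_mul c).indicator (measurable_fst hA)
  have hfm : ∀ k, Measurable (f k) := fun k =>
    hgind.comp ((by fun_prop : Measurable fun ω : Scenario m n => (ω (k, 0)).2).prodMk
      (measurable_afterEvent k T))
  -- The sets `E₀` and `E k` are pairwise disjoint, so at most one term is nonzero.
  have hle : ∀ ω, E₀.indicator f₀ ω + ∑ k, (E k).indicator (f k) ω ≤
      σ.discountedDividends x ω := by
    intro ω
    by_cases h0 : ω ∈ E₀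
    · have hEk : ∀ k, ω ∉ E k := fun k hk => absurd (h0 k) (not_le.2 hk.1.2)
      rw [indicator_of_mem h0, Finset.sum_eq_zero fun k _ => indicator_of_notMem (hEk k) _, add_zero]
      by_cases hr : shiftWaits (fun _ => -T) ω ∈ Reg
      · simp only [f₀, indicator_of_mem hr]
        have hd := delayed_shiftWaits (n := n) T T (shiftWaits (fun _ => -T) ω)
        have h1 : shiftWaits (fun _ => T) (shiftWaits (fun _ => -T) ω) = ω := by
          rw [shiftWaits_add]
          refine Eq.trans ?_ (shiftWaits_zero ω)
          congr 1
          funext k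
          simp
        rw [h1] at hd
        have h2 := Strategy.le_discountedDividends_switch hF hR hT hI π hβ hp hd le_rfl hr
          (x := x) (by simpa [retained_noHit] using hx)
        rw [lineClaims_noHit, retained_noHit] at h2
        refine le_trans ?_ h2
        gcongr
        refine (hgle _ _).trans (Strategy.discountedDividends_mono _ _ ?_)
        simpa using hz0
      · simp [f₀, indicator_of_notMem hr]
    · rw [indicator_of_notMem h0, zero_add]
      by_cases hk : ∃ k, ω ∈ E k
      · obtain ⟨k, hk⟩ := hk
        rw [Finset.sum_eq_single k (fun k' _ hk' => indicator_of_notMem (fun h' => ?_) _)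
          (by simp), indicator_of_mem hk]
        · by_cases hu : (ω (k, 0)).2 ∈ A
          · by_cases hr : afterEvent k T ω ∈ Reg
            · simp only [f, indicator_of_mem hr, indicator_of_mem hu]
              have hd := delayed_arrive k (ω (k, 0)).1 (ω (k, 0)).2 T (afterEvent k T ω)
              rw [arrive_afterEvent] at hd
              refine le_trans ?_ (Strategy.le_discountedDividends_switch hF hR hT hI π hβ hp hd
                hk.1.2.le hr (hA1 _ hu))
              gcongr
              exact (hgle _ _).trans (Strategy.discountedDividends_mono _ _ (hA2 _ hu))
            · simp [f, indicator_of_notMem hr]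
          · simp [f, indicator_of_notMem hu]
        · have h1 := hk.2 k'
          rw [if_neg hk'] at h1
          exact absurd h'.1.2 (not_lt.2 h1)
      · rw [Finset.sum_eq_zero fun k _ => indicator_of_notMem (fun h => hk ⟨k, h⟩) _]
        exact zero_le
  have hEm : MeasurableSet E₀ := by
    have : E₀ = ⋂ k, {ω : Scenario m n | T ≤ (ω (k, 0)).1} := by ext; simp [hE₀]
    rw [this]
    exact MeasurableSet.iInter fun k => measurableSet_le measurable_const (by fun_prop)
  have hi0 : ∫⁻ ω, E₀.indicator f₀ ω ∂M.prob = ENNReal.ofReal (Real.exp (-(M.totalβ * T))) *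
      (c * (π (I 0)).value (z (I 0))) := by
    have h1 := M.lintegral_prob_shiftWaits (a := fun _ => T) (fun _ => hT) hf₀m
    rw [← Finset.sum_mul] at h1
    rw [hE₀, h1]
    have h2 : ∀ ω, f₀ (shiftWaits (fun _ => T) ω) = c * Reg.indicator (g (I 0)) ω := fun ω => by
      simp only [f₀, shiftWaits_add]
      have : ((fun _ => T) + fun _ => -T : Fin m → ℝ) = 0 := by funext k; simp
      rw [this, shiftWaits_zero]
    simp_rw [h2]
    rw [lintegral_const_mul _ ((hg _).indicator hRegm), lintegral_indicator_isRegular, ← hgeq]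
    rfl
  have hik : ∀ k, ∫⁻ ω, (E k).indicator (f k) ω ∂M.prob =
      ENNReal.ofReal T * (ENNReal.ofReal (M.β k * Real.exp (-(M.totalβ * T))) *
        (c * ∫⁻ u in A, (π (I (lineClaims u))).value (z (I (lineClaims u))) ∂M.markLaw k)) := by
    intro k
    have h1 := M.lintegral_prob_arrive k (B := Ico 0 T) measurableSet_Ico (b := fun _ => T)
      measurable_const (fun t ht => ht.1) (fun t ht => ht.2.le) (hfm k)
    have h2 : ∀ t u ω, f k (arrive k t u T ω) =
        A.indicator (fun u => c * Reg.indicator (g (I (lineClaims u))) ω) u := fun t u ω => by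
      simp only [f, afterEvent_arrive, arrive_self_snd]
    have h3 : ∀ u, ∫⁻ ω, A.indicator (fun u => c * Reg.indicator (g (I (lineClaims u))) ω) u
        ∂M.prob = A.indicator (fun u => c * (π (I (lineClaims u))).value
          (z (I (lineClaims u)))) u := fun u => by
      by_cases hu : u ∈ A
      · simp only [indicator_of_mem hu]
        rw [lintegral_const_mul _ ((hg _).indicator hRegm), lintegral_indicator_isRegular, ← hgeq]
        rfl
      · simp [hu]
    simp only [h2, h3] at h1
    rw [setLIntegral_const, Real.volume_Ico, sub_zero, mul_comm, lintegral_indicator hA,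
      lintegral_const_mul' _ _ ENNReal.ofReal_ne_top] at h1
    exact h1
  have hmono : ∫⁻ ω, (E₀.indicator f₀ ω + ∑ k, (E k).indicator (f k) ω) ∂M.prob ≤ σ.value x :=
    lintegral_mono hle
  have hsum : ∑ k, ∫⁻ ω, (E k).indicator (f k) ω ∂M.prob ≤
      ∫⁻ ω, ∑ k, (E k).indicator (f k) ω ∂M.prob := by
    have h : ∀ s : Finset (Fin m), ∑ k ∈ s, ∫⁻ ω, (E k).indicator (f k) ω ∂M.prob ≤
        ∫⁻ ω, ∑ k ∈ s, (E k).indicator (f k) ω ∂M.prob := fun s => by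
      induction s using Finset.induction_on with
      | empty => simp
      | insert k s hk ih =>
        simp only [Finset.sum_insert hk]
        exact (add_le_add le_rfl ih).trans (le_lintegral_add _ _)
    exact h _
  refine le_trans ?_ (le_iSup _ σ)
  refine le_trans ?_ hmono
  rw [lintegral_add_left (hf₀m.indicator hEm), hi0]
  refine le_trans (le_of_eq ?_) (add_le_add le_rfl hsum)
  simp_rw [hik]
  have hexp : ENNReal.ofReal (Real.exp (-((M.δ + M.totalβ) * T))) =
      ENNReal.ofReal (Real.exp (-(M.totalβ * T))) * c := by
    rw [← ENNReal.ofReal_mul (Real.exp_pos _).le, ← Real.exp_add]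
    ring_nf
  rw [hexp, mul_add, mul_assoc]
  congr 1
  rw [← lintegral_indicator hA, lintegral_intensity, Finset.mul_sum, Finset.mul_sum]
  refine Finset.sum_congr rfl fun k _ => ?_
  rw [lintegral_indicator hA, ENNReal.ofReal_mul (M.β_pos k).le]
  ring

theorem exp_mul_optimalValueENN_le (hF : ∀ j, IsReinsuranceFamily (F j)) (hβ : 0 < M.totalβ)
    {R : Fin n → Retention} (hR : ∀ j, R j ∈ F j) (hp : 0 ≤ M.premium R) {T : ℝ} (hT : 0 ≤ T)
    {x : ℝ} (hx : 0 ≤ x) : ENNReal.ofReal (Real.exp (-((M.δ + M.totalβ) * T))) *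
      M.optimalValueENN F (x + M.premium R * T) ≤ M.optimalValueENN F x := by
  conv_lhs => rw [optimalValueENN]
  rw [ENNReal.mul_iSup]
  refine iSup_le fun π => ?_
  have := M.le_optimalValueENN_switch hF hβ hR hp hT (I := fun _ => 0) measurable_const
    (fun _ => π) (z := fun _ => x + M.premium R * T) hx le_rfl MeasurableSet.empty
    (fun u hu => hu.elim) (fun u hu => hu.elim)
  simpa using this

/-- A switching strategy can choose among countably many continuations only. One factor `θ < 1` pays
for almost optimal strategies, a second one for rounding the level after the claim down to a grid;
at the end `θ → 1`. -/
theorem le_optimalValueENN_of_premium_pos (hF : ∀ j, IsReinsuranceFamily (F j))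
    (hβ : 0 < M.totalβ) {R : Fin n → Retention} (hR : ∀ j, R j ∈ F j) (hp : 0 < M.premium R)
    {T : ℝ} (hT : 0 ≤ T) {x : ℝ} (hx : 0 ≤ x) :
    ENNReal.ofReal (Real.exp (-((M.δ + M.totalβ) * T))) *
      (M.optimalValueENN F (x + M.premium R * T) + ENNReal.ofReal T *
        ∫⁻ u, M.optimalValueENN F (x - retained R u) ∂M.intensity) ≤ M.optimalValueENN F x := by
  have hRm : ∀ j, Measurable (R j) := fun j => (hF j).measurable _ (hR j)
  have hRle : ∀ j α, R j α ≤ α := fun j => (hF j).le_self _ (hR j)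
  have hVfin := M.optimalValueENN_ne_top hF hβ
  have hVmono : Monotone (M.optimalValueENN F) := M.optimalValueENN_mono
  set p := M.premium R with hpdef
  set lam := M.δ + M.totalβ with hlam
  have hlam0 : 0 < lam := by have := M.δ_pos; positivity
  set A : Set (Mark n) := {u | (retained R u : ℝ) ≤ x} with hA
  have hret : Measurable fun u : Mark n => (retained R u : ℝ) :=
    (measurable_retained_const hRm).coe_nnreal_real
  have hAm : MeasurableSet A := measurableSet_le hret measurable_const
  have hint : ∫⁻ u, M.optimalValueENN F (x - retained R u) ∂M.intensity =
      ∫⁻ u in A, M.optimalValueENN F (x - retained R u) ∂M.intensity := by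
    rw [← lintegral_indicator hAm]
    refine lintegral_congr fun u => ?_
    by_cases hu : u ∈ A
    · rw [indicator_of_mem hu]
    · rw [indicator_of_notMem hu, M.optimalValueENN_of_neg hF hβ]
      have : x < retained R u := not_le.1 hu
      linarith
  rw [hint]
  -- an approximation up to a factor
  have key : ∀ θ : ℝ, 0 < θ → θ < 1 → ENNReal.ofReal (θ ^ 2) *
      (ENNReal.ofReal (Real.exp (-(lam * T))) * (M.optimalValueENN F (x + p * T) +
        ENNReal.ofReal T * ∫⁻ u in A, M.optimalValueENN F (x - retained R u) ∂M.intensity)) ≤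
      M.optimalValueENN F x := by
    intro θ hθ0 hθ1
    -- `1 / (N * p)` is the time in which the premium earns one mesh width `1 / N`, so the growth
    -- bound compares neighbouring grid points up to the factor `θ`.
    obtain ⟨N, hN0, hN⟩ : ∃ N : ℕ, 0 < N ∧ θ ≤ Real.exp (-(lam * (1 / (N * p)))) := by
      have h1 : Tendsto (fun N : ℕ => Real.exp (-(lam * (1 / (N * p))))) atTop (𝓝 1) := by
        have h2 : Tendsto (fun N : ℕ => -(lam * (1 / (N * p)))) atTop (𝓝 (-(lam * 0))) := by
          refine (Tendsto.const_mul _ ?_).neg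
          simp_rw [one_div]
          exact (tendsto_natCast_atTop_atTop.atTop_mul_const hp).inv_tendsto_atTop
        have h3 := (Real.continuous_exp.tendsto _).comp h2
        rw [mul_zero, neg_zero, Real.exp_zero] at h3
        exact h3
      obtain ⟨N, h3, h4⟩ := ((h1.eventually_const_lt hθ1).and (eventually_gt_atTop 0)).exists
      exact ⟨N, h4, h3.le⟩
    have hN0' : (0 : ℝ) < N := by exact_mod_cast hN0
    -- Index `0` is reserved for the level without claims; an index `i ≥ 1` stands for the grid
    -- point `(i - 1) / N`.
    let z : ℕ → ℝ := fun i => if i = 0 then x + p * T else ((i - 1 : ℕ) : ℝ) / N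
    have hπ : ∀ i, ∃ π : M.Strategy F,
        ENNReal.ofReal θ * M.optimalValueENN F (z i) ≤ π.value (z i) := by
      intro i
      rcases eq_or_ne (M.optimalValueENN F (z i)) 0 with h0 | h0
      · exact ⟨Strategy.const M hF R hR, by simp [h0]⟩
      · have h1 : ENNReal.ofReal θ * M.optimalValueENN F (z i) < M.optimalValueENN F (z i) := by
          conv_rhs => rw [← one_mul (M.optimalValueENN F (z i))]
          exact ENNReal.mul_lt_mul_left h0 (hVfin _) (by simpa using hθ1)
        conv_rhs at h1 => rw [optimalValueENN]
        obtain ⟨π, h2⟩ := lt_iSup_iff.1 h1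
        exact ⟨π, h2.le⟩
    choose π hπ using hπ
    -- An event without claims is indistinguishable from no event and must also get index `0`.
    -- Otherwise `x` minus the retained claim is rounded down; the premium `p * T` is left out,
    -- which only lowers the level.
    let I : (Fin n → ℝ≥0) → ℕ := fun c => if c = 0 then 0 else
      ⌊(x - (∑ j, R j (c j) : ℝ≥0)) * N⌋₊ + 1
    have hI : Measurable I := by
      refine Measurable.ite (measurableSet_singleton _) measurable_const ?_
      refine Measurable.add_const (Nat.measurable_floor.comp ?_) 1
      refine Measurable.mul_const (measurable_const.sub ?_) _
      exact (Finset.measurable_fun_sum _ fun j _ =>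
        (hRm j).comp (measurable_pi_apply j)).coe_nnreal_real
    have hI0 : I 0 = 0 := if_pos rfl
    have hz0 : z 0 = x + p * T := if_pos rfl
    have hpT : 0 ≤ p * T := mul_nonneg hp.le hT
    have hIz : ∀ u ∈ A, z (I (lineClaims u)) ≤ x + p * T - retained R u ∧
        ENNReal.ofReal θ * M.optimalValueENN F (x - retained R u) ≤
          M.optimalValueENN F (z (I (lineClaims u))) := by
      intro u hu
      have hu' : (retained R u : ℝ) ≤ x := hu
      by_cases hc : lineClaims u = 0
      · have h0 : retained R u = 0 := by
          rw [retained_eq_lineClaims hRle, hc]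
          exact Finset.sum_eq_zero fun j _ => le_antisymm (hRle j 0) zero_le
        rw [hc, hI0, hz0, h0]
        refine ⟨by simp, ?_⟩
        calc ENNReal.ofReal θ * M.optimalValueENN F (x - (0 : ℝ≥0))
            ≤ 1 * M.optimalValueENN F (x - (0 : ℝ≥0)) := by
              gcongr
              simpa using hθ1.le
          _ ≤ M.optimalValueENN F (x + p * T) := by
              rw [one_mul]
              refine hVmono ?_
              simpa using hpT
      · have hIu : I (lineClaims u) = ⌊(x - retained R u) * N⌋₊ + 1 := by
          rw [retained_eq_lineClaims hRle]
          exact if_neg hc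
        set y := x - (retained R u : ℝ) with hy
        have hy0 : 0 ≤ y := sub_nonneg.2 hu'
        have hz : z (I (lineClaims u)) = (⌊y * N⌋₊ : ℝ) / N := by
          rw [hIu]
          simp [z]
        have hz1 : z (I (lineClaims u)) ≤ y := by
          rw [hz, div_le_iff₀ hN0']
          exact Nat.floor_le (by positivity)
        have hz2 : y ≤ z (I (lineClaims u)) + p * (1 / (N * p)) := by
          have h1 : p * (1 / (N * p)) = 1 / N := by field_simp
          rw [h1, hz, ← add_div, le_div_iff₀ hN0']
          exact (Nat.lt_floor_add_one _).le
        have hz3 : 0 ≤ z (I (lineClaims u)) := by rw [hz]; positivity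
        refine ⟨by linarith, ?_⟩
        refine le_trans ?_ (M.exp_mul_optimalValueENN_le hF hβ hR hp.le
          (T := 1 / (N * p)) (by positivity) hz3)
        gcongr
        exact hVmono hz2
    have hmain := M.le_optimalValueENN_switch hF hβ hR hp.le hT hI π (z := z) hx
      (by rw [hI0, hz0]) hAm (fun u hu => hu) (fun u hu => (hIz u hu).1)
    refine le_trans ?_ hmain
    rw [hI0, hz0, mul_left_comm, mul_add]
    refine mul_le_mul_right (add_le_add ?_ ?_) _
    · refine le_trans ?_ (hz0 ▸ hπ 0)
      gcongr
      nlinarith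
    · rw [mul_left_comm, ← lintegral_const_mul' _ _ ENNReal.ofReal_ne_top]
      refine mul_le_mul_right ?_ _
      refine setLIntegral_mono' hAm fun u hu => ?_
      refine le_trans ?_ (hπ _)
      rw [pow_two, ENNReal.ofReal_mul hθ0.le, mul_assoc]
      gcongr
      exact (hIz u hu).2
  have hlim : Tendsto (fun θ : ℝ => ENNReal.ofReal (θ ^ 2) *
      (ENNReal.ofReal (Real.exp (-(lam * T))) * (M.optimalValueENN F (x + p * T) +
        ENNReal.ofReal T * ∫⁻ u in A, M.optimalValueENN F (x - retained R u) ∂M.intensity)))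
      (𝓝[<] 1) (𝓝 (1 * (ENNReal.ofReal (Real.exp (-(lam * T))) * (M.optimalValueENN F (x + p * T) +
        ENNReal.ofReal T * ∫⁻ u in A, M.optimalValueENN F (x - retained R u) ∂M.intensity)))) := by
    refine ENNReal.Tendsto.mul_const ?_ (Or.inl one_ne_zero)
    have : Tendsto (fun θ : ℝ => ENNReal.ofReal (θ ^ 2)) (𝓝 1) (𝓝 (ENNReal.ofReal (1 ^ 2))) :=
      ((ENNReal.continuous_ofReal.comp (continuous_pow 2)).tendsto 1)
    simpa using this.mono_left nhdsWithin_le_nhds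
  rw [one_mul] at hlim
  refine le_of_tendsto hlim ?_
  filter_upwards [Ioo_mem_nhdsLT one_pos] with θ hθ
  exact key θ hθ.1 hθ.2

end RiskModel

/-! ### Upper bound for the value of a strategy -/

namespace RiskModel

namespace Strategy

variable {M : RiskModel m n} {F : Fin n → Set Retention}

theorem measurable_claims_delayed {Φ : Scenario m n → Scenario m n} {u : Mark n} {b : ℝ}
    (hΦ : ∀ ω, Delayed (Φ ω) ω b u b) (j : Fin n) {r t : ℝ} (hrt : r < b + t) :
    Measurable[M.historyBefore t] fun ω =>
      (claimsENN (Φ (sanitize ω)) j (fun _ => id) r).toReal := by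
  refine Measurable.ennreal_toReal ?_
  simp_rw [fun ω => hΦ (sanitize ω) j (fun _ => id) r]
  refine Measurable.const_add ?_ _
  rcases le_or_gt (r - b) 0 with h | h
  · simp_rw [fun ω : Scenario m n => claimsENN_sanitize_of_neg ω j (fun _ => id) h]
    exact measurable_const
  · exact measurable_claimsENN_sanitize (t := t) (g := fun ω => ω)
      (fun q hq hqt => (M.measurable_claims_historyBefore j hq hqt)) h.le (by linarith)

/-- With the time `b` and the mark `u` fixed, the rest of `π` is the admissible strategy `restart`,
which is worth at most `V`. Sanitizing the future scenario changes it on a null set only. -/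
theorem lintegral_delayed_le (hF : ∀ j, IsReinsuranceFamily (F j)) (hβ : 0 < M.totalβ)
    (π : M.Strategy F) {b : ℝ} (hb : 0 ≤ b) {Φ : Scenario m n → Scenario m n} (hΦm : Measurable Φ)
    {u : Mark n} (hΦ : ∀ ω, Delayed (Φ ω) ω b u b) {x : ℝ} {g : Scenario m n → ℝ≥0∞}
    (hg : ∀ ω, g ω ≤ π.discountedDividends x ω) :
    ∫⁻ ω, g (Φ ω) ∂M.prob ≤ π.earlyDividends x (quiet m n) b +
      {_s : Unit | π.Solvent x (quiet m n) b}.indicator (fun _ =>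
        ENNReal.ofReal (Real.exp (-M.δ * b)) * M.optimalValueENN F
          (π.surplus x (quiet m n) b - retained (π.R b (quiet m n)) u)) () := by
  have hΨm : Measurable (Φ ∘ sanitize) := hΦm.comp measurable_sanitize
  have hΨ : ∀ j r t, 0 ≤ t → 0 ≤ r → r < b + t → Measurable[M.historyBefore t] fun ω =>
      (claimsENN ((Φ ∘ sanitize) ω) j (fun _ => id) r).toReal :=
    fun j r t _ _ hrt => measurable_claims_delayed hΦ j hrt
  have h1 : ∫⁻ ω, g (Φ ω) ∂M.prob ≤ ∫⁻ ω, (π.earlyDividends x (quiet m n) b +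
      {_s : Unit | π.Solvent x (quiet m n) b}.indicator (fun _ =>
        ENNReal.ofReal (Real.exp (-M.δ * b)) * (π.restart hb _ hΨm hΨ).discountedDividends
          (π.surplus x (quiet m n) b - retained (π.R b (quiet m n)) u) ω) ()) ∂M.prob := by
    refine lintegral_mono_ae ?_
    filter_upwards [M.ae_isRegular] with ω hω
    have h2 : (Φ ∘ sanitize) ω = Φ ω := by
      rw [Function.comp_apply, sanitize_of_isRegular hω]
    rw [← discountedDividends_restart hF hβ π hb hΨm hΨ (h2 ▸ hΦ ω) hω x, h2]
    exact hg _
  refine h1.trans ?_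
  rw [lintegral_add_left measurable_const, lintegral_const, measure_univ, mul_one]
  refine add_le_add le_rfl ?_
  by_cases hS : π.Solvent x (quiet m n) b
  · have hS' : () ∈ {_s : Unit | π.Solvent x (quiet m n) b} := hS
    simp only [indicator_of_mem hS']
    rw [lintegral_const_mul' _ _ ENNReal.ofReal_ne_top]
    gcongr
    exact le_iSup (fun σ : M.Strategy F => σ.value _) (π.restart hb _ hΨm hΨ)
  · have hS' : () ∉ {_s : Unit | π.Solvent x (quiet m n) b} := hS
    simp [indicator_of_notMem hS']

end Strategy

variable (M : RiskModel m n) {F : Fin n → Set Retention}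

/-- Decomposition of the law of the scenarios with respect to the first event before time `T`. -/
theorem lintegral_le_first_event {T : ℝ} (hT : 0 ≤ T) {f : Scenario m n → ℝ≥0∞}
    (hf : Measurable f) : ∫⁻ ω, f ω ∂M.prob ≤
      ENNReal.ofReal (Real.exp (-(M.totalβ * T))) * ∫⁻ ω, f (shiftWaits (fun _ => T) ω) ∂M.prob +
      ∑ k, ∫⁻ t in Ico 0 T, ENNReal.ofReal (M.β k * Real.exp (-(M.totalβ * t))) *
        ∫⁻ u, ∫⁻ ω, f (arrive k t u t ω) ∂M.prob ∂M.markLaw k := by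
  have h0 := M.lintegral_prob_shiftWaits (a := fun _ => T) (fun _ => hT) hf
  rw [← Finset.sum_mul] at h0
  have hk := fun k => M.lintegral_prob_arrive k (B := Ico 0 T) measurableSet_Ico (b := fun t => t)
      measurable_id (fun t ht => ht.1) (fun t _ => le_rfl) hf
  rw [← totalβ] at h0
  rw [← h0]
  simp_rw [← hk]
  set E₀ := {ω : Scenario m n | ∀ k, T ≤ (ω (k, 0)).1} with hE₀
  have hEm : MeasurableSet E₀ := by
    have : E₀ = ⋂ k, {ω : Scenario m n | T ≤ (ω (k, 0)).1} := by ext; simp [hE₀]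
    rw [this]
    exact MeasurableSet.iInter fun k => measurableSet_le measurable_const (by fun_prop)
  have hEkm : ∀ k : Fin m, MeasurableSet {ω : Scenario m n | (ω (k, 0)).1 ∈ Ico 0 T ∧ ∀ k',
      if k' = k then (ω (k, 0)).1 - (ω (k, 0)).1 ≤ (ω (k, 1)).1
      else (ω (k, 0)).1 ≤ (ω (k', 0)).1} := fun k => by
    have : {ω : Scenario m n | (ω (k, 0)).1 ∈ Ico 0 T ∧ ∀ k',
        if k' = k then (ω (k, 0)).1 - (ω (k, 0)).1 ≤ (ω (k, 1)).1
        else (ω (k, 0)).1 ≤ (ω (k', 0)).1} =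
        (fun ω : Scenario m n => (ω (k, 0)).1) ⁻¹' Ico 0 T ∩ ⋂ k', {ω | if k' = k
        then (ω (k, 0)).1 - (ω (k, 0)).1 ≤ (ω (k, 1)).1
        else (ω (k, 0)).1 ≤ (ω (k', 0)).1} := by ext; simp
    rw [this]
    refine MeasurableSet.inter ((by fun_prop : Measurable fun ω : Scenario m n =>
      (ω (k, 0)).1) measurableSet_Ico) (MeasurableSet.iInter fun k' => ?_)
    by_cases h : k' = k
    · simp only [h, if_true]
      exact measurableSet_le (by fun_prop) (by fun_prop)
    · simp only [h, if_false]
      exact measurableSet_le (by fun_prop) (by fun_prop)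
  rw [← lintegral_finsetSum _ fun k _ => hf.indicator (hEkm k),
    ← lintegral_add_left (hf.indicator hEm)]
  refine lintegral_mono_ae ?_
  filter_upwards [M.ae_wait_pos] with ω hω
  by_cases h : ω ∈ E₀
  · rw [indicator_of_mem h]
    exact le_self_add
  · obtain ⟨k₀, hk₀⟩ : ∃ k, (ω (k, 0)).1 < T := by
      by_contra hcon
      push Not at hcon
      exact h hcon
    have : Nonempty (Fin m) := ⟨k₀⟩
    -- Ties between classes are harmless, since only an upper bound is needed.
    obtain ⟨k₁, hk₁⟩ := Finite.exists_min fun k : Fin m => (ω (k, 0)).1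
    refine le_trans ?_ le_add_self
    refine le_trans ?_ (Finset.single_le_sum (fun _ _ => zero_le) (Finset.mem_univ k₁))
    rw [indicator_of_mem]
    refine ⟨⟨(hω _).le, (hk₁ k₀).trans_lt hk₀⟩, fun k' => ?_⟩
    split_ifs
    · rw [sub_self]; exact (hω _).le
    · exact hk₁ k'

/-- The total mass of the exponential law of the first event time, split at `T`. -/
theorem exp_add_lintegral_exp (hβ : 0 < M.totalβ) {T : ℝ} (hT : 0 ≤ T) :
    ENNReal.ofReal (Real.exp (-(M.totalβ * T))) +
      ∫⁻ t in Ico 0 T, ENNReal.ofReal (M.totalβ * Real.exp (-(M.totalβ * t))) = 1 := by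
  have := isProbabilityMeasure_expMeasure hβ
  have h1 := lintegral_expMeasure_Ici (r := M.totalβ) hT (f := fun _ => 1) measurable_const
  have h2 := lintegral_expMeasure (r := M.totalβ) (f := (Ico 0 T).indicator fun _ => 1)
    (measurable_const.indicator measurableSet_Ico)
  rw [lintegral_one, measure_univ, mul_one] at h1
  have h3 : ∫⁻ t in Ici 0, ENNReal.ofReal (M.totalβ * Real.exp (-(M.totalβ * t))) *
      (Ico 0 T).indicator (fun _ => 1) t =
      ∫⁻ t in Ico 0 T, ENNReal.ofReal (M.totalβ * Real.exp (-(M.totalβ * t))) := by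
    rw [← lintegral_indicator measurableSet_Ici, ← lintegral_indicator measurableSet_Ico]
    refine lintegral_congr fun t => ?_
    by_cases ht : t ∈ Ico 0 T
    · simp [ht, ht.1]
    · simp [ht]
  rw [← h3, ← h2, ← h1, lintegral_indicator_const measurableSet_Ici,
    lintegral_indicator_const measurableSet_Ico, one_mul, one_mul,
    ← measure_union (by rw [Set.disjoint_left]; intro t ht ht'; exact ht'.2.not_ge ht)
      measurableSet_Ico]
  have h4 : (expMeasure M.totalβ) (Ici 0) = 1 := by
    have h5 := lintegral_expMeasure_Ici (r := M.totalβ) le_rfl (f := fun _ => 1) measurable_const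
    rw [lintegral_one, measure_univ, mul_one, lintegral_indicator_const measurableSet_Ici,
      one_mul] at h5
    simpa using h5
  rw [union_comm, Ico_union_Ici_eq_Ici hT, h4]

/-- The value of a strategy is controlled by its action on `[0, T)` in the absence of claims. -/
theorem Strategy.value_le {M : RiskModel m n} (hF : ∀ j, IsReinsuranceFamily (F j))
    (hβ : 0 < M.totalβ) (π : M.Strategy F) {T : ℝ} (hT : 0 ≤ T) (x : ℝ) :
    π.value x ≤ π.earlyDividends x (quiet m n) T +
      ENNReal.ofReal (Real.exp (-((M.δ + M.totalβ) * T))) *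
        {_s : Unit | π.Solvent x (quiet m n) T}.indicator (fun _ =>
          M.optimalValueENN F (π.surplus x (quiet m n) T)) () +
      ∫⁻ t in Ico 0 T, ∫⁻ u, M.optimalValueENN F
        (x + M.premiumBound * T - retained (π.R t (quiet m n)) u) ∂M.intensity := by
  obtain ⟨g, hg, hgle, hgeq⟩ := exists_measurable_le_lintegral_eq M.prob
    fun ω => π.discountedDividends x ω
  have hVmono : Monotone (M.optimalValueENN F) := M.optimalValueENN_mono
  set q : Scenario m n := quiet m n with hq
  set A := π.earlyDividends x q T with hA
  -- A crude bound for the value after an event at `t`: earlier dividends and discounting are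
  -- dropped, and the premiums are replaced by their bound. `exists_pos_generator_le` later absorbs
  -- the raised level.
  let J : ℝ → Mark n → ℝ≥0∞ := fun t u =>
    M.optimalValueENN F (x + M.premiumBound * T - retained (π.R t q) u)
  have hJm : Measurable fun s : ℝ × Mark n => J s.1 s.2 := by
    refine hVmono.measurable.comp (measurable_const.sub ?_)
    exact (measurable_retained (R := fun t => π.R t q) fun j =>
      π.measurable_R_time q j).coe_nnreal_real
  have hJkm : ∀ k, Measurable fun t => ∫⁻ u, J t u ∂M.markLaw k := fun k =>
    hJm.lintegral_prod_right'
  have h0 : ∫⁻ ω, g (shiftWaits (fun _ => T) ω) ∂M.prob ≤ A +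
      ENNReal.ofReal (Real.exp (-M.δ * T)) * {_s : Unit | π.Solvent x q T}.indicator (fun _ =>
          M.optimalValueENN F (π.surplus x q T)) () := by
    have := lintegral_delayed_le hF hβ π hT (measurable_shiftWaits measurable_const measurable_id)
      (fun ω => delayed_shiftWaits T T ω) hgle
    refine this.trans (add_le_add le_rfl (le_of_eq ?_))
    rw [retained_noHit, NNReal.coe_zero, sub_zero]
    by_cases hS : π.Solvent x q T <;> simp [hS, ← hq]
  have hk : ∀ k t u, t ∈ Ico 0 T → ∫⁻ ω, g (arrive k t u t ω) ∂M.prob ≤ A + J t u := by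
    intro k t u ht
    have := lintegral_delayed_le hF hβ π ht.1 (Φ := arrive k t u t)
      (measurable_arrive k measurable_const measurable_const measurable_const measurable_id)
      (fun ω => delayed_arrive k t u t ω) hgle
    refine this.trans (add_le_add (π.earlyDividends_mono x q ht.2.le) ?_)
    refine (indicator_le_self _ _ _).trans ?_
    refine (mul_le_of_le_one_left zero_le ?_).trans (hVmono ?_)
    · rw [ENNReal.ofReal_le_one, Real.exp_le_one_iff]
      have := mul_nonneg M.δ_pos.le ht.1
      linarith
    · have h1 := π.surplus_le hF hβ x q ht.1
      have h2 := π.D_nonneg t q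
      have h3 := mul_le_mul_of_nonneg_left ht.2.le M.premiumBound_nonneg
      linarith
  have hsum : ∑ k, ∫⁻ t in Ico 0 T, ENNReal.ofReal (M.β k * Real.exp (-(M.totalβ * t))) *
        ∫⁻ u, ∫⁻ ω, g (arrive k t u t ω) ∂M.prob ∂M.markLaw k ≤
      (∫⁻ t in Ico 0 T, ENNReal.ofReal (M.totalβ * Real.exp (-(M.totalβ * t)))) * A +
        ∫⁻ t in Ico 0 T, ∫⁻ u, J t u ∂M.intensity := by
    have h1 : ∀ k, ∫⁻ t in Ico 0 T, ENNReal.ofReal (M.β k * Real.exp (-(M.totalβ * t))) *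
        ∫⁻ u, ∫⁻ ω, g (arrive k t u t ω) ∂M.prob ∂M.markLaw k ≤
        ∫⁻ t in Ico 0 T, (ENNReal.ofReal (M.β k * Real.exp (-(M.totalβ * t))) * A +
          ENNReal.ofReal (M.β k) * ∫⁻ u, J t u ∂M.markLaw k) := fun k => by
      refine setLIntegral_mono' measurableSet_Ico fun t ht => ?_
      have h2 : ∫⁻ u, ∫⁻ ω, g (arrive k t u t ω) ∂M.prob ∂M.markLaw k ≤
          A + ∫⁻ u, J t u ∂M.markLaw k := by
        refine (lintegral_mono fun u => hk k t u ht).trans ?_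
        rw [lintegral_add_left measurable_const, lintegral_const, measure_univ, mul_one]
      refine (mul_le_mul_right h2 _).trans ?_
      rw [mul_add]
      gcongr
      refine mul_le_of_le_one_right (M.β_pos k).le ?_
      rw [Real.exp_le_one_iff]
      have := mul_nonneg hβ.le ht.1
      linarith
    refine (Finset.sum_le_sum fun k _ => h1 k).trans ?_
    rw [← lintegral_finsetSum _ fun k _ => by
      have := hJkm k
      fun_prop]
    have h3 : ∀ t, ∑ k, (ENNReal.ofReal (M.β k * Real.exp (-(M.totalβ * t))) * A +
          ENNReal.ofReal (M.β k) * ∫⁻ u, J t u ∂M.markLaw k) =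
        ENNReal.ofReal (M.totalβ * Real.exp (-(M.totalβ * t))) * A + ∫⁻ u, J t u ∂M.intensity :=
      fun t => by
        rw [Finset.sum_add_distrib, lintegral_intensity, ← Finset.sum_mul,
          ← ENNReal.ofReal_sum_of_nonneg fun k _ => mul_nonneg (M.β_pos k).le (Real.exp_pos _).le,
          ← Finset.sum_mul]
        rfl
    simp_rw [h3]
    rw [lintegral_add_left (by fun_prop), lintegral_mul_const _ (by fun_prop)]
  calc π.value x = ∫⁻ ω, g ω ∂M.prob := hgeq
    _ ≤ _ := M.lintegral_le_first_event hT hg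
    _ ≤ _ := add_le_add (mul_le_mul_right h0 _) hsum
    _ = (ENNReal.ofReal (Real.exp (-(M.totalβ * T))) +
        ∫⁻ t in Ico 0 T, ENNReal.ofReal (M.totalβ * Real.exp (-(M.totalβ * t)))) * A +
        ENNReal.ofReal (Real.exp (-(M.totalβ * T))) * ENNReal.ofReal (Real.exp (-M.δ * T)) *
          {_s : Unit | π.Solvent x q T}.indicator (fun _ =>
            M.optimalValueENN F (π.surplus x q T)) () +
        ∫⁻ t in Ico 0 T, ∫⁻ u, J t u ∂M.intensity := by ring
    _ = _ := by
      rw [M.exp_add_lintegral_exp hβ hT, one_mul, ← ENNReal.ofReal_mul (Real.exp_pos _).le,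
        ← Real.exp_add]
      congr 5
      ring

end RiskModel

/-! ### The value function as a real function -/

namespace RiskModel

variable (M : RiskModel m n) {F : Fin n → Set Retention}

theorem ofReal_optimalValue (hF : ∀ j, IsReinsuranceFamily (F j)) (hβ : 0 < M.totalβ) (x : ℝ) :
    ENNReal.ofReal (M.optimalValue F x) = M.optimalValueENN F x :=
  ENNReal.ofReal_toReal (M.optimalValueENN_ne_top hF hβ x)

theorem optimalValue_nonneg (x : ℝ) : 0 ≤ M.optimalValue F x := ENNReal.toReal_nonneg

theorem optimalValue_mono (hF : ∀ j, IsReinsuranceFamily (F j)) (hβ : 0 < M.totalβ) :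
    Monotone (M.optimalValue F) := fun _ _ h =>
  ENNReal.toReal_mono (M.optimalValueENN_ne_top hF hβ _) (M.optimalValueENN_mono h)

theorem optimalValue_of_neg (hF : ∀ j, IsReinsuranceFamily (F j)) (hβ : 0 < M.totalβ) {x : ℝ}
    (hx : x < 0) : M.optimalValue F x = 0 := by
  rw [optimalValue, M.optimalValueENN_of_neg hF hβ hx, ENNReal.toReal_zero]

theorem optimalValue_add_le {R : Fin n → Retention} (hF : ∀ j, IsReinsuranceFamily (F j))
    (hβ : 0 < M.totalβ) (hR : ∀ j, R j ∈ F j) (hp : 0 < M.premium R) {x h : ℝ} (hx : 0 ≤ x)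
    (hh : 0 ≤ h) : M.optimalValue F x + h ≤ M.optimalValue F (x + h) := by
  have := M.add_le_optimalValueENN hF hR hp.le hx hh
  rw [← M.ofReal_optimalValue hF hβ, ← M.ofReal_optimalValue hF hβ,
    ← ENNReal.ofReal_add (M.optimalValue_nonneg _) hh] at this
  exact (ENNReal.ofReal_le_ofReal_iff (M.optimalValue_nonneg _)).1 this

theorem optimalValue_add_le_exp {R : Fin n → Retention} (hF : ∀ j, IsReinsuranceFamily (F j))
    (hβ : 0 < M.totalβ) (hR : ∀ j, R j ∈ F j) (hp : 0 < M.premium R) {x h : ℝ} (hx : 0 ≤ x)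
    (hh : 0 ≤ h) : M.optimalValue F (x + h) ≤
      Real.exp ((M.δ + M.totalβ) / M.premium R * h) * M.optimalValue F x := by
  have := M.exp_mul_optimalValueENN_le hF hβ hR hp.le (T := h / M.premium R) (by positivity) hx
  rw [mul_div_cancel₀ _ hp.ne', ← M.ofReal_optimalValue hF hβ, ← M.ofReal_optimalValue hF hβ,
    ← ENNReal.ofReal_mul (Real.exp_pos _).le,
    ENNReal.ofReal_le_ofReal_iff (M.optimalValue_nonneg _), Real.exp_neg,
    inv_mul_le_iff₀ (Real.exp_pos _)] at this
  rwa [show (M.δ + M.totalβ) * (h / M.premium R) = (M.δ + M.totalβ) / M.premium R * h by ring]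
    at this

/-- If `V x = 0`, the growth bound would force `V (x + 1) = 0`, against `V x + 1 ≤ V (x + 1)`. -/
theorem optimalValue_pos {R : Fin n → Retention} (hF : ∀ j, IsReinsuranceFamily (F j))
    (hβ : 0 < M.totalβ) (hR : ∀ j, R j ∈ F j) (hp : 0 < M.premium R) {x : ℝ} (hx : 0 ≤ x) :
    0 < M.optimalValue F x := by
  by_contra hcon
  have h0 : M.optimalValue F x = 0 := le_antisymm (not_lt.1 hcon) (M.optimalValue_nonneg x)
  have h1 := M.optimalValue_add_le hF hβ hR hp hx zero_le_one
  have h2 := M.optimalValue_add_le_exp hF hβ hR hp hx zero_le_one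
  rw [h0, mul_zero] at h2
  linarith

/-- Monotonicity and the growth bound leave increments of at most `(exp s - 1) V` with `s`
proportional to the distance, and `exp s - 1 ≤ s exp s`. -/
theorem locallyLipschitzOn_optimalValue {R : Fin n → Retention}
    (hF : ∀ j, IsReinsuranceFamily (F j)) (hβ : 0 < M.totalβ) (hR : ∀ j, R j ∈ F j)
    (hp : 0 < M.premium R) : LocallyLipschitzOn (Ici 0) (M.optimalValue F) := by
  intro x hx
  rw [mem_Ici] at hx
  set c := (M.δ + M.totalβ) / M.premium R with hc
  have hc0 : 0 < c := div_pos (add_pos M.δ_pos hβ) hp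
  have hV0 := M.optimalValue_nonneg (F := F) (x + 1)
  have hVm := M.optimalValue_mono hF hβ
  refine ⟨(c * Real.exp (c * (x + 1)) * M.optimalValue F (x + 1)).toNNReal, Icc 0 (x + 1), ?_, ?_⟩
  · rw [← Ici_inter_Iic]
    exact inter_mem_nhdsWithin _ (Iic_mem_nhds (by linarith))
  · refine LipschitzOnWith.of_le_add_mul _ fun y hy z hz => ?_
    rw [Real.coe_toNNReal _ (by positivity)]
    rcases le_total y z with h | h
    · refine (hVm h).trans (le_add_of_nonneg_right (by positivity))
    · have h1 := M.optimalValue_add_le_exp hF hβ hR hp hz.1 (sub_nonneg.2 h)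
      rw [add_sub_cancel, ← hc] at h1
      rw [Real.dist_eq, abs_of_nonneg (sub_nonneg.2 h)]
      have hs : 0 ≤ c * (y - z) := mul_nonneg hc0.le (sub_nonneg.2 h)
      have h2 : Real.exp (c * (y - z)) - 1 ≤ c * (y - z) * Real.exp (c * (y - z)) := by
        have := Real.add_one_le_exp (-(c * (y - z)))
        have h3 := mul_le_mul_of_nonneg_right this (Real.exp_pos (c * (y - z))).le
        rw [← Real.exp_add, neg_add_cancel, Real.exp_zero] at h3
        linarith
      have h4 : Real.exp (c * (y - z)) ≤ Real.exp (c * (x + 1)) :=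
        Real.exp_le_exp.2 (mul_le_mul_of_nonneg_left (by linarith [hy.2, hz.1]) hc0.le)
      have h5 : Real.exp (c * (y - z)) - 1 ≤ c * (y - z) * Real.exp (c * (x + 1)) :=
        h2.trans (mul_le_mul_of_nonneg_left h4 hs)
      have h6 : c * (y - z) * Real.exp (c * (x + 1)) * M.optimalValue F z ≤
          c * (y - z) * Real.exp (c * (x + 1)) * M.optimalValue F (x + 1) :=
        mul_le_mul_of_nonneg_left (hVm hz.2) (by positivity)
      have h7 := mul_le_mul_of_nonneg_right h5 (M.optimalValue_nonneg (F := F) z)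
      linarith

theorem continuousOn_optimalValue {R : Fin n → Retention}
    (hF : ∀ j, IsReinsuranceFamily (F j)) (hβ : 0 < M.totalβ) (hR : ∀ j, R j ∈ F j)
    (hp : 0 < M.premium R) : ContinuousOn (M.optimalValue F) (Ici 0) :=
  (M.locallyLipschitzOn_optimalValue hF hβ hR hp).continuousOn

/-- Rate at which value is regained through the claims, from the surplus level `y`. -/
def jumpValue (F : Fin n → Set Retention) (R : Fin n → Retention) (y : ℝ) : ℝ≥0∞ :=
  ∫⁻ u, M.optimalValueENN F (y - retained R u) ∂M.intensity

theorem jumpValue_le (R : Fin n → Retention) (y : ℝ) :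
    M.jumpValue F R y ≤ ENNReal.ofReal M.totalβ * M.optimalValueENN F y := by
  refine (lintegral_mono fun u => M.optimalValueENN_mono (F := F)
    (sub_le_self y (retained R u).coe_nonneg)).trans ?_
  rw [lintegral_const, M.intensity_univ, mul_comm]

theorem jumpValue_mono (R : Fin n → Retention) : Monotone (M.jumpValue F R) := fun _ _ h =>
  lintegral_mono fun _ => M.optimalValueENN_mono (sub_le_sub_right h _)

theorem jumpValue_ne_top (hF : ∀ j, IsReinsuranceFamily (F j)) (hβ : 0 < M.totalβ)
    (R : Fin n → Retention) (y : ℝ) : M.jumpValue F R y ≠ ⊤ :=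
  ne_top_of_le_ne_top (ENNReal.mul_ne_top ENNReal.ofReal_ne_top (M.optimalValueENN_ne_top hF hβ y))
    (M.jumpValue_le R y)

theorem toReal_jumpValue_le (hF : ∀ j, IsReinsuranceFamily (F j)) (hβ : 0 < M.totalβ)
    (R : Fin n → Retention) (y : ℝ) :
    (M.jumpValue F R y).toReal ≤ M.totalβ * M.optimalValue F y := by
  have := ENNReal.toReal_mono (ENNReal.mul_ne_top ENNReal.ofReal_ne_top
    (M.optimalValueENN_ne_top hF hβ y)) (M.jumpValue_le R y)
  rwa [ENNReal.toReal_mul, ENNReal.toReal_ofReal hβ.le] at this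

/-- The cutoff to `Icc 0 x` is immaterial: claims are almost surely nonnegative and `V` vanishes at
negative levels. -/
theorem generator_eq (hF : ∀ j, IsReinsuranceFamily (F j)) (hβ : 0 < M.totalβ)
    {R : Fin n → Retention} (hR : ∀ j, R j ∈ F j) (x v d : ℝ) :
    M.generator R x v d (M.optimalValue F) =
      M.premium R * d - (M.δ + M.totalβ) * v + (M.jumpValue F R x).toReal := by
  have hVm : Measurable (M.optimalValueENN F) := (M.optimalValueENN_mono (F := F)).measurable
  have hRm : ∀ j, Measurable (R j) := fun j => (hF j).measurable _ (hR j)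
  have hm : Measurable fun a => M.optimalValue F (x - a) :=
    (M.optimalValue_mono hF hβ).measurable.comp (measurable_const.sub measurable_id)
  rw [generator]
  congr 1
  rw [integral_eq_lintegral_of_nonneg_ae (ae_of_all _ fun a => M.optimalValue_nonneg _)
    hm.aestronglyMeasurable]
  simp_rw [M.ofReal_optimalValue hF hβ]
  rw [← lintegral_indicator measurableSet_Icc, jumpValue,
    ← M.lintegral_claimDist hβ hRm (f := fun a => M.optimalValueENN F (x - a))
      (hVm.comp (measurable_const.sub measurable_id)),
    ENNReal.toReal_mul, ENNReal.toReal_ofReal hβ.le]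
  congr 2
  refine lintegral_congr_ae ?_
  filter_upwards [M.ae_claimDist_nonneg hRm] with a ha
  by_cases hax : a ≤ x
  · exact indicator_of_mem (show a ∈ Icc 0 x from ⟨ha, hax⟩) _
  · rw [indicator_of_notMem fun h : a ∈ Icc 0 x => hax h.2,
      M.optimalValueENN_of_neg hF hβ (by linarith)]

/-! ### The value function is a supersolution -/

theorem one_le_of_isSubdifferential {R : Fin n → Retention} (hF : ∀ j, IsReinsuranceFamily (F j))
    (hβ : 0 < M.totalβ) (hR : ∀ j, R j ∈ F j) (hp : 0 < M.premium R) {x d : ℝ} (hx : 0 < x)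
    (hd : IsSubdifferential (M.optimalValue F) x d) : 1 ≤ d := by
  have h1 : ((1 : ℝ) : EReal) ≤ limsup (fun h : ℝ => (((M.optimalValue F (x + h) -
      M.optimalValue F x) / h : ℝ) : EReal)) (𝓝[<] 0) := by
    refine le_limsup_of_frequently_le (Eventually.frequently ?_)
    filter_upwards [Ioo_mem_nhdsLT (neg_lt_zero.2 hx)] with h hh
    rw [EReal.coe_le_coe_iff, le_div_iff_of_neg hh.2, one_mul]
    have := M.optimalValue_add_le hF hβ hR hp (x := x + h) (h := -h) (by linarith [hh.1])
      (by linarith [hh.2])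
    rw [add_neg_cancel_right] at this
    linarith
  exact EReal.coe_le_coe_iff.1 (h1.trans hd.2)

/-- Left of `0` the function drops from `V 0 > 0` to `0`, so the left quotients are unbounded and
the supersolution condition is void. -/
theorem not_isSubdifferential_zero {R : Fin n → Retention} (hF : ∀ j, IsReinsuranceFamily (F j))
    (hβ : 0 < M.totalβ) (hR : ∀ j, R j ∈ F j) (hp : 0 < M.premium R) (d : ℝ) :
    ¬ IsSubdifferential (M.optimalValue F) 0 d := fun hd => by
  have hV := M.optimalValue_pos hF hβ hR hp le_rfl
  set v := M.optimalValue F 0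
  have h1 : ((|d| + 1 : ℝ) : EReal) ≤ limsup (fun h : ℝ => (((M.optimalValue F (0 + h) -
      v) / h : ℝ) : EReal)) (𝓝[<] 0) := by
    refine le_limsup_of_frequently_le (Eventually.frequently ?_)
    have h2 : -(v / (|d| + 1)) < 0 := neg_lt_zero.2 (by positivity)
    filter_upwards [Ioo_mem_nhdsLT h2] with h hh
    rw [EReal.coe_le_coe_iff, le_div_iff_of_neg hh.2, zero_add,
      M.optimalValue_of_neg hF hβ hh.2]
    have h3 : -h < v / (|d| + 1) := by linarith [hh.1]
    rw [lt_div_iff₀ (by positivity)] at h3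
    linarith
  have h2 := EReal.coe_le_coe_iff.1 (h1.trans hd.2)
  linarith [le_abs_self d]

/-- The lower estimate with `T = h / p` bounds the right quotients, and `d` lies below their lower
limit as `h → 0`. -/
theorem generator_nonpos_of_premium_pos {R : Fin n → Retention}
    (hF : ∀ j, IsReinsuranceFamily (F j)) (hβ : 0 < M.totalβ) (hR : ∀ j, R j ∈ F j)
    (hp : 0 < M.premium R) {x d : ℝ} (hx : 0 ≤ x)
    (hd : IsSubdifferential (M.optimalValue F) x d) :
    M.generator R x (M.optimalValue F x) d (M.optimalValue F) ≤ 0 := by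
  rw [M.generator_eq hF hβ hR]
  set p := M.premium R
  set lam := M.δ + M.totalβ
  set V := M.optimalValue F with hV
  set J := (M.jumpValue F R x).toReal
  suffices H : d ≤ lam / p * V x - J / p by
    have := mul_le_mul_of_nonneg_left H hp.le
    have h2 : p * (lam / p * V x - J / p) = lam * V x - J := by field_simp
    linarith
  have hquot : ∀ h, 0 < h → (V (x + h) - V x) / h ≤
      (Real.exp (lam / p * h) - 1) / h * V x - J / p := by
    intro h hh
    have h1 := M.le_optimalValueENN_of_premium_pos hF hβ hR hp (T := h / p) (by positivity) hx
    rw [mul_div_cancel₀ _ hp.ne', ← jumpValue, ← M.ofReal_optimalValue hF hβ,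
      ← M.ofReal_optimalValue hF hβ, ← ENNReal.ofReal_toReal (M.jumpValue_ne_top hF hβ R x),
      ← ENNReal.ofReal_mul (by positivity), ← ENNReal.ofReal_add (M.optimalValue_nonneg _)
        (mul_nonneg (by positivity) ENNReal.toReal_nonneg), ← ENNReal.ofReal_mul (Real.exp_pos _).le,
      ENNReal.ofReal_le_ofReal_iff (M.optimalValue_nonneg _), Real.exp_neg,
      inv_mul_le_iff₀ (Real.exp_pos _)] at h1
    have h2 : lam * (h / p) = lam / p * h := by ring
    change V (x + h) + h / p * J ≤ Real.exp (lam * (h / p)) * V x at h1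
    rw [h2] at h1
    rw [div_le_iff₀ hh]
    have h3 : ((Real.exp (lam / p * h) - 1) / h * V x - J / p) * h =
        (Real.exp (lam / p * h) - 1) * V x - h / p * J := by field_simp
    rw [h3]
    linarith
  have hlim : Tendsto (fun h => (Real.exp (lam / p * h) - 1) / h * V x - J / p) (𝓝[>] 0)
      (𝓝 (lam / p * V x - J / p)) := by
    refine Tendsto.sub_const (Tendsto.mul_const _ ?_) _
    have h1 : HasDerivAt (fun h => Real.exp (lam / p * h)) (lam / p) 0 := by
      have := ((hasDerivAt_id (0 : ℝ)).const_mul (lam / p)).exp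
      simpa using this
    have h2 := (hasDerivAt_iff_tendsto_slope.1 h1).mono_left
      (nhdsWithin_mono 0 fun h (hh : 0 < h) => hh.ne')
    refine h2.congr fun h => ?_
    rw [slope_def_field]
    simp
  refine le_of_forall_lt fun d' hd' => ?_
  obtain ⟨d'', h1, h2⟩ := exists_between hd'
  refine h1.trans_le (ge_of_tendsto hlim ?_)
  have h3 := eventually_lt_of_lt_liminf ((EReal.coe_lt_coe_iff.2 h2).trans_le hd.1)
  filter_upwards [h3, self_mem_nhdsWithin] with h h4 h5
  exact (EReal.coe_lt_coe_iff.1 h4).le.trans (hquot h h5)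

theorem isViscositySupersolutionAt_optimalValue {R : Fin n → Retention}
    (hF : ∀ j, IsReinsuranceFamily (F j)) (hβ : 0 < M.totalβ) (hR : ∀ j, R j ∈ F j)
    (hp : 0 < M.premium R) {x : ℝ} (hx : 0 ≤ x) :
    IsViscositySupersolutionAt (M.hjb F) (M.optimalValue F) x := by
  refine ⟨M.locallyLipschitzOn_optimalValue hF hβ hR hp, fun d hd => ?_⟩
  rcases hx.eq_or_lt with rfl | hx'
  · exact absurd hd (M.not_isSubdifferential_zero hF hβ hR hp d)
  have h1 := M.one_le_of_isSubdifferential hF hβ hR hp hx' hd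
  refine max_le (by linarith) (Real.sSup_le ?_ le_rfl)
  rintro y ⟨R', hR', rfl⟩
  rcases lt_or_ge 0 (M.premium R') with h | h
  · exact M.generator_nonpos_of_premium_pos hF hβ hR' h hx hd
  -- For `p_R ≤ 0` no dynamics is needed: `p_R d ≤ 0` because `d ≥ 1`, the jump term is at most `β V
  -- x`, and `-δ V x ≤ 0` is left.
  · rw [M.generator_eq hF hβ hR']
    have h2 := M.toReal_jumpValue_le hF hβ R' x
    have h3 := mul_nonneg M.δ_pos.le (M.optimalValue_nonneg (F := F) x)
    have h4 := mul_nonpos_of_nonpos_of_nonneg h (zero_le_one.trans h1)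
    linarith

end RiskModel

/-! ### Compactness of the set of reinsurance treaties -/

theorem exists_subseq_tendsto_pi {ι X : Type*} [Finite ι] [TopologicalSpace X] {s : ι → Set X}
    (hs : ∀ j, IsSeqCompact (s j)) {u : ℕ → ι → X} (hu : ∀ i j, u i j ∈ s j) :
    ∃ a : ι → X, (∀ j, a j ∈ s j) ∧ ∃ φ : ℕ → ℕ, StrictMono φ ∧
      Tendsto (u ∘ φ) atTop (𝓝 a) := by
  classical
  have := Fintype.ofFinite ι
  suffices H : ∀ S : Finset ι, ∃ φ : ℕ → ℕ, StrictMono φ ∧ ∀ j ∈ S, ∃ a ∈ s j,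
      Tendsto (fun i => u (φ i) j) atTop (𝓝 a) by
    obtain ⟨φ, hφ, h⟩ := H Finset.univ
    choose a ha h using fun j => h j (Finset.mem_univ j)
    exact ⟨a, ha, φ, hφ, tendsto_pi_nhds.2 h⟩
  intro S
  induction S using Finset.induction_on with
  | empty => exact ⟨id, strictMono_id, by simp⟩
  | insert j S _ ih =>
    obtain ⟨φ, hφ, h⟩ := ih
    obtain ⟨a, ha, ψ, hψ, hlim⟩ := hs j fun i => hu (φ i) j
    refine ⟨φ ∘ ψ, hφ.comp hψ, fun j' hj' => ?_⟩
    rcases Finset.mem_insert.1 hj' with rfl | hj'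
    · exact ⟨a, ha, hlim⟩
    · obtain ⟨b, hb, hb'⟩ := h j' hj'
      exact ⟨b, hb, hb'.comp hψ.tendsto_atTop⟩

theorem tendsto_retained {R : ℕ → Fin n → Retention} {R' : Fin n → Retention}
    (h : Tendsto R atTop (𝓝 R')) (u : Mark n) :
    Tendsto (fun i => retained (R i) u) atTop (𝓝 (retained R' u)) := by
  refine tendsto_finsetSum _ fun j _ => ?_
  split_ifs
  · exact tendsto_pi_nhds.1 (tendsto_pi_nhds.1 h j) (u.2 j)
  · exact tendsto_const_nhds

namespace RiskModel

variable (M : RiskModel m n) {F : Fin n → Set Retention}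

theorem tendsto_premium (hβ : 0 < M.totalβ) {R : ℕ → Fin n → Retention} {R' : Fin n → Retention}
    (hR : ∀ i j, Measurable (R i j)) (hle : ∀ i j α, R i j α ≤ α) (hR' : ∀ j, Measurable (R' j))
    (h : Tendsto R atTop (𝓝 R')) :
    Tendsto (fun i => M.premium (R i)) atTop (𝓝 (M.premium R')) := by
  rw [M.premium_eq hβ hR']
  simp_rw [fun i => M.premium_eq hβ (hR i)]
  have hlim : Tendsto (fun i => M.claimRate (R i)) atTop (𝓝 (M.claimRate R')) :=
    tendsto_lintegral_of_dominated_convergence (fun u => (retained (fun _ => id) u : ℝ≥0∞))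
      (fun i => (measurable_retained_const (hR i)).coe_nnreal_ennreal)
      (fun i => ae_of_all _ fun u => ENNReal.coe_le_coe.2 (retained_le_id (hle i) u))
      M.claimRate_id_ne_top
      (ae_of_all _ fun u => ENNReal.tendsto_coe.2 (tendsto_retained h u))
  have hle' : ∀ j α, R' j α ≤ α := fun j α =>
    le_of_tendsto (tendsto_pi_nhds.1 (tendsto_pi_nhds.1 h j) α) (Eventually.of_forall
      fun i => hle i j α)
  exact (((ENNReal.tendsto_toReal (ne_top_of_le_ne_top M.claimRate_id_ne_top
    (M.claimRate_le_id hle'))).comp hlim).const_mul _).sub_const _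

/-- `V` is continuous on `[0, ∞)` and zero to the left, so its jump at `0` respects upper
semicontinuity, though not continuity. -/
theorem limsup_optimalValueENN_le {R : Fin n → Retention} (hF : ∀ j, IsReinsuranceFamily (F j))
    (hβ : 0 < M.totalβ) (hR : ∀ j, R j ∈ F j) (hp : 0 < M.premium R) {y : ℕ → ℝ} {y' : ℝ}
    (hy : Tendsto y atTop (𝓝 y')) :
    limsup (fun i => M.optimalValueENN F (y i)) atTop ≤ M.optimalValueENN F y' := by
  rcases lt_or_ge y' 0 with h | h
  · refine (limsup_congr (v := fun _ => 0) ?_).le.trans (by simp)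
    filter_upwards [hy.eventually_lt_const h] with i hi
    exact M.optimalValueENN_of_neg hF hβ hi
  · have h1 : Tendsto (fun i => M.optimalValueENN F (max (y i) 0)) atTop
        (𝓝 (M.optimalValueENN F y')) := by
      simp_rw [← M.ofReal_optimalValue hF hβ]
      refine (ENNReal.continuous_ofReal.tendsto _).comp ?_
      refine (M.continuousOn_optimalValue hF hβ hR hp y' h).tendsto.comp ?_
      refine tendsto_nhdsWithin_iff.2 ⟨?_, Eventually.of_forall fun i => mem_Ici.2 (le_max_right _ _)⟩
      simpa [max_eq_left h] using hy.max (tendsto_const_nhds (x := (0 : ℝ)))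
    rw [← h1.limsup_eq]
    exact limsup_le_limsup (Eventually.of_forall fun i =>
      M.optimalValueENN_mono (le_max_left _ _))

/-- A uniform negative bound of the generators persists for slightly larger surplus levels. -/
theorem exists_pos_generator_le {R : Fin n → Retention} (hF : ∀ j, IsReinsuranceFamily (F j))
    (hβ : 0 < M.totalβ) (hR : ∀ j, R j ∈ F j) (hp : 0 < M.premium R) {x d a c : ℝ} (hc : a < c)
    (h : ∀ R : Fin n → Retention, (∀ j, R j ∈ F j) →
      M.premium R * d + (M.jumpValue F R x).toReal ≤ a) :
    ∃ ε > 0, ∀ R : Fin n → Retention, (∀ j, R j ∈ F j) →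
      M.premium R * d + (M.jumpValue F R (x + ε)).toReal ≤ c := by
  by_contra! hcon
  -- Contracts that violate the bound at levels decreasing to `x` have a pointwise limit contract.
  -- Premiums converge by dominated convergence, jump terms are controlled by the reverse Fatou
  -- lemma, and the limit violates the bound at `x`.
  choose R₁ hR₁ hlt using fun i : ℕ => hcon (1 / ((i : ℝ) + 1)) Nat.one_div_pos_of_nat
  obtain ⟨R', hR', φ, hφ, hlim⟩ := exists_subseq_tendsto_pi (fun j => (hF j).isSeqCompact) hR₁
  have hm : ∀ i j, Measurable (R₁ i j) := fun i j => (hF j).measurable _ (hR₁ i j)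
  have hle : ∀ i j α, R₁ i j α ≤ α := fun i j => (hF j).le_self _ (hR₁ i j)
  have hprem := M.tendsto_premium hβ (fun i j => hm (φ i) j) (fun i j => hle (φ i) j)
    (fun j => (hF j).measurable _ (hR' j)) hlim
  have hVm : Measurable (M.optimalValueENN F) := (M.optimalValueENN_mono (F := F)).measurable
  have hε : Tendsto (fun i => 1 / ((φ i : ℝ) + 1)) atTop (𝓝 0) :=
    tendsto_one_div_add_atTop_nhds_zero_nat.comp hφ.tendsto_atTop
  have hsup : limsup (fun i => M.jumpValue F (R₁ (φ i)) (x + 1 / ((φ i : ℝ) + 1))) atTop ≤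
      M.jumpValue F R' x := by
    refine (limsup_lintegral_le (fun _ => M.optimalValueENN F (x + 1)) (fun i => ?_) (fun i => ?_)
      ?_).trans (lintegral_mono fun u => ?_)
    · exact hVm.comp (measurable_const.sub
        (measurable_retained_const (hm (φ i))).coe_nnreal_real)
    · refine ae_of_all _ fun u => M.optimalValueENN_mono ?_
      have h1 : 1 / ((φ i : ℝ) + 1) ≤ 1 := by
        rw [div_le_one (by positivity)]
        linarith [(φ i).cast_nonneg (α := ℝ)]
      linarith [(retained (R₁ (φ i)) u).coe_nonneg]
    · rw [lintegral_const, M.intensity_univ]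
      exact ENNReal.mul_ne_top (M.optimalValueENN_ne_top hF hβ _) ENNReal.ofReal_ne_top
    · refine M.limsup_optimalValueENN_le hF hβ hR hp ?_
      have h1 := (hε.const_add x).sub (NNReal.tendsto_coe.2 (tendsto_retained hlim u))
      simpa using h1
  have hfin := M.jumpValue_ne_top hF hβ R' x
  have h1 : M.jumpValue F R' x < M.jumpValue F R' x + ENNReal.ofReal ((c - a) / 2) :=
    ENNReal.lt_add_right hfin (ENNReal.ofReal_pos.2 (by linarith)).ne'
  have h2 := eventually_lt_of_limsup_lt (hsup.trans_lt h1)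
  have h3 := (hprem.mul_const d).eventually_lt_const
    (show M.premium R' * d < M.premium R' * d + (c - a) / 2 by linarith)
  obtain ⟨i, h4, h5⟩ := (h2.and h3).exists
  have h6 := ENNReal.toReal_mono (ENNReal.add_ne_top.2 ⟨hfin, ENNReal.ofReal_ne_top⟩) h4.le
  rw [ENNReal.toReal_add hfin ENNReal.ofReal_ne_top, ENNReal.toReal_ofReal (by linarith)] at h6
  have h7 := h R' hR'
  have h8 := hlt (φ i)
  linarith

end RiskModel

/-! ### The value function is a subsolution -/

/-- Multiplying by a negative `h` reverses the bound on the left quotients, so both sides give the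
same kind of upper expansion. -/
theorem IsSuperdifferential.exists_le {u : ℝ → ℝ} {x d ε : ℝ} (hd : IsSuperdifferential u x d)
    (hε : 0 < ε) : ∃ ρ > 0, ∀ h, |h| < ρ → u (x + h) ≤ u x + d * h + ε * |h| := by
  have h1 := eventually_lt_of_lt_liminf
    ((EReal.coe_lt_coe_iff.2 (show d - ε < d by linarith)).trans_le hd.1)
  have h2 := eventually_lt_of_limsup_lt
    (hd.2.trans_lt (EReal.coe_lt_coe_iff.2 (show d < d + ε by linarith)))
  rw [eventually_nhdsWithin_iff, Metric.eventually_nhds_iff] at h1 h2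
  obtain ⟨ρ₁, hρ₁, h1⟩ := h1
  obtain ⟨ρ₂, hρ₂, h2⟩ := h2
  refine ⟨min ρ₁ ρ₂, lt_min hρ₁ hρ₂, fun h hh => ?_⟩
  have hdist : dist h 0 = |h| := by rw [Real.dist_eq, sub_zero]
  rcases lt_trichotomy h 0 with h0 | rfl | h0
  · have h3 := EReal.coe_lt_coe_iff.1 (h1 (hdist ▸ hh.trans_le (min_le_left _ _)) h0)
    rw [lt_div_iff_of_neg h0] at h3
    rw [abs_of_neg h0]
    linarith
  · simp
  · have h3 := EReal.coe_lt_coe_iff.1 (h2 (hdist ▸ hh.trans_le (min_le_right _ _)) h0)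
    rw [div_lt_iff₀ h0] at h3
    rw [abs_of_pos h0]
    linarith

namespace RiskModel

variable (M : RiskModel m n) {F : Fin n → Set Retention}

/-- A strategy is controlled on a short time interval if the generators at slightly larger surplus
levels are bounded. -/
theorem Strategy.value_le_of_generator_le {M : RiskModel m n}
    (hF : ∀ j, IsReinsuranceFamily (F j)) (hβ : 0 < M.totalβ) (π : M.Strategy F) {x d a ε T : ℝ}
    (hT : 0 ≤ T) (hTε : M.premiumBound * T ≤ ε)
    (h : ∀ R : Fin n → Retention, (∀ j, R j ∈ F j) →
      M.premium R * d + (M.jumpValue F R (x + ε)).toReal ≤ a) :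
    π.value x ≤ π.earlyDividends x (quiet m n) T +
      ENNReal.ofReal (Real.exp (-((M.δ + M.totalβ) * T))) *
        {_s : Unit | π.Solvent x (quiet m n) T}.indicator (fun _ =>
          M.optimalValueENN F (π.surplus x (quiet m n) T)) () +
      ENNReal.ofReal (a * T - d * ∫ t in (0 : ℝ)..T, M.premium (π.R t (quiet m n))) := by
  refine (π.value_le hF hβ hT x).trans (add_le_add le_rfl ?_)
  have h1 : ∀ t, M.premium (π.R t (quiet m n)) * d +
      (M.jumpValue F (π.R t (quiet m n)) (x + ε)).toReal ≤ a := fun t => h _ (π.R_mem t _)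
  have hint := π.intervalIntegrable_premium hF hβ (quiet m n) 0 T
  -- The generator bound replaces the jump term at time `t` by `a - d p_{R_t}`; after integration,
  -- the strategy enters only through its total premium.
  have hI : a * T - d * ∫ t in (0 : ℝ)..T, M.premium (π.R t (quiet m n)) =
      ∫ t in Ico 0 T, (a - d * M.premium (π.R t (quiet m n))) := by
    rw [integral_Ico_eq_integral_Ioc, ← intervalIntegral.integral_of_le hT,
      intervalIntegral.integral_sub intervalIntegrable_const (hint.const_mul d),
      intervalIntegral.integral_const, intervalIntegral.integral_const_mul, sub_zero, smul_eq_mul,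
      mul_comm]
  have hint' : IntegrableOn (fun t => a - d * M.premium (π.R t (quiet m n))) (Ico 0 T) := by
    rw [← intervalIntegrable_iff_integrableOn_Ico_of_le hT]
    exact intervalIntegrable_const.sub (hint.const_mul d)
  rw [hI, ofReal_integral_eq_lintegral_ofReal hint' (ae_of_all _ fun t => ?_)]
  · refine lintegral_mono fun t => ?_
    refine le_trans (M.jumpValue_mono (F := F) (π.R t (quiet m n)) (add_le_add le_rfl hTε)) ?_
    rw [← ENNReal.ofReal_toReal (M.jumpValue_ne_top hF hβ _ _)]
    exact ENNReal.ofReal_le_ofReal (by linarith [h1 t])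
  · have := h1 t
    have h2 := ENNReal.toReal_nonneg (a := M.jumpValue F (π.R t (quiet m n)) (x + ε))
    simp only [Pi.zero_apply]
    linarith

/-- Real form of the short-time bound, in the two cases of a ruinous and of a solvent path. -/
theorem Strategy.toReal_value_le {M : RiskModel m n}
    (hF : ∀ j, IsReinsuranceFamily (F j)) (hβ : 0 < M.totalβ)
    (π : M.Strategy F) {x d a ε T : ℝ} (hx : 0 ≤ x)
    (hT : 0 < T) (hTε : M.premiumBound * T ≤ ε)
    (h : ∀ R : Fin n → Retention, (∀ j, R j ∈ F j) →
      M.premium R * d + (M.jumpValue F R (x + ε)).toReal ≤ a) :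
    ∃ Q, |Q| ≤ M.premiumBound * T ∧
      ((π.value x).toReal ≤ x + M.premiumBound * T + (a * T - d * Q) ∨
      ∃ D, 0 ≤ D ∧ D ≤ x + Q ∧ (π.value x).toReal ≤ D +
        Real.exp (-((M.δ + M.totalβ) * T)) * M.optimalValue F (x + Q - D) + (a * T - d * Q)) := by
  have hP := M.premiumBound_nonneg
  have hPT : 0 ≤ M.premiumBound * T := mul_nonneg hP hT.le
  have hle := π.value_le_of_generator_le hF hβ hT.le hTε h
  set Q := ∫ t in (0 : ℝ)..T, M.premium (π.R t (quiet m n)) with hQ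
  have hQle : |Q| ≤ M.premiumBound * T := π.abs_integral_premium_le hF hβ _ hT.le
  set D := π.D T (quiet m n)
  have hD0 : 0 ≤ D := π.D_nonneg _ _
  have hsurplus : π.surplus x (quiet m n) T = x + Q - D := π.surplus_quiet x T
  have haQ : 0 ≤ a * T - d * Q := by
    have h1 : ∀ t, 0 ≤ a - d * M.premium (π.R t (quiet m n)) := fun t => by
      have := h _ (π.R_mem t (quiet m n))
      have h2 := ENNReal.toReal_nonneg (a := M.jumpValue F (π.R t (quiet m n)) (x + ε))
      linarith
    have h2 := intervalIntegral.integral_nonneg (μ := volume) hT.le fun t _ => h1 t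
    rwa [intervalIntegral.integral_sub intervalIntegrable_const
      ((π.intervalIntegrable_premium hF hβ (quiet m n) 0 T).const_mul d),
      intervalIntegral.integral_const, intervalIntegral.integral_const_mul, sub_zero, smul_eq_mul,
      mul_comm T] at h2
  refine ⟨Q, hQle, ?_⟩
  -- Solvency before `T` does not exclude a negative surplus at `T`. As `V` vanishes there, this
  -- belongs to the ruinous case.
  by_cases hS : π.Solvent x (quiet m n) T ∧ 0 ≤ x + Q - D
  · right
    refine ⟨D, hD0, by linarith [hS.2], ?_⟩
    have hS' : () ∈ {_s : Unit | π.Solvent x (quiet m n) T} := hS.1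
    rw [indicator_of_mem hS', hsurplus, ← M.ofReal_optimalValue hF hβ,
      ← ENNReal.ofReal_mul (Real.exp_pos _).le] at hle
    have hE : 0 ≤ Real.exp (-((M.δ + M.totalβ) * T)) * M.optimalValue F (x + Q - D) :=
      mul_nonneg (Real.exp_pos _).le (M.optimalValue_nonneg _)
    refine ENNReal.toReal_le_of_le_ofReal (by linarith) (hle.trans ?_)
    rw [ENNReal.ofReal_add (by linarith) haQ, ENNReal.ofReal_add hD0 hE]
    gcongr
    exact π.earlyDividends_le_D x _ T
  · left
    have h0 : {_s : Unit | π.Solvent x (quiet m n) T}.indicator (fun _ =>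
        M.optimalValueENN F (π.surplus x (quiet m n) T)) () = 0 := by
      by_cases h1 : π.Solvent x (quiet m n) T
      · have h2 : x + Q - D < 0 := not_le.1 fun h2 => hS ⟨h1, h2⟩
        rw [hsurplus, M.optimalValueENN_of_neg hF hβ h2]
        simp
      · exact indicator_of_notMem h1 _
    rw [h0, mul_zero, add_zero] at hle
    refine ENNReal.toReal_le_of_le_ofReal (by linarith) (hle.trans ?_)
    rw [ENNReal.ofReal_add (by linarith) haQ]
    gcongr
    exact π.earlyDividends_le hF hβ x _ T

/-- Ruin forfeits `V 0`; small dividends leave the deficit `c T / 2` of the generators, up to errors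
of `3 c T / 16`; large dividends cost about `d - 1` per unit on their first `ρ / 2`. Since `T` is
fixed before the strategy, the loss is uniform. -/
theorem exists_uniform_lt {R : Fin n → Retention} (hF : ∀ j, IsReinsuranceFamily (F j))
    (hβ : 0 < M.totalβ) (hR : ∀ j, R j ∈ F j) (hp : 0 < M.premium R) {x d c : ℝ} (hx : 0 ≤ x)
    (hd : IsSuperdifferential (M.optimalValue F) x d) (hd1 : 1 < d) (hc : 0 < c)
    (h : ∀ R : Fin n → Retention, (∀ j, R j ∈ F j) → M.premium R * d +
      (M.jumpValue F R x).toReal ≤ (M.δ + M.totalβ) * M.optimalValue F x - c) :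
    ∃ κ > 0, ∀ π : M.Strategy F, (π.value x).toReal ≤ M.optimalValue F x - κ := by
  set V := M.optimalValue F with hVdef
  set lam := M.δ + M.totalβ with hlam
  set P := M.premiumBound with hPdef
  have hP : 0 ≤ P := M.premiumBound_nonneg
  have hlam0 : 0 < lam := add_pos M.δ_pos hβ
  have hV0 : 0 < V 0 := M.optimalValue_pos hF hβ hR hp le_rfl
  have hVn : ∀ y, 0 ≤ V y := M.optimalValue_nonneg
  have hVmono : Monotone V := M.optimalValue_mono hF hβ
  obtain ⟨ε₀, hε₀, hgen⟩ := M.exists_pos_generator_le hF hβ hR hp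
    (show lam * V x - c < lam * V x - c / 2 by linarith) h
  -- The first bound lets the loss `d - 1` per unit of dividends dominate the expansion error; the
  -- second keeps `ε P T` below `c T / 16`.
  set ε := min ((d - 1) / 2) (c / (16 * (P + 1))) with hε
  have hε0 : 0 < ε := lt_min (by linarith) (by positivity)
  have hε1 : ε ≤ (d - 1) / 2 := min_le_left _ _
  have hε2 : ε * P ≤ c / 16 := by
    have h1 : ε * (P + 1) ≤ c / (16 * (P + 1)) * (P + 1) :=
      mul_le_mul_of_nonneg_right (min_le_right _ _) (by linarith)
    have h2 : c / (16 * (P + 1)) * (P + 1) = c / 16 := by field_simp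
    linarith
  obtain ⟨ρ₁, hρ₁, hexp⟩ := hd.exists_le hε0
  obtain ⟨ρ₂, hρ₂, hcont⟩ := Metric.continuousOn_iff.1
    (M.continuousOn_optimalValue hF hβ hR hp) x hx (c / (16 * lam)) (by positivity)
  set ρ := min ρ₁ ρ₂ with hρ
  have hρ0 : 0 < ρ := lt_min hρ₁ hρ₂
  set W := V (x + P) with hW
  -- `C T` majorises the terms of order `T` that have to be absorbed in the cases of ruin and of
  -- large dividends.
  set C := P + lam * V x + d * P + lam ^ 2 * W + lam * V x + ε * P + 1 with hC
  have hW0 : 0 ≤ W := hVn _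
  have hC1 : 1 ≤ C := by
    have := hVn x
    have : 0 ≤ P + lam * V x + d * P + lam ^ 2 * W + lam * V x + ε * P := by positivity
    linarith
  -- a common short time
  have hsmall : ∀ᶠ T in 𝓝[>] (0 : ℝ), 0 < T ∧ T < 1 ∧ P * T < ε₀ ∧ P * T < ρ / 2 ∧ lam * T < 1 ∧
      C * T < V 0 / 2 ∧ lam ^ 2 * W * T < c / 16 ∧ C * T < (d - 1) * (ρ / 2) / 4 := by
    have h1 : ∀ K b : ℝ, 0 < b → ∀ᶠ T in 𝓝[>] (0 : ℝ), K * T < b := fun K b hb => by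
      have h2 : Tendsto (fun T : ℝ => K * T) (𝓝[>] 0) (𝓝 (K * 0)) :=
        (tendsto_id.const_mul K).mono_left nhdsWithin_le_nhds
      rw [mul_zero] at h2
      exact h2.eventually_lt_const hb
    have h3 : 0 < (d - 1) * (ρ / 2) / 4 := by
      have := sub_pos.2 hd1
      positivity
    filter_upwards [self_mem_nhdsWithin, h1 1 1 one_pos, h1 P ε₀ hε₀, h1 P (ρ / 2) (by linarith),
      h1 lam 1 one_pos, h1 C (V 0 / 2) (by linarith), h1 (lam ^ 2 * W) (c / 16) (by linarith),
      h1 C _ h3] with T a0 a1 a2 a3 a4 a5 a6 a7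
    exact ⟨a0, by linarith, a2, a3, a4, a5, a6, a7⟩
  obtain ⟨T, hT0, hT1, hTε, hTρ, hTlam, hTV, hTW, hTd⟩ := hsmall.exists
  refine ⟨min (V 0 / 2) (min (c * T / 8) ((d - 1) * (ρ / 2) / 4)),
    lt_min (by linarith) (lt_min (by positivity) (by
      have := sub_pos.2 hd1
      positivity)), fun π => ?_⟩
  set κ := min (V 0 / 2) (min (c * T / 8) ((d - 1) * (ρ / 2) / 4))
  have hκ1 : κ ≤ V 0 / 2 := min_le_left _ _
  have hκ2 : κ ≤ c * T / 8 := (min_le_right _ _).trans (min_le_left _ _)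
  have hκ3 : κ ≤ (d - 1) * (ρ / 2) / 4 := (min_le_right _ _).trans (min_le_right _ _)
  obtain ⟨Q, hQ, hcase⟩ := π.toReal_value_le hF hβ hx hT0 hTε.le hgen
  obtain ⟨hQ1, hQ2⟩ := abs_le.1 hQ
  have hdQ : -(d * Q) ≤ d * P * T := by
    have := mul_le_mul_of_nonneg_left hQ1 (show 0 ≤ d by linarith)
    linarith
  have hcT : 0 < c * T := by positivity
  have hVx0 := hVn x
  have hCT : C * T = P * T + lam * V x * T + d * P * T + lam ^ 2 * W * T + lam * V x * T +
    ε * P * T + T := by rw [hC]; ring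
  have hn1 : 0 ≤ P * T := by positivity
  have hn2 : 0 ≤ lam * V x * T := by positivity
  have hn3 : 0 ≤ d * P * T := by positivity
  have hn4 : 0 ≤ lam ^ 2 * W * T := by positivity
  have hn5 : 0 ≤ ε * P * T := by positivity
  rcases hcase with hcase | ⟨D, hD0, hDx, hcase⟩
  -- Ruin: the strategy obtains little more than `x`, whereas paying `x` at once leaves `V 0` in
  -- addition.
  · have h1 := M.optimalValue_add_le hF hβ hR hp le_rfl hx
    rw [zero_add] at h1
    change V 0 + x ≤ V x at h1
    have : (lam * V x - c / 2) * T = lam * V x * T - c * T / 2 := by ring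
    rw [this] at hcase
    linarith
  · set z := x + Q - D with hz
    have hz0 : 0 ≤ z := by linarith
    have hzW : V z ≤ W := hVmono (by
      have : P * T ≤ P * 1 := mul_le_mul_of_nonneg_left hT1.le hP
      linarith)
    have hexpT : Real.exp (-(lam * T)) ≤ 1 - lam * T + (lam * T) ^ 2 := by
      have h1 : 0 < lam * T := by positivity
      have h2 := Real.abs_exp_sub_one_sub_id_le (x := -(lam * T))
        (by rw [abs_neg, abs_of_pos h1]; exact hTlam.le)
      have h3 := (abs_le.1 h2).2
      rw [neg_sq] at h3
      linarith
    have hmul : Real.exp (-(lam * T)) * V z ≤ V z - lam * T * V z + lam ^ 2 * W * T * T := by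
      have h1 := mul_le_mul_of_nonneg_right hexpT (hVn z)
      have h2 : (lam * T) ^ 2 * V z ≤ (lam * T) ^ 2 * W :=
        mul_le_mul_of_nonneg_left hzW (by positivity)
      have h3 : (lam * T) ^ 2 * W = lam ^ 2 * W * T * T := by ring
      linarith
    have hval : (π.value x).toReal ≤ D + V z + lam * T * (V x - V z) + lam ^ 2 * W * T * T -
        c * T / 2 - d * Q := by linarith
    rcases le_or_gt D (ρ / 2) with hDρ | hDρ
    -- Small dividends: `d * Q` cancels against the expansion at `x + Q - D`, and `D` contributes
    -- `-D (d - 1 - ε) ≤ 0`.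
    · have hdist : |Q - D| < ρ := by
        rw [abs_lt]
        constructor <;> linarith
      have hxz : x + (Q - D) = z := by rw [hz]; ring
      have h1 := hexp (Q - D) (hdist.trans_le (min_le_left _ _))
      rw [hxz] at h1
      have h2 := hcont z hz0 (by
        rw [Real.dist_eq, hz, add_sub_assoc, add_sub_cancel_left]
        exact hdist.trans_le (min_le_right _ _))
      rw [Real.dist_eq] at h2
      have h3 : lam * T * (V x - V z) ≤ c * T / 16 := by
        have h4 : V x - V z ≤ c / (16 * lam) := by linarith [(abs_lt.1 h2).1]
        have h5 := mul_le_mul_of_nonneg_left h4 (show 0 ≤ lam * T by positivity)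
        have h6 : lam * T * (c / (16 * lam)) = c * T / 16 := by field_simp
        linarith
      have h4 : ε * |Q - D| ≤ ε * (P * T + D) := by
        refine mul_le_mul_of_nonneg_left ?_ hε0.le
        rw [abs_le]
        constructor <;> linarith
      have h5 : ε * P * T ≤ c / 16 * T := mul_le_mul_of_nonneg_right hε2 hT0.le
      have h6 : lam ^ 2 * W * T * T ≤ c / 16 * T := mul_le_mul_of_nonneg_right hTW.le hT0.le
      have h7 : 0 ≤ D * (d - 1 - ε) := mul_nonneg hD0 (by linarith)
      linarith
    -- Large dividends: the excess over `ρ / 2` is returned to the surplus without loss, which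
    -- brings the level into the range of the expansion.
    · have h1 := M.optimalValue_add_le hF hβ hR hp hz0 (h := D - ρ / 2) (by linarith)
      have hz' : z + (D - ρ / 2) = x + (Q - ρ / 2) := by rw [hz]; ring
      rw [hz'] at h1
      have hdist : |Q - ρ / 2| < ρ := by
        rw [abs_lt]
        constructor <;> linarith
      have h2 := hexp (Q - ρ / 2) (hdist.trans_le (min_le_left _ _))
      have h4 : ε * |Q - ρ / 2| ≤ ε * (P * T + ρ / 2) := by
        refine mul_le_mul_of_nonneg_left ?_ hε0.le
        rw [abs_le]
        constructor <;> linarith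
      have h5 : (d - 1) * (ρ / 2) / 2 ≤ (d - 1 - ε) * (ρ / 2) := by
        have := mul_le_mul_of_nonneg_right (show (d - 1) / 2 ≤ d - 1 - ε by linarith)
          (show 0 ≤ ρ / 2 by linarith)
        linarith
      have h6 : lam * T * (V x - V z) ≤ lam * V x * T := by
        have := mul_nonneg (show 0 ≤ lam * T by positivity) (hVn z)
        linarith
      have h7 : lam ^ 2 * W * T * T ≤ lam ^ 2 * W * T * 1 := mul_le_mul_of_nonneg_left hT1.le hn4
      linarith

theorem isViscositySubsolutionAt_optimalValue {R : Fin n → Retention}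
    (hF : ∀ j, IsReinsuranceFamily (F j)) (hβ : 0 < M.totalβ) (hR : ∀ j, R j ∈ F j)
    (hp : 0 < M.premium R) {x : ℝ} (hx : 0 ≤ x) :
    IsViscositySubsolutionAt (M.hjb F) (M.optimalValue F) x := by
  refine ⟨M.locallyLipschitzOn_optimalValue hF hβ hR hp, fun d hd => ?_⟩
  by_contra hcon
  obtain ⟨h1, h2⟩ := max_lt_iff.1 (not_le.1 hcon)
  set S := {y | ∃ R : Fin n → Retention, (∀ j, R j ∈ F j) ∧
    y = M.generator R x (M.optimalValue F x) d (M.optimalValue F)}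
  have hd0 : 0 ≤ d := by linarith
  -- Without boundedness the real `sSup` need not dominate the individual generators.
  have hS : BddAbove S := by
    refine ⟨M.premiumBound * d - (M.δ + M.totalβ) * M.optimalValue F x +
      M.totalβ * M.optimalValue F x, ?_⟩
    rintro y ⟨R', hR', rfl⟩
    rw [M.generator_eq hF hβ hR']
    have h3 := (abs_le.1 (M.abs_premium_le hβ (fun j => (hF j).measurable _ (hR' j))
      fun j => (hF j).le_self _ (hR' j))).2
    have h4 := mul_le_mul_of_nonneg_right h3 hd0
    have h5 := M.toReal_jumpValue_le hF hβ R' x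
    linarith
  obtain ⟨κ, hκ, hle⟩ := M.exists_uniform_lt hF hβ hR hp hx hd (by linarith)
    (neg_pos.2 h2) fun R' hR' => by
      have h3 := le_csSup hS ⟨R', hR', rfl⟩
      rw [M.generator_eq hF hβ hR'] at h3
      linarith
  have hVfin := M.optimalValueENN_ne_top hF hβ x
  have h0 : 0 ≤ M.optimalValue F x - κ :=
    ENNReal.toReal_nonneg.trans (hle (Strategy.const M hF R hR))
  have h3 : M.optimalValueENN F x ≤ ENNReal.ofReal (M.optimalValue F x - κ) := by
    refine iSup_le fun π => ?_
    rw [← ENNReal.ofReal_toReal (ne_top_of_le_ne_top hVfin (le_iSup (fun π : M.Strategy F =>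
      π.value x) π))]
    exact ENNReal.ofReal_le_ofReal (hle π)
  rw [← M.ofReal_optimalValue hF hβ, ENNReal.ofReal_le_ofReal_iff h0] at h3
  linarith

end RiskModel

end

end ThinningRisk

theorem mainTheorem2 {m n : ℕ} (M : ThinningRisk.RiskModel m n)
    (F : Fin n → Set ThinningRisk.Retention)
    (hF : ∀ j, ThinningRisk.IsReinsuranceFamily (F j))
    (hprem : ∃ R : Fin n → ThinningRisk.Retention, (∀ j, R j ∈ F j) ∧ 0 < M.premium R) :
    (∀ x : ℝ, 0 ≤ x → M.optimalValueENN F x ≠ ⊤) ∧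
      ∀ x : ℝ, 0 ≤ x →
        ThinningRisk.IsViscositySolutionAt (M.hjb F) (M.optimalValue F) x := by
  obtain ⟨R, hR, hp⟩ := hprem
  have hβ := M.totalβ_pos_of_premium_pos hp
  exact ⟨fun x _ => M.optimalValueENN_ne_top hF hβ x, fun x hx =>
    ⟨M.isViscositySubsolutionAt_optimalValue hF hβ hR hp hx,
      M.isViscositySupersolutionAt_optimalValue hF hβ hR hp hx⟩⟩
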